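/- **The maps $f_r$.** Let $\lambda\ge 14$ be real, let $r\ge 1$ be an integer, and put $I=[0,4]$, $\delta=\lambda^{-r}$. For $n\ge1$ set $x_n=1+\frac1n$, $y_n=x_n+\frac1{2n^2}$, $M_n=2\left\lfloor\frac{\lambda^n}{2n^2}\right\rfloor-1$, $m_n=1-\frac1{(n+1)^2}$, $k_n=\frac{2\lambda^r}{M_n}$ and $w_n=y_{n+1}+\frac{n+2}{2n(n+1)^2M_{n+1}k_{n+1}}$. A map $f_r\colon I\to I$ is any map obtained by the following construction (which leaves some choices free). * $f_r$ is $C^\infty$ on $I\setminus\{1\}$. * For $n\ge1$ and $x\in[x_n,y_n]$: $f_r(x)=\lambda^{-nr}\left[x_n+(y_n-x_n)\,s_n\!\left(M_n\frac{x-x_n}{y_n-x_n}\right)\right]$, where $s_n\colon[0,M_n]\to[-m_n,1]$, $n\ge1$, are $C^\infty$ functions such that: $s_n(0)=0$, $s_n(M_n)=1$; $s_n$ is (strictly) increasing on each $[2k,2k+1]\subset[0,M_n]$ and decreasing on each $[2k+1,2k+2]\subset[0,M_n]$; $s_n(t)=1-\frac{1}{4\delta^2}(t-j)^2$ for $|t-j|\le\delta$,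 $j$ an odd integer, $0<j<M_n$; $s_n(t)=-m_n+\frac1{4\delta^2}(t-j)^2$ for $|t-j|\le\delta$, $j$ an even integer, $0<j<M_n$; $s_n(t)=k_n(t-M_n)+1$ on $[M_n-\delta,M_n]$; $s_n(t)=k_nt$ on $[0,\delta]$; for every $k\ge1$, $\sup_n\|s_n^{(k)}\|_\infty<\infty$; $\|s_n'\|_\infty\le\lambda^r$; and $|s_n'(t)|\ge\min\{\frac12,k_n\}$ whenever $|t-j|\ge\delta$ for all integers $0<j<M_n$. * For $n\ge1$: on $[y_{n+1},w_n]$, $f_r$ is affine of slope $\lambda^{-(n+1)r}M_{n+1}k_{n+1}$, with $f_r(y_{n+1})=\lambda^{-(n+1)r}y_{n+1}$. On $[w_n,x_n]$, the normalized functions $\varphi_n(t)=\dfrac{f_r(w_n+(x_n-w_n)t)-f_r(w_n)}{f_r(x_n)-f_r(w_n)}$, $t\in[0,1]$, satisfy $\sup_n\|\varphi_n^{(k)}\|_\infty<\infty$ for every $k\ge1$, and $\frac23\varphi_n'(0)\le\varphi_n'(t)\le\lambda^r$ for all $t\in[0,1]$. * $f_r(x)=\lambda^rx$ on $[0,\frac52\delta]$;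 $f_r(x)=4-\frac{3}{2\delta}(x-\frac12)^2$ for $|x-\frac12|\le\delta$; $f_r(x)=\delta^{1-2r}(x-1)^{2r}$ on $[1-\delta,1]$; $f_r(x)=4+\lambda^r(x-4)$ on $[4-\frac32\delta,4]$. * $\frac32\le f_r'\le\lambda^r$ on $[\frac52\delta,\frac12-\delta]$ and on $[y_1,4]$, and $-\lambda^r\le f_r'\le-\frac32$ on $[\frac12+\delta,1-\delta]$. **Local entropy.** For a continuous map $T\colon X\to X$ of a compact metric space let $B_n(x,\varepsilon)=\{y: d(T^ky,T^kx)<\varepsilon,\ 0\le k<n\}$, and for $Y\subset X$ let $s_n(T,\delta,Y)$ be the maximal cardinality of a set $E\subset Y$ such that any two distinct $y,y'\in E$ satisfy $d(T^ky,T^ky')>\delta$ for some $0\le k<n$. Then $$h_{loc}(T)=\lim_{\varepsilon\to0}\lim_{\delta\to0}\limsup_{n\to\infty}\frac1n\sup_{x\in X}\log s_n(T,\delta,B_n(x,\varepsilon)).$$ For a $C^1$ map $f\colon I\to I$ let $R(f)=\inf_{k\ge1}\|(f^k)'\|_\infty^{1/k}$, and let $h_{top}$ be the topological entropy. **Proposition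 3.6.** For all $\lambda\ge14$ and $r\ge1$ such maps $f_r$ exist, and every such $f_r$ is $C^r$ on $I$ with $R(f_r)=\lambda^r$ and $$h_{loc}(f_r)=\frac{\log R(f_r)}{r}=\log\lambda=h_{top}(f_r).$$ In particular Buzzi's upper bound $h_{loc}(f)\le\frac{\log R(f)}{r}$ for $C^r$ interval maps $f$ is attained for every $r\ge1$. -/

import Mathlib

open Set Filter Topology
open scoped ENNReal ContDiff

/-! ### Bowen balls, separated sets, local entropy -/

section LocalEntropy

/-- The Bowen ball of radius `ε` and order `n` centred at `x`. -/
def bowenBall {X : Type*} [MetricSpace X] (T : X → X) (n : ℕ) (x : X) (ε : ℝ) : Set X :=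
  {y | ∀ k < n, dist (T^[k] y) (T^[k] x) < ε}

/-- `E` is an `(ε, n)`-separated subset of `Y`. -/
def IsDynSeparated {X : Type*} [MetricSpace X] (T : X → X) (ε : ℝ) (n : ℕ) (Y E : Set X) : Prop :=
  E ⊆ Y ∧ ∀ y ∈ E, ∀ y' ∈ E, y ≠ y' → ∃ k < n, ε < dist (T^[k] y) (T^[k] y')

/-- The maximal cardinality `s_n(T, ε, Y)` of an `(ε, n)`-separated subset of `Y`. -/
noncomputable def sepCard {X : Type*} [MetricSpace X] (T : X → X) (ε : ℝ) (n : ℕ) (Y : Set X) :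
    ℕ∞ :=
  ⨆ (E : Set X) (_ : IsDynSeparated T ε n Y E), E.encard

/-- `limsup_n (1/n) sup_x log s_n(T, δ, B_n(x, ε))`, as an extended real. -/
noncomputable def localEntropyAt {X : Type*} [MetricSpace X] (T : X → X) (ε δ : ℝ) : EReal :=
  limsup (fun n : ℕ =>
    (⨆ x : X, ENNReal.log (sepCard T δ n (bowenBall T n x ε) : ℝ≥0∞)) / (n : EReal)) atTop

/-- Buzzi's local entropy `lim_{ε → 0} lim_{δ → 0} limsup_n (1/n) sup_x log s_n(T, δ, B_n(x, ε))`.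
The quantity increases as `δ` decreases to `0` and then decreases as `ε` decreases to `0`, so the
two limits exist and are a supremum and an infimum: this is shown in
`tendsto_localEntropyAt` and `tendsto_localEntropy`. -/
noncomputable def localEntropy {X : Type*} [MetricSpace X] (T : X → X) : EReal :=
  ⨅ ε ∈ Ioi (0 : ℝ), ⨆ δ ∈ Ioi (0 : ℝ), localEntropyAt T ε δ

theorem localEntropyAt_mono {X : Type*} [MetricSpace X] (T : X → X) {ε ε' δ δ' : ℝ}
    (hε : ε ≤ ε') (hδ : δ' ≤ δ) : localEntropyAt T ε δ ≤ localEntropyAt T ε' δ' := by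
  refine limsup_le_limsup (Eventually.of_forall fun n => ?_)
  refine EReal.div_le_div_right_of_nonneg (by positivity) (iSup_mono fun x => ?_)
  refine ENNReal.log_monotone (ENat.toENNReal_le.2 ?_)
  refine iSup₂_le fun E hE => le_iSup₂_of_le E ⟨fun y hy k hk => ?_, fun y hy y' hy' h => ?_⟩ le_rfl
  · exact (hE.1 hy k hk).trans_le hε
  · obtain ⟨k, hk, h'⟩ := hE.2 y hy y' hy' h
    exact ⟨k, hk, hδ.trans_lt h'⟩

theorem tendsto_localEntropyAt {X : Type*} [MetricSpace X] (T : X → X) (ε : ℝ) :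
    Tendsto (fun δ => localEntropyAt T ε δ) (𝓝[>] 0)
      (𝓝 (⨆ δ ∈ Ioi (0 : ℝ), localEntropyAt T ε δ)) := by
  have h : Antitone (fun δ => localEntropyAt T ε δ) :=
    fun a b hab => localEntropyAt_mono T le_rfl hab
  simpa only [sSup_image] using h.tendsto_nhdsGT 0

theorem tendsto_localEntropy {X : Type*} [MetricSpace X] (T : X → X) :
    Tendsto (fun ε => ⨆ δ ∈ Ioi (0 : ℝ), localEntropyAt T ε δ) (𝓝[>] 0) (𝓝 (localEntropy T)) := by
  have h : Monotone (fun ε => ⨆ δ ∈ Ioi (0 : ℝ), localEntropyAt T ε δ) :=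
    fun a b hab => iSup₂_mono fun δ _ => localEntropyAt_mono T hab le_rfl
  simpa only [sInf_image, localEntropy] using h.tendsto_nhdsGT 0

end LocalEntropy

/-- `R(f) = inf_{k ≥ 1} ‖(f^k)'‖_∞^{1/k}`, the sup norm being taken over the interval `I`. -/
noncomputable def derivSpectralRadius (I : Set ℝ) (f : ℝ → ℝ) : ℝ :=
  ⨅ k : ℕ+, (⨆ x : I, |derivWithin (f^[(k : ℕ)]) I x|) ^ ((k : ℝ)⁻¹)

/-! ### The maps `f_r`

The parameters are a real number `lam ≥ 14` and an integer `r ≥ 1`; the sequences are used for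
indices `n ≥ 1`. -/

namespace Ruette

/-- `x_n = 1 + 1/n`. -/
noncomputable def x (n : ℕ) : ℝ := 1 + 1 / n

/-- `y_n = x_n + 1/(2n²)`. -/
noncomputable def y (n : ℕ) : ℝ := x n + 1 / (2 * n ^ 2)

/-- `M_n = 2[λ^n/(2n²)] - 1`; for `λ ≥ 14` and `n ≥ 1` the integer part is at least `7`, so the
subtraction does not truncate. -/
noncomputable def M (lam : ℝ) (n : ℕ) : ℕ := 2 * ⌊lam ^ n / (2 * n ^ 2)⌋₊ - 1

/-- `m_n = 1 - 1/(n+1)²`. -/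
noncomputable def m (n : ℕ) : ℝ := 1 - 1 / (n + 1) ^ 2

/-- `δ = λ^{-r}`. -/
noncomputable def delta (lam : ℝ) (r : ℕ) : ℝ := (lam ^ r)⁻¹

/-- `k_n = 2λ^r/M_n`. -/
noncomputable def slope (lam : ℝ) (r n : ℕ) : ℝ := 2 * lam ^ r / M lam n

/-- `w_n = y_{n+1} + (n+2)/(2n(n+1)² M_{n+1} k_{n+1})`. -/
noncomputable def w (lam : ℝ) (r n : ℕ) : ℝ :=
  y (n + 1) + (n + 2) / (2 * n * (n + 1) ^ 2 * M lam (n + 1) * slope lam r (n + 1))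

/-- The conditions on the oscillating functions `s_n : [0, M_n] → [-m_n, 1]`, `n ≥ 1`. The interior
local extrema of `s_n` are the integers `j` with `0 < j < M_n`: maxima for odd `j`, minima for
even `j`. -/
structure IsOscillation (lam : ℝ) (r : ℕ) (s : ℕ → ℝ → ℝ) : Prop where
  smooth : ∀ n ≥ 1, ContDiffOn ℝ ∞ (s n) (Icc 0 (M lam n))
  mapsTo : ∀ n ≥ 1, MapsTo (s n) (Icc 0 (M lam n)) (Icc (-m n) 1)
  left_end : ∀ n ≥ 1, s n 0 = 0
  right_end : ∀ n ≥ 1, s n (M lam n) = 1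
  increasing : ∀ n ≥ 1, ∀ k : ℕ, 2 * k + 1 ≤ M lam n →
    StrictMonoOn (s n) (Icc (2 * k) (2 * k + 1))
  decreasing : ∀ n ≥ 1, ∀ k : ℕ, 2 * k + 2 ≤ M lam n →
    StrictAntiOn (s n) (Icc (2 * k + 1) (2 * k + 2))
  near_max : ∀ n ≥ 1, ∀ j : ℕ, 0 < j → j < M lam n → Odd j → ∀ t : ℝ, |t - j| ≤ delta lam r →
    s n t = 1 - 1 / (4 * delta lam r ^ 2) * (t - j) ^ 2
  near_min : ∀ n ≥ 1, ∀ j : ℕ, 0 < j → j < M lam n → Even j → ∀ t : ℝ, |t - j| ≤ delta lam r →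
    s n t = -m n + 1 / (4 * delta lam r ^ 2) * (t - j) ^ 2
  near_right : ∀ n ≥ 1, ∀ t ∈ Icc ((M lam n : ℝ) - delta lam r) (M lam n),
    s n t = slope lam r n * (t - M lam n) + 1
  near_left : ∀ n ≥ 1, ∀ t ∈ Icc 0 (delta lam r), s n t = slope lam r n * t
  deriv_bounded : ∀ k ≥ 1, ∃ A : ℝ, ∀ n ≥ 1, ∀ t ∈ Icc (0 : ℝ) (M lam n),
    |iteratedDerivWithin k (s n) (Icc 0 (M lam n)) t| ≤ A
  deriv_le : ∀ n ≥ 1, ∀ t ∈ Icc (0 : ℝ) (M lam n),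
    |derivWithin (s n) (Icc 0 (M lam n)) t| ≤ lam ^ r
  le_deriv : ∀ n ≥ 1, ∀ t ∈ Icc (0 : ℝ) (M lam n),
    (∀ j : ℕ, 0 < j → j < M lam n → delta lam r ≤ |t - j|) →
    min (1 / 2) (slope lam r n) ≤ |derivWithin (s n) (Icc 0 (M lam n)) t|

/-- The normalization `φ_n(t) = h_n⁻¹ (f(w_n + l_n t) - f(w_n))` of `f` on `[w_n, x_n]`, where
`h_n = f(x_n) - f(w_n)` and `l_n = x_n - w_n`. -/
noncomputable def phi (lam : ℝ) (r : ℕ) (f : ℝ → ℝ) (n : ℕ) (t : ℝ) : ℝ :=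
  (f (x n) - f (w lam r n))⁻¹ * (f (w lam r n + (x n - w lam r n) * t) - f (w lam r n))

/-- `f` is one of the maps `f_r : [0,4] → [0,4]` with parameter `λ`: the construction prescribes
`f` on some intervals and leaves a choice on the others. Only the values of `f` on `[0,4]`
matter. -/
structure IsMap (lam : ℝ) (r : ℕ) (f : ℝ → ℝ) : Prop where
  mapsTo : MapsTo f (Icc 0 4) (Icc 0 4)
  /-- The pieces are glued in a `C^∞` way, except at `1`. -/
  smooth : ContDiffOn ℝ ∞ f (Icc 0 4 \ {1})
  /-- On `[x_n, y_n]`. -/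
  on_xy : ∃ s : ℕ → ℝ → ℝ, IsOscillation lam r s ∧ ∀ n ≥ 1, ∀ t ∈ Icc (x n) (y n),
    f t = (lam ^ (n * r))⁻¹ *
      (x n + (y n - x n) * s n (M lam n * ((t - x n) / (y n - x n))))
  /-- On `[y_{n+1}, w_n]`. -/
  on_yw : ∀ n ≥ 1, ∀ t ∈ Icc (y (n + 1)) (w lam r n),
    f t = (lam ^ ((n + 1) * r))⁻¹ * y (n + 1) +
      (lam ^ ((n + 1) * r))⁻¹ * M lam (n + 1) * slope lam r (n + 1) * (t - y (n + 1))
  /-- On `[w_n, x_n]`. -/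
  phi_deriv_bounded : ∀ k ≥ 1, ∃ B : ℝ, ∀ n ≥ 1, ∀ t ∈ Icc (0 : ℝ) 1,
    |iteratedDerivWithin k (phi lam r f n) (Icc 0 1) t| ≤ B
  phi_deriv_mem : ∀ n ≥ 1, ∀ t ∈ Icc (0 : ℝ) 1,
    derivWithin (phi lam r f n) (Icc 0 1) t ∈
      Icc (2 / 3 * derivWithin (phi lam r f n) (Icc 0 1) 0) (lam ^ r)
  /-- Near `0`, `1/2`, `1` (on the left) and `4`. -/
  near_zero : ∀ t ∈ Icc 0 (5 / 2 * delta lam r), f t = lam ^ r * t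
  near_half : ∀ t : ℝ, |t - 1 / 2| ≤ delta lam r →
    f t = 4 - 3 / 2 * (delta lam r)⁻¹ * (t - 1 / 2) ^ 2
  near_one : ∀ t ∈ Icc (1 - delta lam r) 1,
    f t = (delta lam r ^ (2 * r - 1))⁻¹ * (t - 1) ^ (2 * r)
  near_four : ∀ t ∈ Icc (4 - 3 / 2 * delta lam r) 4, f t = 4 + lam ^ r * (t - 4)
  /-- On the remaining intervals. -/
  deriv_left : ∀ t ∈ Icc (5 / 2 * delta lam r) (1 / 2 - delta lam r),
    derivWithin f (Icc 0 4) t ∈ Icc (3 / 2) (lam ^ r)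
  deriv_middle : ∀ t ∈ Icc (1 / 2 + delta lam r) (1 - delta lam r),
    derivWithin f (Icc 0 4) t ∈ Icc (-lam ^ r) (-(3 / 2))
  deriv_right : ∀ t ∈ Icc (y 1) 4, derivWithin f (Icc 0 4) t ∈ Icc (3 / 2) (lam ^ r)

end Ruette

/-!
The value of the local entropy is obtained from the chain
`log λ ≤ h_loc(f) ≤ h_top(f) ≤ log λ`, valid for every map `f` of the construction.

The middle inequality holds for every map of a metric space (`localEntropy_le_coverEntropy`). The
first one comes from the oscillations near `1`: `f` sends `[x_n, y_n]` to `λ^{-nr} [y_{n+1}, y_n]`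
and then multiplies `n` times by `λ^r`, so that `f^{n+1}` has about `λ^n / n²` full laps over
`[x_n, y_n]`, while the intermediate images have diameter at most `1 / n²`. These horseshoes are
invisible at any scale larger than `1 / n²`, and their entropies tend to `log λ`
(`Ruette.IsMap.log_le_localEntropy`).

For the last inequality the total variation of `f^n` is at most `4 λ^n`
(`Ruette.IsMap.eVariationOn_iterate_le`). The proof is an induction on `n`, joint with a bound
`u_m λ^n` for the variation on the zone `[y_{m+1}, y_m]`: a lap of the oscillation is mapped
monotonically into the zone scaled by `λ^{-mr}` and comes back `m` steps later, so the `M_m ≤ λ^m`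
laps reproduce the bound. Growth of the variation bounds the number of separated points of the line
(`coverEntropy_le_log_of_eVariationOn_le`).

The rates are balanced for regularity `C^r`: on the zone of index `n` a derivative of order
`1 ≤ k ≤ r` costs `λ^{nk}`, which the factor `λ^{-nr}` pays for, with `1 / n²` to spare. So all
derivatives up to order `r` tend to `0` at `1` (`Ruette.IsMap.contDiffOn`). The derivative is
bounded by `λ^r`, with equality at the fixed point `0`, whence `R(f) = λ^r`
(`Ruette.IsMap.derivSpectralRadius_eq`).

Existence (`Ruette.isMap_standardMap`) reduces to one device: `connect` joins two germs by a smooth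
function whose derivative passes from the derivative of the first germ to a constant and then to the
derivative of the second. Slopes stay in the prescribed range because the transitions are short,
and all higher derivatives are bounded uniformly since the derivative depends affinely on the
parameters of the germs.
-/

/-! ### Entropy of interval maps: separated sets, variation and horseshoes -/

open UniformSpace SetRel in
/-- Two points of a `δ`-separated set never lie in the same dynamical ball of radius `δ / 2`. -/
theorem sepCard_le_coverMincard {X : Type*} [MetricSpace X] (T : X → X) (δ : ℝ) (n : ℕ)
    (Y : Set X) :
    sepCard T δ n Y ≤ Dynamics.coverMincard T univ {p : X × X | dist p.1 p.2 < δ / 2} n := by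
  refine iSup₂_le fun E hE => le_iInf₂ fun s hs => ?_
  have hc : ∀ e : X, ∃ c ∈ s, ∀ k < n, dist (T^[k] e) (T^[k] c) < δ / 2 := fun e => by
    obtain ⟨c, hc, h⟩ := hs (mem_univ e)
    exact ⟨c, hc, fun k hk => by simpa using Dynamics.mem_dynEntourage.1 h k hk⟩
  choose c hcs hc using hc
  have hinj : InjOn c E := by
    intro e he e' he' hee
    by_contra hne
    obtain ⟨k, hk, hd⟩ := hE.2 e he e' he' hne
    have h1 := hc e k hk
    have h2 := hc e' k hk
    rw [← hee] at h2
    have := dist_triangle_right (T^[k] e) (T^[k] e') (T^[k] (c e))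
    linarith
  rw [← hinj.encard_image, ← Set.encard_coe_eq_coe_finsetCard]
  exact Set.encard_le_encard (by rintro _ ⟨e, _, rfl⟩; exact hcs e)

/-- The local entropy is at most the topological entropy: a `δ`-separated set is not larger than
a dynamical cover at scale `δ / 2`. -/
theorem localEntropy_le_coverEntropy {X : Type*} [MetricSpace X] (T : X → X) :
    localEntropy T ≤ Dynamics.coverEntropy T univ := by
  refine (iInf₂_le (1 : ℝ) (mem_Ioi.2 one_pos)).trans (iSup₂_le fun δ hδ => ?_)
  refine le_trans ?_ (Dynamics.coverEntropyEntourage_le_coverEntropy T univ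
    (Metric.dist_mem_uniformity (half_pos hδ)))
  refine limsup_le_limsup (Eventually.of_forall fun n => ?_)
  refine EReal.div_le_div_right_of_nonneg (by positivity) (iSup_le fun x => ?_)
  exact ENNReal.log_monotone (ENat.toENNReal_le.2 (sepCard_le_coverMincard T δ n _))

/-- If consecutive points of a finite subset `s` of the line are `ε`-separated by one of the
functions `g 0, …, g (n - 1)`, then these functions have total variation at least
`(#s - 1) * ε`. -/
theorem card_sub_one_mul_le_sum_eVariationOn (g : ℕ → ℝ → ℝ) (n : ℕ) (S : Set ℝ) (s : Finset ℝ)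
    (hs : (s : Set ℝ) ⊆ S) (ε : ℝ)
    (hsep : ∀ x ∈ s, ∀ y ∈ s, x ≠ y → ∃ k < n, ε ≤ dist (g k x) (g k y)) :
    ((s.card - 1 : ℕ) : ℝ≥0∞) * ENNReal.ofReal ε ≤ ∑ k ∈ Finset.range n, eVariationOn (g k) S := by
  classical
  rcases Nat.eq_zero_or_pos s.card with h0 | hpos
  · simp [h0]
  let o := s.orderIsoOfFin rfl
  let u : ℕ → ℝ := fun i => o ⟨min i (s.card - 1), by omega⟩
  have hu : Monotone u := by
    intro i j hij
    have : o ⟨min i (s.card - 1), by omega⟩ ≤ o ⟨min j (s.card - 1), by omega⟩ :=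
      o.monotone (by simp only [Fin.mk_le_mk]; omega)
    exact_mod_cast this
  have hmem : ∀ i, u i ∈ s := fun i => (o _).2
  have hne : ∀ i < s.card - 1, u (i + 1) ≠ u i := by
    intro i hi h
    have h' := o.injective (Subtype.ext h)
    simp only [Fin.mk.injEq] at h'
    omega
  calc ((s.card - 1 : ℕ) : ℝ≥0∞) * ENNReal.ofReal ε
      = ∑ i ∈ Finset.range (s.card - 1), ENNReal.ofReal ε := by simp
    _ ≤ ∑ i ∈ Finset.range (s.card - 1), ∑ k ∈ Finset.range n,
          edist (g k (u (i + 1))) (g k (u i)) := by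
        refine Finset.sum_le_sum fun i hi => ?_
        obtain ⟨k, hk, h⟩ := hsep _ (hmem (i + 1)) _ (hmem i) (hne i (Finset.mem_range.1 hi))
        calc ENNReal.ofReal ε ≤ edist (g k (u (i + 1))) (g k (u i)) := by
              rw [edist_dist]; exact ENNReal.ofReal_le_ofReal h
          _ ≤ _ := Finset.single_le_sum (f := fun k => edist (g k (u (i + 1))) (g k (u i)))
                (fun _ _ => zero_le) (Finset.mem_range.2 hk)
    _ = ∑ k ∈ Finset.range n, ∑ i ∈ Finset.range (s.card - 1),
          edist (g k (u (i + 1))) (g k (u i)) := Finset.sum_comm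
    _ ≤ _ := Finset.sum_le_sum fun k _ => eVariationOn.sum_le hu fun i => hs (hmem i)

/-- The topological entropy of an interval map is at most the exponential growth rate of the
total variation of its iterates. -/
theorem coverEntropy_le_log_of_eVariationOn_le {I : Set ℝ} {f : ℝ → ℝ} (hf : MapsTo f I I)
    {lam K : ℝ} (hlam : 1 < lam) (hK : 0 ≤ K)
    (hvar : ∀ n, eVariationOn f^[n] I ≤ ENNReal.ofReal (K * lam ^ n)) :
    Dynamics.coverEntropy (hf.restrict f I I) univ ≤ (Real.log lam : EReal) := by
  have hit : ∀ (k : ℕ) (z : I), (((hf.restrict f I I)^[k] z : I) : ℝ) = f^[k] z := fun k z =>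
    by simp [MapsTo.iterate_restrict]
  have hlog : ENNReal.log (ENNReal.ofReal lam) = (Real.log lam : EReal) :=
    ENNReal.log_ofReal_of_pos (by linarith)
  rw [Dynamics.coverEntropy_eq_iSup_basis_netEntropyEntourage Metric.uniformity_basis_dist,
    ← hlog, ← ExpGrowth.expGrowthSup_pow]
  refine iSup₂_le fun ε hε => ?_
  -- The variations of `f^0, …, f^{n-1}` sum to at most `K λ^n / (λ - 1)`, and each gap between
  -- consecutive points of an `(ε, n)`-separated set uses up `ε` of this sum.
  set C : ℝ := 1 + K / (ε * (lam - 1)) with hC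
  have hl : 0 < lam - 1 := by linarith
  refine ExpGrowth.expGrowthSup_le_of_eventually_le (b := ENNReal.ofReal C) ENNReal.ofReal_ne_top
    (Eventually.of_forall fun n => ?_)
  have key : Dynamics.netMaxcard (hf.restrict f I I) univ {p | dist p.1 p.2 < ε} n ≤
      ((⌊C * lam ^ n⌋₊ : ℕ) : ℕ∞) := by
    refine iSup₂_le fun s hs => ?_
    have h1 := card_sub_one_mul_le_sum_eVariationOn (fun k => f^[k]) n I
      (s.map (Function.Embedding.subtype _)) (by intro z hz; simp at hz; exact hz.1) ε (by
        intro x hx y hy hxy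
        simp only [Finset.mem_map, Function.Embedding.subtype_apply] at hx hy
        obtain ⟨x', hx', rfl⟩ := hx
        obtain ⟨y', hy', rfl⟩ := hy
        by_contra! hcon
        have hd := hs.2 hx' hy' (fun h => hxy (by rw [h]))
        have h1 : y' ∈ UniformSpace.ball x' (Dynamics.dynEntourage (hf.restrict f I I)
            {p | dist p.1 p.2 < ε} n) := Dynamics.mem_ball_dynEntourage.2 fun k hk => by
          have := hcon k hk
          simpa [UniformSpace.ball, Subtype.dist_eq, hit] using this
        have h2 : y' ∈ UniformSpace.ball y' (Dynamics.dynEntourage (hf.restrict f I I)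
            {p | dist p.1 p.2 < ε} n) := Dynamics.mem_ball_dynEntourage.2 fun k hk => by
          simpa [UniformSpace.ball] using hε
        exact Set.disjoint_left.1 hd h1 h2)
    rw [Finset.card_map] at h1
    have h2 : ∑ k ∈ Finset.range n, eVariationOn f^[k] I ≤
        ENNReal.ofReal (∑ k ∈ Finset.range n, K * lam ^ k) := by
      rw [ENNReal.ofReal_sum_of_nonneg fun k _ => by positivity]
      exact Finset.sum_le_sum fun k _ => hvar k
    have h3 := h1.trans h2
    rw [← ENNReal.ofReal_natCast, ← ENNReal.ofReal_mul (by positivity),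
      ENNReal.ofReal_le_ofReal_iff (Finset.sum_nonneg fun k _ => by positivity),
      ← Finset.mul_sum, geom_sum_eq hlam.ne'] at h3
    have h4 : ((s.card - 1 : ℕ) : ℝ) ≤ K / (ε * (lam - 1)) * lam ^ n := by
      rw [← mul_div_assoc, div_mul_eq_mul_div] at *
      rw [le_div_iff₀ hl] at h3
      rw [le_div_iff₀ (by positivity)]
      nlinarith [h3, hK]
    have h5 : (s.card : ℝ) ≤ ((s.card - 1 : ℕ) : ℝ) + 1 := by
      exact_mod_cast (by omega : s.card ≤ s.card - 1 + 1)
    have h6 : (1 : ℝ) ≤ lam ^ n := one_le_pow₀ hlam.le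
    exact_mod_cast Nat.le_floor (by rw [hC]; nlinarith)
  calc ((Dynamics.netMaxcard (hf.restrict f I I) univ {p | dist p.1 p.2 < ε} n : ℕ∞) : ℝ≥0∞)
      ≤ (((⌊C * lam ^ n⌋₊ : ℕ) : ℕ∞) : ℝ≥0∞) := ENat.toENNReal_le.2 key
    _ = ENNReal.ofReal ((⌊C * lam ^ n⌋₊ : ℕ) : ℝ) := by simp
    _ ≤ ENNReal.ofReal (C * lam ^ n) :=
        ENNReal.ofReal_le_ofReal (Nat.floor_le (by positivity))
    _ = ENNReal.ofReal C * ENNReal.ofReal lam ^ n := by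
        rw [ENNReal.ofReal_mul (by positivity), ENNReal.ofReal_pow (by linarith)]

/-- Every itinerary in a horseshoe is realized by a point. -/
theorem exists_forall_iterate_mem_of_subset_image {X : Type*} {T : X → X} {p N : ℕ} {J : Set X}
    {D : Fin N → Set X} (hJ : J.Nonempty) (hDJ : ∀ i, D i ⊆ J) (hcov : ∀ i, J ⊆ T^[p] '' D i)
    (q : ℕ) :
    ∃ φ : (Fin q → Fin N) → X, ∀ w, φ w ∈ J ∧ ∀ j : Fin q, T^[p * j] (φ w) ∈ D (w j) := by
  induction q with
  | zero =>
    obtain ⟨x, hx⟩ := hJ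
    exact ⟨fun _ => x, fun w => ⟨hx, fun j => j.elim0⟩⟩
  | succ q ih =>
    obtain ⟨φ, hφ⟩ := ih
    have : ∀ w : Fin (q + 1) → Fin N, ∃ x ∈ D (w 0), T^[p] x = φ (Fin.tail w) := fun w =>
      hcov (w 0) (hφ _).1
    choose ψ hψ hψ' using this
    refine ⟨ψ, fun w => ⟨hDJ _ (hψ w), fun j => ?_⟩⟩
    refine Fin.cases ?_ (fun j => ?_) j
    · simpa using hψ w
    · have := (hφ (Fin.tail w)).2 j
      rw [← hψ' w, ← Function.iterate_add_apply] at this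
      simpa [Fin.tail, mul_add] using this

/-- A horseshoe of `N` disjoint pieces for `T^p` whose successive images stay small produces
local entropy at least `log N / p`. -/
theorem log_div_le_localEntropyAt_of_horseshoe {X : Type*} [MetricSpace X] {T : X → X} {p N : ℕ}
    (hp : 0 < p) (hN : 0 < N) {J : Set X} {D : Fin N → Set X} {ε δ : ℝ} (hδ : 0 ≤ δ) (hJ : J.Nonempty)
    (hDJ : ∀ i, D i ⊆ J) (hcov : ∀ i, J ⊆ T^[p] '' D i)
    (hsep : ∀ i j, i ≠ j → ∀ x ∈ D i, ∀ y ∈ D j, δ < dist x y)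
    (hdiam : ∀ k < p, ∀ x ∈ J, ∀ y ∈ J, dist (T^[k] x) (T^[k] y) < ε) :
    ((Real.log N / p : ℝ) : EReal) ≤ localEntropyAt T ε δ := by
  -- Points with distinct itineraries of length `q` are `δ`-separated before time `p q`, while all
  -- of them lie in one Bowen ball.
  have main : ∀ q : ℕ, ∃ x : X, ((N ^ q : ℕ) : ℕ∞) ≤
      sepCard T δ (p * q) (bowenBall T (p * q) x ε) := by
    intro q
    obtain ⟨φ, hφ⟩ := exists_forall_iterate_mem_of_subset_image hJ hDJ hcov q
    have hsepφ : ∀ w w', w ≠ w' → ∃ k < p * q, δ < dist (T^[k] (φ w)) (T^[k] (φ w')) := by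
      intro w w' hww
      obtain ⟨j, hj⟩ := Function.ne_iff.1 hww
      exact ⟨p * j, by gcongr; exact j.2,
        hsep _ _ hj _ ((hφ w).2 j) _ ((hφ w').2 j)⟩
    have hclose : ∀ w w', ∀ k < p * q, dist (T^[k] (φ w)) (T^[k] (φ w')) < ε := by
      intro w w' k hk
      have hj : k / p < q := Nat.div_lt_of_lt_mul hk
      have h1 := hDJ _ ((hφ w).2 ⟨k / p, hj⟩)
      have h2 := hDJ _ ((hφ w').2 ⟨k / p, hj⟩)
      have := hdiam (k % p) (Nat.mod_lt _ hp) _ h1 _ h2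
      simpa only [← Function.iterate_add_apply, Nat.mod_add_div] using this
    let w₀ : Fin q → Fin N := fun _ => ⟨0, hN⟩
    refine ⟨φ w₀, ?_⟩
    have hinj : ∀ w w', w ≠ w' → φ w ≠ φ w' := fun w w' hww h => by
      obtain ⟨k, hk, h1⟩ := hsepφ w w' hww
      rw [h, dist_self] at h1
      linarith
    calc ((N ^ q : ℕ) : ℕ∞) = (univ : Set (Fin q → Fin N)).encard := by simp
      _ = (range φ).encard := by
        rw [← image_univ, InjOn.encard_image fun w _ w' _ h => by_contra fun hne => hinj w w' hne h]
      _ ≤ _ := le_iSup₂_of_le (range φ) ⟨?_, ?_⟩ le_rfl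
    · rintro _ ⟨w, rfl⟩ k hk
      exact hclose w w₀ k hk
    · rintro _ ⟨w, rfl⟩ _ ⟨w', rfl⟩ hne
      exact hsepφ w w' fun h => hne (by rw [h])
  refine le_limsup_of_frequently_le (frequently_atTop.2 fun a => ?_)
  refine ⟨p * (a + 1), by nlinarith, ?_⟩
  obtain ⟨x, hx⟩ := main (a + 1)
  have hpos : (0 : ℝ) < N := by exact_mod_cast hN
  have hlog : ENNReal.log (((N ^ (a + 1) : ℕ) : ℕ∞) : ℝ≥0∞) =
      (((a + 1 : ℕ) * Real.log N : ℝ) : EReal) := by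
    rw [← Real.log_pow, ← ENNReal.log_ofReal_of_pos (by positivity)]
    congr 1
    rw [ENNReal.ofReal_pow hpos.le]
    simp
  calc ((Real.log N / p : ℝ) : EReal)
      = (((a + 1 : ℕ) * Real.log N : ℝ) : EReal) / ((p * (a + 1) : ℕ) : EReal) := by
        have : ((p * (a + 1) : ℕ) : EReal) = ((p * (a + 1) : ℕ) : ℝ) := rfl
        rw [this, ← EReal.coe_div]
        congr 1
        have : (p : ℝ) ≠ 0 := by positivity
        push_cast
        field_simp
    _ ≤ _ := EReal.div_le_div_right_of_nonneg (by positivity) <| by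
        rw [← hlog]
        exact (ENNReal.log_monotone (ENat.toENNReal_le.2 hx)).trans
          (le_iSup (fun x => ENNReal.log (sepCard T δ (p * (a + 1))
            (bowenBall T (p * (a + 1)) x ε) : ℝ≥0∞)) x)

/-! ### The sequences of the construction -/

namespace Ruette

theorem y_sub_x (n : ℕ) : y n - x n = 1 / (2 * n ^ 2) := by simp [y]

theorem y_one : y 1 = 5 / 2 := by norm_num [y, x]

theorem x_sub_y_succ {n : ℕ} (hn : 1 ≤ n) :
    x n - y (n + 1) = (n + 2) / (2 * n * (n + 1) ^ 2) := by
  have : (n : ℝ) ≠ 0 := by positivity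
  simp only [y, x]
  push_cast
  field_simp
  ring

/-- The minimal value of the oscillation on `[x_n, y_n]` is `y_{n+1}` after rescaling. -/
theorem x_sub_m_mul {n : ℕ} (hn : 1 ≤ n) : x n + (y n - x n) * -m n = y (n + 1) := by
  have : (n : ℝ) ≠ 0 := by positivity
  simp only [y, x, m]
  push_cast
  field_simp
  ring

theorem one_lt_x {n : ℕ} (hn : 1 ≤ n) : 1 < x n := by
  have : (0 : ℝ) < n := by positivity
  simp only [x]
  linarith [show 0 < 1 / (n : ℝ) by positivity]

theorem x_lt_y {n : ℕ} (hn : 1 ≤ n) : x n < y n := by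
  have h := y_sub_x n
  have : (0 : ℝ) < n := by positivity
  linarith [show 0 < 1 / (2 * (n : ℝ) ^ 2) by positivity]

theorem y_succ_lt_x {n : ℕ} (hn : 1 ≤ n) : y (n + 1) < x n := by
  have h := x_sub_y_succ hn
  have : (0 : ℝ) < n := by positivity
  linarith [show 0 < ((n : ℝ) + 2) / (2 * n * (n + 1) ^ 2) by positivity]

theorem y_sub_y_succ_le {n : ℕ} (hn : 1 ≤ n) : y n - y (n + 1) ≤ 1 / n ^ 2 := by
  have h1 := y_sub_x n
  have h2 := x_sub_y_succ hn
  have : (0 : ℝ) < n := by positivity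
  have h3 : ((n : ℝ) + 2) / (2 * n * (n + 1) ^ 2) ≤ 1 / (2 * n ^ 2) := by
    rw [div_le_div_iff₀ (by positivity) (by positivity)]
    nlinarith
  have h4 : 1 / (n : ℝ) ^ 2 = 1 / (2 * n ^ 2) + 1 / (2 * n ^ 2) := by field_simp; ring
  linarith

theorem y_le {n : ℕ} (hn : 1 ≤ n) : y n ≤ 5 / 2 := by
  rw [← y_one]
  induction n, hn using Nat.le_induction with
  | base => rfl
  | succ n hn ih => linarith [y_succ_lt_x hn, x_lt_y hn]

theorem one_lt_y {n : ℕ} (hn : 1 ≤ n) : 1 < y n := (one_lt_x hn).trans (x_lt_y hn)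

theorem y_strictAnti {a b : ℕ} (ha : 1 ≤ a) (hab : a < b) : y b < y a := by
  induction b, hab using Nat.le_induction with
  | base => exact (y_succ_lt_x ha).trans (x_lt_y ha)
  | succ n hn ih =>
    have h : 1 ≤ n := by omega
    exact ((y_succ_lt_x h).trans (x_lt_y h)).trans ih

theorem x_le {n : ℕ} (hn : 1 ≤ n) : x n ≤ 2 := by
  have : (1 : ℝ) ≤ n := by exact_mod_cast hn
  have : 1 / (n : ℝ) ≤ 1 := by rw [div_le_one (by positivity)]; exact this
  simp only [x]; linarith

theorem tendsto_y : Tendsto y atTop (𝓝 1) := by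
  have h1 : Tendsto (fun n : ℕ => 1 / (n : ℝ)) atTop (𝓝 0) := tendsto_one_div_atTop_nhds_zero_nat
  have h2 : Tendsto (fun n : ℕ => 1 + 1 / (n : ℝ) + 1 / 2 * (1 / (n : ℝ)) ^ 2) atTop
      (𝓝 (1 + 0 + 1 / 2 * 0 ^ 2)) := (tendsto_const_nhds.add h1).add ((h1.pow 2).const_mul _)
  simp only [add_zero, ne_eq, OfNat.ofNat_ne_zero, not_false_eq_true, zero_pow, mul_zero] at h2
  refine h2.congr fun n => ?_
  simp only [y, x]
  ring

/-- Each point to the right of `1` and to the left of `y_1` lies in some `[y_{n+1}, y_n]`. -/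
theorem exists_mem_Ioc_y {t : ℝ} (h1 : 1 < t) (h2 : t ≤ y 1) :
    ∃ n, 1 ≤ n ∧ t ∈ Ioc (y (n + 1)) (y n) := by
  classical
  have hex : ∃ n : ℕ, 1 ≤ n ∧ y (n + 1) < t := by
    obtain ⟨n, hn⟩ := ((tendsto_y.eventually (gt_mem_nhds h1)).and (eventually_ge_atTop 2)).exists
    exact ⟨n - 1, by omega, by rw [Nat.sub_add_cancel (by omega)]; exact hn.1⟩
  obtain ⟨hn1, hn2⟩ := Nat.find_spec hex
  refine ⟨Nat.find hex, hn1, hn2, ?_⟩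
  rcases hn1.eq_or_lt with h | h
  · rw [← h]; exact h2
  · have := Nat.find_min hex (m := Nat.find hex - 1) (by omega)
    push Not at this
    have := this (by omega)
    rwa [Nat.sub_add_cancel hn1] at this

section

variable {lam : ℝ} {r : ℕ}

theorem fourteen_mul_sq_le {lam : ℝ} (hlam : 14 ≤ lam) {n : ℕ} (hn : 1 ≤ n) :
    14 * (n : ℝ) ^ 2 ≤ lam ^ n := by
  induction n, hn using Nat.le_induction with
  | base => simpa using hlam
  | succ n hn ih =>
    have : (1 : ℝ) ≤ n := by exact_mod_cast hn
    have h1 : lam ^ n * 14 ≤ lam ^ n * lam :=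
      mul_le_mul_of_nonneg_left hlam (pow_nonneg (by linarith) n)
    rw [pow_succ lam n]
    push_cast
    nlinarith

theorem seven_le_floor (hlam : 14 ≤ lam) {n : ℕ} (hn : 1 ≤ n) :
    7 ≤ ⌊lam ^ n / (2 * n ^ 2)⌋₊ := by
  have : (0 : ℝ) < n := by positivity
  refine Nat.le_floor ?_
  rw [le_div_iff₀ (by positivity)]
  push_cast
  linarith [fourteen_mul_sq_le hlam hn]

theorem M_add_one (hlam : 14 ≤ lam) {n : ℕ} (hn : 1 ≤ n) :
    M lam n + 1 = 2 * ⌊lam ^ n / (2 * n ^ 2)⌋₊ := by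
  have := seven_le_floor hlam hn
  simp only [M]; omega

theorem thirteen_le_M (hlam : 14 ≤ lam) {n : ℕ} (hn : 1 ≤ n) : 13 ≤ M lam n := by
  have := seven_le_floor hlam hn
  have := M_add_one hlam hn
  omega

theorem M_pos (hlam : 14 ≤ lam) {n : ℕ} (hn : 1 ≤ n) : (0 : ℝ) < M lam n := by
  have := thirteen_le_M hlam hn
  exact_mod_cast (by omega : 0 < M lam n)

theorem M_le (hlam : 14 ≤ lam) {n : ℕ} (hn : 1 ≤ n) : (M lam n : ℝ) ≤ lam ^ n / n ^ 2 := by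
  have h1 : (M lam n : ℝ) + 1 = 2 * (⌊lam ^ n / (2 * n ^ 2)⌋₊ : ℝ) := by
    exact_mod_cast M_add_one hlam hn
  have : (0 : ℝ) < n := by positivity
  have h2 := Nat.floor_le (show 0 ≤ lam ^ n / (2 * (n : ℝ) ^ 2) by positivity)
  have h3 : 2 * (lam ^ n / (2 * (n : ℝ) ^ 2)) = lam ^ n / n ^ 2 := by field_simp
  linarith

theorem M_mul_slope (hlam : 14 ≤ lam) {n : ℕ} (hn : 1 ≤ n) :
    M lam n * slope lam r n = 2 * lam ^ r := by
  have := (M_pos hlam hn).ne'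
  simp only [slope]; field_simp

theorem w_sub_y_succ (hlam : 14 ≤ lam) {n : ℕ} (hn : 1 ≤ n) :
    w lam r n - y (n + 1) = (x n - y (n + 1)) * (2 * lam ^ r)⁻¹ := by
  have h : (0 : ℝ) < n := by positivity
  rw [x_sub_y_succ hn, w, mul_assoc _ (M lam (n + 1) : ℝ), M_mul_slope hlam (by omega)]
  field_simp
  ring

theorem y_succ_lt_w (hlam : 14 ≤ lam) {n : ℕ} (hn : 1 ≤ n) : y (n + 1) < w lam r n := by
  have h := w_sub_y_succ (r := r) hlam hn
  have := y_succ_lt_x hn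
  have : 0 < (x n - y (n + 1)) * (2 * lam ^ r)⁻¹ := by
    have : 0 < x n - y (n + 1) := by linarith
    positivity
  linarith

theorem half_mul_le_x_sub_w (hlam : 14 ≤ lam) {n : ℕ} (hn : 1 ≤ n) :
    (x n - y (n + 1)) / 2 ≤ x n - w lam r n := by
  have h := w_sub_y_succ (r := r) hlam hn
  have h1 := y_succ_lt_x hn
  have h2 : (1 : ℝ) ≤ lam ^ r := one_le_pow₀ (by linarith)
  have h3 : (2 * lam ^ r)⁻¹ ≤ 1 / 2 := by
    rw [one_div]; exact inv_anti₀ (by norm_num) (by linarith)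
  nlinarith

theorem w_lt_x (hlam : 14 ≤ lam) {n : ℕ} (hn : 1 ≤ n) : w lam r n < x n := by
  linarith [half_mul_le_x_sub_w (r := r) hlam hn, y_succ_lt_x hn]

theorem lam_pow_ge (hlam : 14 ≤ lam) (hr : 1 ≤ r) : lam ≤ lam ^ r :=
  le_self_pow₀ (by linarith) (by omega)

theorem delta_pos (hlam : 14 ≤ lam) : 0 < delta lam r := by
  have : 0 < lam := by linarith
  simp only [delta]; positivity

theorem delta_le (hlam : 14 ≤ lam) (hr : 1 ≤ r) : delta lam r ≤ 1 / 14 := by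
  rw [one_div, delta]
  exact inv_anti₀ (by norm_num) (hlam.trans (lam_pow_ge hlam hr))

end

end Ruette

/-! ### The action of the map on the intervals of the construction -/

namespace Ruette

section

variable {lam : ℝ} {r : ℕ} {f : ℝ → ℝ}

theorem affine_mem_Icc {a b t : ℝ} (hab : a < b) (ht : t ∈ Icc a b) {c : ℝ} (hc : 0 ≤ c) :
    c * ((t - a) / (b - a)) ∈ Icc 0 c := by
  have h : 0 < b - a := by linarith
  have h1 : (t - a) / (b - a) ∈ Icc (0 : ℝ) 1 :=
    ⟨div_nonneg (by linarith [ht.1]) h.le, (div_le_one h).2 (by linarith [ht.2])⟩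
  exact ⟨mul_nonneg hc h1.1, by nlinarith [h1.2]⟩

theorem IsMap.map_zero (hf : IsMap lam r f) (hlam : 14 ≤ lam) : f 0 = 0 := by
  have := delta_pos (r := r) hlam
  rw [hf.near_zero 0 ⟨le_rfl, by positivity⟩, mul_zero]

theorem IsMap.map_one (hf : IsMap lam r f) (hlam : 14 ≤ lam) (hr : 1 ≤ r) : f 1 = 0 := by
  have := delta_pos (r := r) hlam
  rw [hf.near_one 1 ⟨by linarith, le_rfl⟩, sub_self, zero_pow (by omega), mul_zero]

/-- The map multiplies by `λ^r` on `[0, 5/2 λ^{-r}]`; hence it maps `λ^{-(j+1)r} [0, 5/2]` onto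
`λ^{-jr} [0, 5/2]`. -/
theorem IsMap.map_scaled (hf : IsMap lam r f) (hlam : 14 ≤ lam) (j : ℕ) {t : ℝ}
    (ht : t ∈ Icc (0 : ℝ) (5 / 2)) :
    f ((lam ^ ((j + 1) * r))⁻¹ * t) = (lam ^ (j * r))⁻¹ * t := by
  have h0 : 0 < lam := by linarith
  have h1 : (lam ^ (j * r))⁻¹ ≤ 1 := inv_le_one_of_one_le₀ (one_le_pow₀ (by linarith))
  have h2 : (lam ^ ((j + 1) * r))⁻¹ = (lam ^ (j * r))⁻¹ * (lam ^ r)⁻¹ := by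
    rw [add_mul, one_mul, pow_add, mul_inv]
  have h3 : 0 < (lam ^ r)⁻¹ := by positivity
  rw [hf.near_zero, h2]
  · field_simp
  · refine ⟨mul_nonneg (by positivity) ht.1, ?_⟩
    rw [h2, delta, mul_assoc, mul_comm (5 / 2)]
    have h4 : (lam ^ r)⁻¹ * t ≤ (lam ^ r)⁻¹ * (5 / 2) := mul_le_mul_of_nonneg_left ht.2 h3.le
    have h5 : 0 ≤ (lam ^ r)⁻¹ * t := mul_nonneg h3.le ht.1
    nlinarith

theorem IsMap.iterate_scaled (hf : IsMap lam r f) (hlam : 14 ≤ lam) (i j : ℕ) {t : ℝ}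
    (ht : t ∈ Icc (0 : ℝ) (5 / 2)) :
    f^[i] ((lam ^ ((j + i) * r))⁻¹ * t) = (lam ^ (j * r))⁻¹ * t := by
  induction i with
  | zero => simp
  | succ i ih =>
    rw [Function.iterate_succ_apply, ← add_assoc, hf.map_scaled hlam _ ht, ih]

theorem IsMap.map_x (hf : IsMap lam r f) {n : ℕ} (hn : 1 ≤ n) :
    f (x n) = (lam ^ (n * r))⁻¹ * x n := by
  obtain ⟨s, hs, h⟩ := hf.on_xy
  rw [h n hn _ ⟨le_rfl, (x_lt_y hn).le⟩]
  simp [hs.left_end n hn]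

theorem IsMap.map_yw (hf : IsMap lam r f) (hlam : 14 ≤ lam) {n : ℕ} (hn : 1 ≤ n) {t : ℝ}
    (ht : t ∈ Icc (y (n + 1)) (w lam r n)) :
    f t = (lam ^ ((n + 1) * r))⁻¹ * (y (n + 1) + 2 * lam ^ r * (t - y (n + 1))) := by
  rw [hf.on_yw n hn t ht, mul_assoc _ (M lam (n + 1) : ℝ), M_mul_slope hlam (by omega)]
  ring

theorem IsMap.map_w (hf : IsMap lam r f) (hlam : 14 ≤ lam) {n : ℕ} (hn : 1 ≤ n) :
    f (w lam r n) = (lam ^ ((n + 1) * r))⁻¹ * x n := by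
  have h0 : 0 < lam := by linarith
  rw [hf.map_yw hlam hn ⟨(y_succ_lt_w hlam hn).le, le_rfl⟩, w_sub_y_succ hlam hn]
  congr 1
  field_simp
  ring

/-- The image of `[x_n, y_n]`, rescaled, lies in `[y_{n+1}, y_n]`. -/
theorem IsMap.exists_map_xy (hf : IsMap lam r f) (hlam : 14 ≤ lam) {n : ℕ} (hn : 1 ≤ n) {t : ℝ}
    (ht : t ∈ Icc (x n) (y n)) :
    ∃ u ∈ Icc (y (n + 1)) (y n), f t = (lam ^ (n * r))⁻¹ * u := by
  obtain ⟨s, hs, h⟩ := hf.on_xy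
  have hm := hs.mapsTo n hn (affine_mem_Icc (x_lt_y hn) ht (M_pos hlam hn).le)
  have hxy := x_lt_y hn
  refine ⟨_, ⟨?_, ?_⟩, h n hn t ht⟩
  · rw [← x_sub_m_mul hn]
    have := mul_le_mul_of_nonneg_left hm.1 (sub_nonneg.2 hxy.le)
    linarith
  · have := mul_le_mul_of_nonneg_left hm.2 (sub_nonneg.2 hxy.le)
    linarith

theorem IsMap.differentiableWithinAt (hf : IsMap lam r f) {t : ℝ} (ht : t ∈ Icc (0 : ℝ) 4)
    (h1 : t ≠ 1) : DifferentiableWithinAt ℝ f (Icc 0 4) t := by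
  have := (hf.smooth.differentiableOn (by simp)) t ⟨ht, h1⟩
  refine this.mono_of_mem_nhdsWithin ?_
  exact inter_mem_nhdsWithin _ (isOpen_ne.mem_nhds h1)

/-- The map is differentiable on `[0, 4]` within subintervals that avoid `1`. -/
theorem IsMap.hasDerivWithinAt (hf : IsMap lam r f) {t : ℝ} (ht : t ∈ Icc (0 : ℝ) 4)
    (h1 : t ≠ 1) {a b : ℝ} (hab : Icc a b ⊆ Icc 0 4) :
    HasDerivWithinAt f (derivWithin f (Icc 0 4) t) (Icc a b) t :=
  (hf.differentiableWithinAt ht h1).hasDerivWithinAt.mono hab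

theorem IsMap.x_sub_f_w (hf : IsMap lam r f) (hlam : 14 ≤ lam) {n : ℕ} (hn : 1 ≤ n) :
    f (x n) - f (w lam r n) = (lam ^ (n * r))⁻¹ * x n * (1 - delta lam r) := by
  have h0 : 0 < lam := by linarith
  rw [hf.map_x hn, hf.map_w hlam hn, delta, add_mul, one_mul, pow_add]
  field_simp

theorem IsMap.f_w_lt_f_x (hf : IsMap lam r f) (hlam : 14 ≤ lam) (hr : 1 ≤ r) {n : ℕ}
    (hn : 1 ≤ n) : 0 < f (x n) - f (w lam r n) := by
  rw [hf.x_sub_f_w hlam hn]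
  have := delta_le hlam hr
  have := one_lt_x hn
  have h0 : 0 < lam := by linarith
  have : 0 < 1 - delta lam r := by linarith
  positivity

/-- The zone `[y_{n+1}, y_n]` lies in `[0, 4] \ {1}`. -/
theorem mem_Icc_of_mem_zone {n : ℕ} (hn : 1 ≤ n) {t : ℝ} (h1 : y (n + 1) ≤ t) (h2 : t ≤ y n) :
    t ∈ Icc (0 : ℝ) 4 ∧ t ≠ 1 := by
  have := one_lt_y (n := n + 1) (by omega)
  have := y_le hn
  exact ⟨⟨by linarith, by linarith⟩, by linarith⟩

theorem w_add_mem (hlam : 14 ≤ lam) {n : ℕ} (hn : 1 ≤ n) {t : ℝ} (ht : t ∈ Icc (0 : ℝ) 1) :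
    w lam r n + (x n - w lam r n) * t ∈ Icc (w lam r n) (x n) := by
  have := w_lt_x (r := r) hlam hn
  constructor <;> nlinarith [ht.1, ht.2]

theorem IsMap.hasDerivWithinAt_phi (hf : IsMap lam r f) (hlam : 14 ≤ lam) {n : ℕ} (hn : 1 ≤ n)
    {t : ℝ} (ht : t ∈ Icc (0 : ℝ) 1) :
    HasDerivWithinAt (phi lam r f n) ((f (x n) - f (w lam r n))⁻¹ *
      (derivWithin f (Icc 0 4) (w lam r n + (x n - w lam r n) * t) * (x n - w lam r n)))
      (Icc 0 1) t := by
  have hm := w_add_mem (r := r) hlam hn ht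
  have hyw := y_succ_lt_w (r := r) hlam hn
  have hxy := x_lt_y hn
  obtain ⟨h4, h1⟩ := mem_Icc_of_mem_zone hn (hyw.le.trans hm.1) (hm.2.trans hxy.le)
  have hd := (hf.differentiableWithinAt h4 h1).hasDerivWithinAt
  have hin : HasDerivWithinAt (fun t => w lam r n + (x n - w lam r n) * t) (x n - w lam r n)
      (Icc 0 1) t := by
    simpa using (((hasDerivAt_id t).const_mul (x n - w lam r n)).const_add
      (w lam r n)).hasDerivWithinAt
  have := hd.scomp t hin fun u hu => by
    have hm := w_add_mem (r := r) hlam hn hu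
    exact (mem_Icc_of_mem_zone hn (hyw.le.trans hm.1) (hm.2.trans hxy.le)).1
  have h3 := (this.sub_const (f (w lam r n))).const_mul (f (x n) - f (w lam r n))⁻¹
  rw [smul_eq_mul, mul_comm (x n - w lam r n)] at h3
  exact h3

theorem IsMap.derivWithin_phi (hf : IsMap lam r f) (hlam : 14 ≤ lam) {n : ℕ} (hn : 1 ≤ n)
    {t : ℝ} (ht : t ∈ Icc (0 : ℝ) 1) :
    derivWithin (phi lam r f n) (Icc 0 1) t = (f (x n) - f (w lam r n))⁻¹ *
      (derivWithin f (Icc 0 4) (w lam r n + (x n - w lam r n) * t) * (x n - w lam r n)) :=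
  (hf.hasDerivWithinAt_phi hlam hn ht).derivWithin (uniqueDiffOn_Icc one_pos t ht)

theorem IsMap.derivWithin_yw (hf : IsMap lam r f) (hlam : 14 ≤ lam) {n : ℕ} (hn : 1 ≤ n) {t : ℝ}
    (ht : t ∈ Icc (y (n + 1)) (w lam r n)) :
    derivWithin f (Icc 0 4) t = (lam ^ ((n + 1) * r))⁻¹ * (2 * lam ^ r) := by
  have hyw := y_succ_lt_w (r := r) hlam hn
  have hwx := w_lt_x (r := r) hlam hn
  have hxy := x_lt_y hn
  have hsub : Icc (y (n + 1)) (w lam r n) ⊆ Icc 0 4 := fun u hu =>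
    (mem_Icc_of_mem_zone hn hu.1 (by linarith [hu.2])).1
  obtain ⟨h4, h1⟩ := mem_Icc_of_mem_zone hn ht.1 (by linarith [ht.2])
  have hd := hf.hasDerivWithinAt h4 h1 hsub
  have hd2 : HasDerivWithinAt f ((lam ^ ((n + 1) * r))⁻¹ * (2 * lam ^ r))
      (Icc (y (n + 1)) (w lam r n)) t := by
    have : HasDerivAt (fun t => (lam ^ ((n + 1) * r))⁻¹ *
        (y (n + 1) + 2 * lam ^ r * (t - y (n + 1)))) ((lam ^ ((n + 1) * r))⁻¹ * (2 * lam ^ r)) t := by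
      simpa using ((((hasDerivAt_id t).sub_const (y (n + 1))).const_mul (2 * lam ^ r)).const_add
        (y (n + 1))).const_mul (lam ^ ((n + 1) * r))⁻¹
    exact this.hasDerivWithinAt.congr (fun u hu => hf.map_yw hlam hn hu) (hf.map_yw hlam hn ht)
  exact (uniqueDiffOn_Icc hyw t ht).eq_deriv _ hd hd2

theorem IsMap.derivWithin_wx_nonneg (hf : IsMap lam r f) (hlam : 14 ≤ lam) (hr : 1 ≤ r) {n : ℕ}
    (hn : 1 ≤ n) {t : ℝ} (ht : t ∈ Icc (w lam r n) (x n)) :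
    0 ≤ derivWithin f (Icc 0 4) t ∧ derivWithin f (Icc 0 4) t ≤
      (f (x n) - f (w lam r n)) / (x n - w lam r n) * lam ^ r := by
  have hwx := w_lt_x (r := r) hlam hn
  have h0 : 0 < lam := by linarith
  have hpos := hf.f_w_lt_f_x hlam hr hn
  have hl : 0 < x n - w lam r n := by linarith
  have hu : (t - w lam r n) / (x n - w lam r n) ∈ Icc (0 : ℝ) 1 := by
    simpa using affine_mem_Icc hwx ht zero_le_one
  have h1 := hf.phi_deriv_mem n hn _ hu
  rw [hf.derivWithin_phi hlam hn hu, hf.derivWithin_phi hlam hn ⟨le_rfl, zero_le_one⟩,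
    mul_div_cancel₀ _ hl.ne', add_sub_cancel, mul_zero, add_zero,
    hf.derivWithin_yw hlam hn ⟨(y_succ_lt_w hlam hn).le, le_rfl⟩] at h1
  constructor
  · have h2 : 0 ≤ (f (x n) - f (w lam r n))⁻¹ *
      (derivWithin f (Icc 0 4) t * (x n - w lam r n)) := le_trans (by positivity) h1.1
    have h3 := (mul_nonneg_iff_of_pos_left (inv_pos.2 hpos)).1 h2
    exact (mul_nonneg_iff_of_pos_right hl).1 h3
  · have h2 := h1.2
    rw [inv_mul_le_iff₀ hpos] at h2
    rw [div_mul_eq_mul_div, le_div_iff₀ hl]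
    exact h2

theorem monotoneOn_of_derivWithin {a b : ℝ} (hc : ContinuousOn f (Icc a b))
    (hd : ∀ t ∈ Ioo a b, ∃ d, 0 ≤ d ∧ HasDerivWithinAt f d (Icc a b) t) :
    MonotoneOn f (Icc a b) := by
  have hd' : ∀ t ∈ Ioo a b, ∃ d, 0 ≤ d ∧ HasDerivAt f d t := fun t ht => by
    obtain ⟨d, h0, h⟩ := hd t ht
    exact ⟨d, h0, h.hasDerivAt (Icc_mem_nhds ht.1 ht.2)⟩
  refine monotoneOn_of_deriv_nonneg (convex_Icc a b) hc ?_ ?_ <;> rw [interior_Icc]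
  · intro t ht
    obtain ⟨d, _, h⟩ := hd' t ht
    exact h.differentiableAt.differentiableWithinAt
  · intro t ht
    obtain ⟨d, h0, h⟩ := hd' t ht
    rwa [h.deriv]

theorem IsMap.monotoneOn_wx (hf : IsMap lam r f) (hlam : 14 ≤ lam) (hr : 1 ≤ r) {n : ℕ}
    (hn : 1 ≤ n) : MonotoneOn f (Icc (w lam r n) (x n)) := by
  have hyw := y_succ_lt_w (r := r) hlam hn
  have hxy := x_lt_y hn
  have hmem : ∀ t ∈ Icc (w lam r n) (x n), t ∈ Icc (0 : ℝ) 4 ∧ t ≠ 1 := fun t ht =>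
    mem_Icc_of_mem_zone hn (hyw.le.trans ht.1) (ht.2.trans hxy.le)
  refine monotoneOn_of_derivWithin (fun t ht => ?_) fun t ht => ⟨_,
    (hf.derivWithin_wx_nonneg hlam hr hn (Ioo_subset_Icc_self ht)).1,
    hf.hasDerivWithinAt (hmem t (Ioo_subset_Icc_self ht)).1 (hmem t (Ioo_subset_Icc_self ht)).2
      fun u hu => (hmem u hu).1⟩
  exact (hf.hasDerivWithinAt (hmem t ht).1 (hmem t ht).2 fun u hu => (hmem u hu).1).continuousWithinAt

end

end Ruette

/-! ### Regularity at the accumulation point -/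

/-- A function that is `C^r` off a point `a`, and whose derivatives up to order `r` have limits
at `a`, is `C^r`. -/
theorem contDiffOn_of_tendsto_iteratedDeriv {U : Set ℝ} (hU : IsOpen U) {a : ℝ} (ha : a ∈ U)
    (r : ℕ) : ∀ (f : ℝ → ℝ) (l : ℕ → ℝ), ContDiffOn ℝ r f (U \ {a}) →
      (∀ k ≤ r, Tendsto (iteratedDeriv k f) (𝓝[≠] a) (𝓝 (l k))) → f a = l 0 →
      ContDiffOn ℝ r f U := by
  have hU' : IsOpen (U \ {a}) := hU.sdiff isClosed_singleton
  have hcont : ∀ (f : ℝ → ℝ) (l : ℕ → ℝ), ContinuousOn f (U \ {a}) →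
      Tendsto (iteratedDeriv 0 f) (𝓝[≠] a) (𝓝 (l 0)) → f a = l 0 → ContinuousOn f U := by
    intro f l hf hl hfa t ht
    refine ContinuousAt.continuousWithinAt ?_
    by_cases h : t = a
    · subst h
      rw [continuousAt_iff_punctured_nhds, hfa]
      simpa using hl
    · exact hf.continuousAt (hU'.mem_nhds ⟨ht, h⟩)
  induction r with
  | zero =>
    intro f l hf hl hfa
    have : ContinuousOn f U := hcont f l hf.continuousOn (hl 0 le_rfl) hfa
    simpa using this
  | succ r ih =>
    intro f l hf hl hfa
    have hc := hcont f l hf.continuousOn (hl 0 (Nat.zero_le _)) hfa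
    push_cast at hf ⊢
    have hf' := (contDiffOn_succ_iff_deriv_of_isOpen hU').1 hf
    have hl1 := hl 1 (by omega)
    rw [iteratedDeriv_one] at hl1
    have hda : HasDerivAt f (l 1) a := by
      rw [← hasDerivWithinAt_univ, ← Iic_union_Ici]
      have hca : ContinuousWithinAt f (U \ {a}) a :=
        (hc.continuousAt (hU.mem_nhds ha)).continuousWithinAt
      have hUa := hU.mem_nhds ha
      refine (hasDerivWithinAt_Iic_of_tendsto_deriv hf'.1 hca ?_
        (hl1.mono_left (nhdsWithin_mono _ fun t ht => ne_of_lt ht))).union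
        (hasDerivWithinAt_Ici_of_tendsto_deriv hf'.1 hca ?_
          (hl1.mono_left (nhdsWithin_mono _ fun t ht => ne_of_gt ht)))
      · filter_upwards [self_mem_nhdsWithin, mem_nhdsWithin_of_mem_nhds hUa] with t h1 h2
        exact ⟨h2, ne_of_lt h1⟩
      · filter_upwards [self_mem_nhdsWithin, mem_nhdsWithin_of_mem_nhds hUa] with t h1 h2
        exact ⟨h2, ne_of_gt h1⟩
    refine (contDiffOn_succ_iff_deriv_of_isOpen hU).2 ⟨fun t ht => ?_, by simp, ?_⟩
    · by_cases h : t = a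
      · subst h; exact hda.differentiableAt.differentiableWithinAt
      · exact (hf'.1.differentiableAt (hU'.mem_nhds ⟨ht, h⟩)).differentiableWithinAt
    · refine ih (deriv f) (fun k => l (k + 1)) hf'.2.2 (fun k hk => ?_) hda.deriv
      have := hl (k + 1) (by omega)
      rwa [iteratedDeriv_succ'] at this

theorem iteratedDerivWithin_comp_affine {g : ℝ → ℝ} {s t : Set ℝ} (hs : UniqueDiffOn ℝ s)
    (ht : UniqueDiffOn ℝ t) (hg : ContDiffOn ℝ ∞ g s) (p q : ℝ) (hmap : ∀ u ∈ t, p * u + q ∈ s)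
    (k : ℕ) : ∀ u ∈ t, iteratedDerivWithin k (fun u => g (p * u + q)) t u =
      p ^ k * iteratedDerivWithin k g s (p * u + q) := by
  induction k with
  | zero => simp
  | succ k ih =>
    intro u hu
    rw [iteratedDerivWithin_succ, derivWithin_congr ih (ih u hu), iteratedDerivWithin_succ]
    have h1 : HasDerivWithinAt (iteratedDerivWithin k g s)
        (derivWithin (iteratedDerivWithin k g s) s (p * u + q)) s (p * u + q) :=
      (hg.differentiableOn_iteratedDerivWithin (by exact_mod_cast ENat.natCast_lt_top k) hs _
        (hmap u hu)).hasDerivWithinAt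
    have h2 : HasDerivWithinAt (fun u => p * u + q) p t u := by
      simpa using (((hasDerivAt_id u).const_mul p).add_const q).hasDerivWithinAt
    have h3 := (h1.scomp u h2 hmap).const_mul (p ^ k)
    refine (h3.derivWithin (ht u hu)).trans ?_
    rw [smul_eq_mul, pow_succ]
    ring

theorem iteratedDeriv_eq_of_eqOn_affine {f g : ℝ → ℝ} {a b c d : ℝ} (hab : a < b) (hcd : c < d)
    {t : ℝ} (ht : t ∈ Icc a b) (hf : ContDiffAt ℝ ∞ f t) (hg : ContDiffOn ℝ ∞ g (Icc c d))
    (A B p q : ℝ) (hmap : ∀ u ∈ Icc a b, p * u + q ∈ Icc c d)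
    (heq : ∀ u ∈ Icc a b, f u = A + B * g (p * u + q)) {k : ℕ} (hk : 1 ≤ k) :
    iteratedDeriv k f t = B * (p ^ k * iteratedDerivWithin k g (Icc c d) (p * t + q)) := by
  rw [← iteratedDerivWithin_eq_iteratedDeriv (uniqueDiffOn_Icc hab)
      (hf.of_le (by exact_mod_cast le_top)) ht, iteratedDerivWithin_congr heq ht,
    iteratedDerivWithin_const_add hk, iteratedDerivWithin_const_mul_field,
    iteratedDerivWithin_comp_affine (uniqueDiffOn_Icc hcd) (uniqueDiffOn_Icc hab) hg p q hmap k t ht]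

theorem exists_iteratedDeriv_mul_sub_pow (c a : ℝ) (n k : ℕ) :
    ∃ c', iteratedDeriv k (fun t => c * (t - a) ^ n) = fun t : ℝ => c' * (t - a) ^ (n - k) := by
  induction k with
  | zero => exact ⟨c, by simp⟩
  | succ k ih =>
    obtain ⟨c', h⟩ := ih
    refine ⟨c' * (n - k : ℕ), ?_⟩
    rw [iteratedDeriv_succ, h]
    ext t
    have : HasDerivAt (fun t : ℝ => c' * (t - a) ^ (n - k))
        (c' * ((n - k : ℕ) * (t - a) ^ (n - k - 1) * 1)) t :=
      (((hasDerivAt_id t).sub_const a).pow (n - k)).const_mul c'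
    rw [this.deriv, Nat.sub_sub]
    ring

namespace Ruette

variable {lam : ℝ} {r : ℕ} {f : ℝ → ℝ}

theorem IsMap.contDiffAt (hf : IsMap lam r f) {t : ℝ} (ht : t ∈ Ioo (0 : ℝ) 4) (h1 : t ≠ 1) :
    ContDiffAt ℝ ∞ f t := by
  have hU : IsOpen (Ioo (0 : ℝ) 4 \ {1}) := isOpen_Ioo.sdiff isClosed_singleton
  exact (hf.smooth.mono (sdiff_subset_sdiff_left Ioo_subset_Icc_self)).contDiffAt
    (hU.mem_nhds ⟨ht, h1⟩)

theorem mem_Ioo_of_mem_zone {n : ℕ} (hn : 1 ≤ n) {t : ℝ} (h1 : y (n + 1) ≤ t) (h2 : t ≤ y n) :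
    t ∈ Ioo (0 : ℝ) 4 ∧ t ≠ 1 := by
  have := one_lt_y (n := n + 1) (by omega)
  have := y_le hn
  exact ⟨⟨by linarith, by linarith⟩, by linarith⟩

/-- The image of the zone `[y_{n+1}, y_n]` has size `O(λ^{-nr})`. -/
theorem IsMap.abs_le_of_mem_zone (hf : IsMap lam r f) (hlam : 14 ≤ lam) (hr : 1 ≤ r) {n : ℕ}
    (hn : 1 ≤ n) {t : ℝ} (ht : t ∈ Icc (y (n + 1)) (y n)) :
    0 ≤ f t ∧ f t ≤ (lam ^ (n * r))⁻¹ * (5 / 2) := by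
  have h0 : 0 < lam := by linarith
  have hx := x_lt_y hn
  have hy := y_le hn
  have hyw := y_succ_lt_w (r := r) hlam hn
  have hwx := w_lt_x (r := r) hlam hn
  refine ⟨(hf.mapsTo (mem_Icc_of_mem_zone hn ht.1 ht.2).1).1, ?_⟩
  have hmono : ∀ t ∈ Icc (w lam r n) (x n), f t ≤ (lam ^ (n * r))⁻¹ * (5 / 2) := fun t h =>
    calc f t ≤ f (x n) := hf.monotoneOn_wx hlam hr hn h ⟨hwx.le, le_rfl⟩ h.2
      _ = (lam ^ (n * r))⁻¹ * x n := hf.map_x hn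
      _ ≤ _ := by gcongr; linarith
  rcases le_total t (x n) with h1 | h1
  · rcases le_total t (w lam r n) with h2 | h2
    · refine le_trans ?_ (hmono (w lam r n) ⟨le_rfl, hwx.le⟩)
      rw [hf.map_yw hlam hn ⟨ht.1, h2⟩, hf.map_yw hlam hn ⟨hyw.le, le_rfl⟩]
      gcongr
    · exact hmono t ⟨h2, h1⟩
  · obtain ⟨u, hu, h⟩ := hf.exists_map_xy hlam hn ⟨h1, ht.2⟩
    rw [h]
    gcongr
    linarith [hu.2]

theorem inv_lam_pow_mul_le (hlam : 14 ≤ lam) (hr : 1 ≤ r) (n : ℕ) :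
    (lam ^ (n * r))⁻¹ ≤ (lam ^ n)⁻¹ := by
  have : 1 ≤ lam := by linarith
  exact inv_anti₀ (by positivity) (pow_le_pow_right₀ this (Nat.le_mul_of_pos_right n (by omega)))

/-- On `[x_n, y_n]` the derivatives of order `k ≤ r` are `O(1 / n²)`: rescaling by the factor
`M_n / (y_n - x_n) ≈ 2 λ^n` costs `λ^{nk}`, which `λ^{-nr}` compensates. -/
theorem IsMap.exists_abs_iteratedDeriv_le_xy (hf : IsMap lam r f) (hlam : 14 ≤ lam)
    {k : ℕ} (hk : 1 ≤ k) (hkr : k ≤ r) :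
    ∃ C, ∀ n ≥ 1, ∀ t ∈ Icc (x n) (y n), |iteratedDeriv k f t| ≤ C * (1 / n ^ 2) := by
  have h0 : 0 < lam := by linarith
  obtain ⟨s, hs, hfs⟩ := hf.on_xy
  obtain ⟨A, hA⟩ := hs.deriv_bounded k hk
  refine ⟨2 ^ (k - 1) * A, fun n hn t ht => ?_⟩
  have hxy := x_lt_y hn
  have hl : 0 < y n - x n := by linarith
  have hM := M_pos hlam hn
  have hn' : (0 : ℝ) < n := by positivity
  obtain ⟨ht4, ht1⟩ := mem_Ioo_of_mem_zone hn ((y_succ_lt_x hn).le.trans ht.1) ht.2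
  have haff : ∀ u, (M lam n : ℝ) / (y n - x n) * u + -(M lam n * x n / (y n - x n)) =
      M lam n * ((u - x n) / (y n - x n)) := fun u => by field_simp; ring
  have hmem : ∀ u ∈ Icc (x n) (y n),
      (M lam n : ℝ) / (y n - x n) * u + -(M lam n * x n / (y n - x n)) ∈
        Icc (0 : ℝ) (M lam n) := fun u hu => by
    rw [haff]; exact affine_mem_Icc hxy hu hM.le
  have key := iteratedDeriv_eq_of_eqOn_affine hxy hM ht (hf.contDiffAt ht4 ht1) (hs.smooth n hn)
    ((lam ^ (n * r))⁻¹ * x n) ((lam ^ (n * r))⁻¹ * (y n - x n)) (M lam n / (y n - x n))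
    (-(M lam n * x n / (y n - x n))) hmem (fun u hu => by rw [hfs n hn u hu, haff]; ring) hk
  have hA' := hA n hn _ (hmem t ht)
  have hA0 : 0 ≤ A := (abs_nonneg _).trans hA'
  rw [key, abs_mul, abs_of_nonneg (by positivity), abs_mul, abs_of_nonneg (by positivity)]
  have hlen : y n - x n = 1 / (2 * n ^ 2) := y_sub_x n
  have hscale : (lam ^ (n * r))⁻¹ * (y n - x n) * ((M lam n : ℝ) / (y n - x n)) ^ k ≤
      2 ^ (k - 1) * (1 / n ^ 2) := by
    obtain ⟨j, rfl⟩ : ∃ j, k = j + 1 := ⟨k - 1, by omega⟩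
    have h1 : (M lam n : ℝ) / (y n - x n) ≤ 2 * lam ^ n := by
      rw [hlen, div_div_eq_mul_div, div_one]
      have := M_le hlam hn
      rw [le_div_iff₀ (by positivity)] at this
      linarith
    have h2 : (y n - x n) * ((M lam n : ℝ) / (y n - x n)) ^ (j + 1) =
        M lam n * ((M lam n : ℝ) / (y n - x n)) ^ j := by
      rw [pow_succ]; field_simp
    have h3 : (M lam n : ℝ) * ((M lam n : ℝ) / (y n - x n)) ^ j ≤
        (lam ^ n / n ^ 2) * (2 * lam ^ n) ^ j := by
      gcongr
      exact M_le hlam hn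
    have h4 : (lam ^ n / n ^ 2) * (2 * lam ^ n) ^ j =
        lam ^ (n * (j + 1)) * (2 ^ j * (1 / n ^ 2)) := by
      rw [mul_pow, ← pow_mul, mul_add, mul_one, pow_add]; ring
    have h5 : (lam ^ (n * r))⁻¹ * lam ^ (n * (j + 1)) ≤ 1 := by
      rw [inv_mul_le_iff₀ (by positivity), mul_one]
      exact pow_le_pow_right₀ (by linarith) (Nat.mul_le_mul_left n hkr)
    rw [mul_assoc, h2, Nat.add_sub_cancel]
    calc (lam ^ (n * r))⁻¹ * ((M lam n : ℝ) * ((M lam n : ℝ) / (y n - x n)) ^ j)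
        ≤ (lam ^ (n * r))⁻¹ * (lam ^ (n * (j + 1)) * (2 ^ j * (1 / n ^ 2))) := by
          rw [← h4]; gcongr
      _ = ((lam ^ (n * r))⁻¹ * lam ^ (n * (j + 1))) * (2 ^ j * (1 / n ^ 2)) := by ring
      _ ≤ 1 * (2 ^ j * (1 / n ^ 2)) := by gcongr
      _ = _ := one_mul _
  calc _ = (lam ^ (n * r))⁻¹ * (y n - x n) * ((M lam n : ℝ) / (y n - x n)) ^ k *
        |iteratedDerivWithin k (s n) (Icc 0 (M lam n))
          ((M lam n : ℝ) / (y n - x n) * t + -(M lam n * x n / (y n - x n)))| := by ring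
    _ ≤ 2 ^ (k - 1) * (1 / n ^ 2) * A := by gcongr
    _ = _ := by ring

/-- On the affine pieces `[y_{n+1}, w_n]` the derivatives are `O(λ^{-n})`. -/
theorem IsMap.abs_iteratedDeriv_le_yw (hf : IsMap lam r f) (hlam : 14 ≤ lam) (hr : 1 ≤ r)
    {k : ℕ} (hk : 1 ≤ k) {n : ℕ} (hn : 1 ≤ n) {t : ℝ} (ht : t ∈ Icc (y (n + 1)) (w lam r n)) :
    |iteratedDeriv k f t| ≤ 2 * (lam ^ n)⁻¹ := by
  have h0 : 0 < lam := by linarith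
  have hyw := y_succ_lt_w (r := r) hlam hn
  have hwx := w_lt_x (r := r) hlam hn
  have hxy := x_lt_y hn
  obtain ⟨ht4, ht1⟩ := mem_Ioo_of_mem_zone hn ht.1 (by linarith [ht.2])
  have key := iteratedDeriv_eq_of_eqOn_affine (g := id) hyw hyw ht (hf.contDiffAt ht4 ht1)
    contDiff_id.contDiffOn
    ((lam ^ ((n + 1) * r))⁻¹ * (y (n + 1) - 2 * lam ^ r * y (n + 1)))
    ((lam ^ ((n + 1) * r))⁻¹ * (2 * lam ^ r)) 1 0 (fun u hu => by simpa using hu)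
    (fun u hu => by rw [hf.map_yw hlam hn hu]; simp; ring) hk
  have hid : |iteratedDerivWithin k (id : ℝ → ℝ) (Icc (y (n + 1)) (w lam r n)) (1 * t + 0)| ≤ 1 := by
    have ht' : 1 * t + 0 ∈ Icc (y (n + 1)) (w lam r n) := by simpa using ht
    rw [iteratedDerivWithin_id ht' (uniqueDiffOn_Icc hyw), if_neg (by omega)]
    split_ifs <;> simp
  have hfac : (lam ^ ((n + 1) * r))⁻¹ * (2 * lam ^ r) = 2 * (lam ^ (n * r))⁻¹ := by
    rw [add_mul, one_mul, pow_add]; field_simp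
  rw [key, hfac, one_pow, one_mul, abs_mul, abs_of_nonneg (by positivity)]
  calc 2 * (lam ^ (n * r))⁻¹ * _ ≤ 2 * (lam ^ (n * r))⁻¹ * 1 := by gcongr
    _ ≤ 2 * (lam ^ n)⁻¹ := by linarith [inv_lam_pow_mul_le hlam hr n]

theorem inv_x_sub_w_le (hlam : 14 ≤ lam) {n : ℕ} (hn : 1 ≤ n) :
    (x n - w lam r n)⁻¹ ≤ 16 * n ^ 2 := by
  have h1 := half_mul_le_x_sub_w (r := r) hlam hn
  have h2 := x_sub_y_succ hn
  have hn' : (1 : ℝ) ≤ n := by exact_mod_cast hn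
  have h3 : (16 * (n : ℝ) ^ 2)⁻¹ ≤ (x n - y (n + 1)) / 2 := by
    rw [h2, div_div, inv_eq_one_div, div_le_div_iff₀ (by positivity) (by positivity)]
    nlinarith [sq_nonneg ((n : ℝ) - 1)]
  have := inv_anti₀ (by positivity) (h3.trans h1)
  rwa [inv_inv] at this

theorem IsMap.contDiffOn_phi (hf : IsMap lam r f) (hlam : 14 ≤ lam) {n : ℕ} (hn : 1 ≤ n) :
    ContDiffOn ℝ ∞ (phi lam r f n) (Icc 0 1) := by
  have hyw := y_succ_lt_w (r := r) hlam hn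
  have hxy := x_lt_y hn
  refine contDiffOn_const.mul (ContDiffOn.sub (hf.smooth.comp (t := Icc 0 4 \ {1}) ?_ ?_)
    contDiffOn_const)
  · exact (contDiff_const.add (contDiff_const.mul contDiff_id)).contDiffOn
  · intro t ht
    have hm := w_add_mem (r := r) hlam hn ht
    exact mem_Icc_of_mem_zone hn (hyw.le.trans hm.1) (hm.2.trans hxy.le)

/-- On `[w_n, x_n]` the derivatives of order `k` are `O(n^{2k} λ^{-n})`. -/
theorem IsMap.exists_abs_iteratedDeriv_le_wx (hf : IsMap lam r f) (hlam : 14 ≤ lam) (hr : 1 ≤ r)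
    {k : ℕ} (hk : 1 ≤ k) :
    ∃ C, ∀ n ≥ 1, ∀ t ∈ Icc (w lam r n) (x n),
      |iteratedDeriv k f t| ≤ C * ((n : ℝ) ^ (2 * k) * (lam ^ n)⁻¹) := by
  have h0 : 0 < lam := by linarith
  obtain ⟨B, hB⟩ := hf.phi_deriv_bounded k hk
  refine ⟨2 * 16 ^ k * B, fun n hn t ht => ?_⟩
  have hyw := y_succ_lt_w (r := r) hlam hn
  have hwx := w_lt_x (r := r) hlam hn
  have hxy := x_lt_y hn
  have hl : 0 < x n - w lam r n := by linarith
  have hpos := hf.f_w_lt_f_x hlam hr hn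
  obtain ⟨ht4, ht1⟩ := mem_Ioo_of_mem_zone hn (hyw.le.trans ht.1) (by linarith [ht.2])
  have haff : ∀ u, (x n - w lam r n)⁻¹ * u + -(w lam r n / (x n - w lam r n)) =
      1 * ((u - w lam r n) / (x n - w lam r n)) := fun u => by field_simp; ring
  have hmem : ∀ u ∈ Icc (w lam r n) (x n),
      (x n - w lam r n)⁻¹ * u + -(w lam r n / (x n - w lam r n)) ∈ Icc (0 : ℝ) 1 :=
    fun u hu => by rw [haff]; exact affine_mem_Icc hwx hu zero_le_one
  have key := iteratedDeriv_eq_of_eqOn_affine hwx one_pos ht (hf.contDiffAt ht4 ht1)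
    (hf.contDiffOn_phi hlam hn) (f (w lam r n)) (f (x n) - f (w lam r n)) (x n - w lam r n)⁻¹
    (-(w lam r n / (x n - w lam r n))) hmem (fun u hu => by
      rw [haff, phi, one_mul, mul_div_cancel₀ _ hl.ne', mul_inv_cancel_left₀ hpos.ne']
      simp) hk
  have hB' := hB n hn _ (hmem t ht)
  have hB0 : 0 ≤ B := (abs_nonneg _).trans hB'
  have h1 : f (x n) - f (w lam r n) ≤ 2 * (lam ^ n)⁻¹ := by
    rw [hf.x_sub_f_w hlam hn]
    have h2 := delta_pos (r := r) hlam
    have h3 := inv_lam_pow_mul_le hlam hr n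
    have h4 := delta_le hlam hr
    have h5 := one_lt_x hn
    calc (lam ^ (n * r))⁻¹ * x n * (1 - delta lam r) ≤ (lam ^ n)⁻¹ * 2 * 1 := by
          gcongr
          · linarith
          · exact x_le hn
          · linarith
      _ = _ := by ring
  rw [key, abs_mul, abs_of_pos hpos, abs_mul, abs_of_nonneg (by positivity)]
  calc _ ≤ 2 * (lam ^ n)⁻¹ * ((16 * (n : ℝ) ^ 2) ^ k * B) := by
        gcongr
        exact inv_x_sub_w_le hlam hn
    _ = _ := by rw [mul_pow, ← pow_mul]; ring

theorem tendsto_pow_mul_inv_pow (hlam : 14 ≤ lam) (k : ℕ) :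
    Tendsto (fun n : ℕ => (n : ℝ) ^ k * (lam ^ n)⁻¹) atTop (𝓝 0) := by
  have := tendsto_pow_const_mul_const_pow_of_abs_lt_one k (r := lam⁻¹) (by
    rw [abs_of_pos (inv_pos.2 (by linarith))]; exact inv_lt_one_of_one_lt₀ (by linarith))
  simpa only [inv_pow] using this

/-- The derivatives of order at most `r` on the zone `[y_{n+1}, y_n]` tend to `0` as `n → ∞`. -/
theorem IsMap.exists_tendsto_abs_iteratedDeriv_le (hf : IsMap lam r f) (hlam : 14 ≤ lam)
    (hr : 1 ≤ r) {k : ℕ} (hkr : k ≤ r) :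
    ∃ e : ℕ → ℝ, Tendsto e atTop (𝓝 0) ∧ ∀ n ≥ 1, ∀ t ∈ Icc (y (n + 1)) (y n),
      |iteratedDeriv k f t| ≤ e n := by
  have h0 : 0 < lam := by linarith
  have hlim : Tendsto (fun n : ℕ => (lam ^ n)⁻¹) atTop (𝓝 0) := by
    simpa using tendsto_pow_mul_inv_pow hlam 0
  rcases Nat.eq_zero_or_pos k with rfl | hk
  · refine ⟨fun n => (lam ^ n)⁻¹ * (5 / 2), by simpa using hlim.mul_const (5 / 2), ?_⟩
    intro n hn t ht
    obtain ⟨h1, h2⟩ := hf.abs_le_of_mem_zone hlam hr hn ht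
    rw [iteratedDeriv_zero, abs_of_nonneg h1]
    exact h2.trans (by linarith [inv_lam_pow_mul_le hlam hr n])
  obtain ⟨A, hA⟩ := hf.exists_abs_iteratedDeriv_le_xy hlam hk hkr
  obtain ⟨B, hB⟩ := hf.exists_abs_iteratedDeriv_le_wx hlam hr hk
  refine ⟨fun n => |A| * (1 / (n : ℝ) ^ 2) + |B| * ((n : ℝ) ^ (2 * k) * (lam ^ n)⁻¹) +
    2 * (lam ^ n)⁻¹, ?_, ?_⟩
  · have h2 : Tendsto (fun n : ℕ => 1 / (n : ℝ) ^ 2) atTop (𝓝 0) := by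
      have := (tendsto_one_div_atTop_nhds_zero_nat (𝕜 := ℝ)).pow 2
      simpa using this
    simpa using ((h2.const_mul |A|).add ((tendsto_pow_mul_inv_pow hlam (2 * k)).const_mul
      |B|)).add (hlim.const_mul 2)
  · intro n hn t ht
    have e1 : 0 ≤ |A| * (1 / (n : ℝ) ^ 2) := by positivity
    have e2 : 0 ≤ |B| * ((n : ℝ) ^ (2 * k) * (lam ^ n)⁻¹) := by positivity
    have e3 : 0 ≤ 2 * (lam ^ n)⁻¹ := by positivity
    rcases le_total t (x n) with h1 | h1
    · rcases le_total t (w lam r n) with h2 | h2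
      · have := hf.abs_iteratedDeriv_le_yw hlam hr hk hn ⟨ht.1, h2⟩
        linarith
      · have := hB n hn t ⟨h2, h1⟩
        have : B * ((n : ℝ) ^ (2 * k) * (lam ^ n)⁻¹) ≤ |B| * ((n : ℝ) ^ (2 * k) * (lam ^ n)⁻¹) := by
          gcongr; exact le_abs_self B
        linarith
    · have := hA n hn t ⟨h1, ht.2⟩
      have : A * (1 / (n : ℝ) ^ 2) ≤ |A| * (1 / (n : ℝ) ^ 2) := by
        gcongr; exact le_abs_self A
      linarith

theorem IsMap.tendsto_iteratedDeriv_right (hf : IsMap lam r f) (hlam : 14 ≤ lam)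
    (hr : 1 ≤ r) {k : ℕ} (hkr : k ≤ r) :
    Tendsto (iteratedDeriv k f) (𝓝[>] 1) (𝓝 0) := by
  obtain ⟨e, he, hbound⟩ := hf.exists_tendsto_abs_iteratedDeriv_le hlam hr hkr
  rw [Metric.tendsto_nhds]
  intro ε hε
  obtain ⟨N, hN⟩ := eventually_atTop.1 (he.eventually (gt_mem_nhds hε))
  filter_upwards [Ioo_mem_nhdsGT (one_lt_y (n := N + 1) (by omega))] with t ht
  have ht1 : t ≤ y 1 := by
    have := y_le (n := N + 1) (by omega)
    rw [y_one]; linarith [ht.2]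
  obtain ⟨n, hn, hm⟩ := exists_mem_Ioc_y ht.1 ht1
  have hnN : N ≤ n := by
    by_contra! hlt
    have : y (N + 1) < y (n + 1) := y_strictAnti (by omega) (by omega)
    linarith [hm.1, ht.2]
  rw [Real.dist_eq, sub_zero]
  exact (hbound n hn t ⟨hm.1.le, hm.2⟩).trans_lt (hN n hnN)

theorem IsMap.tendsto_iteratedDeriv_left (hf : IsMap lam r f) (hlam : 14 ≤ lam)
    (hr : 1 ≤ r) {k : ℕ} (hkr : k ≤ r) :
    Tendsto (iteratedDeriv k f) (𝓝[<] 1) (𝓝 0) := by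
  have hd := delta_pos (r := r) hlam
  obtain ⟨c, hc⟩ := exists_iteratedDeriv_mul_sub_pow ((delta lam r ^ (2 * r - 1))⁻¹) 1 (2 * r) k
  have hlim : Tendsto (fun t : ℝ => c * (t - 1) ^ (2 * r - k)) (𝓝[<] 1) (𝓝 0) := by
    have : Continuous fun t : ℝ => c * (t - 1) ^ (2 * r - k) := by fun_prop
    have := this.tendsto 1
    rw [sub_self, zero_pow (by omega), mul_zero] at this
    exact this.mono_left nhdsWithin_le_nhds
  refine hlim.congr' ?_
  filter_upwards [Ioo_mem_nhdsLT (show 1 - delta lam r < 1 by linarith)] with t ht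
  rw [← congrFun hc t]
  refine (Filter.EventuallyEq.iteratedDeriv_eq k ?_).symm
  filter_upwards [Ioo_mem_nhds ht.1 ht.2] with u hu
  exact hf.near_one u ⟨hu.1.le, hu.2.le⟩

theorem IsMap.contDiffOn_Ioo (hf : IsMap lam r f) (hlam : 14 ≤ lam) (hr : 1 ≤ r) :
    ContDiffOn ℝ r f (Ioo 0 4) := by
  refine contDiffOn_of_tendsto_iteratedDeriv isOpen_Ioo (a := 1) ⟨by norm_num, by norm_num⟩ r f
    (fun _ => 0) ?_ (fun k hk => ?_) (hf.map_one hlam hr)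
  · exact (hf.smooth.mono (sdiff_subset_sdiff_left Ioo_subset_Icc_self)).of_le
      (by exact_mod_cast le_top)
  · rw [← Iio_union_Ioi, nhdsWithin_union]
    exact (hf.tendsto_iteratedDeriv_left hlam hr hk).sup (hf.tendsto_iteratedDeriv_right hlam hr hk)

/-- The maps `f_r` are of class `C^r`. -/
theorem IsMap.contDiffOn (hf : IsMap lam r f) (hlam : 14 ≤ lam) (hr : 1 ≤ r) :
    ContDiffOn ℝ r f (Icc 0 4) := by
  intro t ht
  by_cases h : t = 1
  · subst h
    exact ((hf.contDiffOn_Ioo hlam hr).contDiffAt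
      (Ioo_mem_nhds (by norm_num) (by norm_num))).contDiffWithinAt
  · have h1 : ContDiffWithinAt ℝ r f (Icc 0 4 \ {1}) t :=
      (hf.smooth t ⟨ht, h⟩).of_le (by exact_mod_cast le_top)
    exact h1.mono_of_mem_nhdsWithin (inter_mem_nhdsWithin _ (isOpen_ne.mem_nhds h))

end Ruette

/-! ### Bounds on the derivative and its growth rate -/

namespace Ruette

variable {lam : ℝ} {r : ℕ} {f : ℝ → ℝ}

theorem IsMap.differentiableOn (hf : IsMap lam r f) (hlam : 14 ≤ lam) (hr : 1 ≤ r) :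
    DifferentiableOn ℝ f (Icc 0 4) :=
  (hf.contDiffOn hlam hr).differentiableOn (by exact_mod_cast (by omega : r ≠ 0))

theorem IsMap.continuousOn (hf : IsMap lam r f) (hlam : 14 ≤ lam) (hr : 1 ≤ r) :
    ContinuousOn f (Icc 0 4) :=
  (hf.contDiffOn hlam hr).continuousOn

theorem IsMap.derivWithin_eq_of_eqOn (hf : IsMap lam r f) (hlam : 14 ≤ lam) (hr : 1 ≤ r)
    {a b t d : ℝ} {g : ℝ → ℝ} (hab : a < b) (ht : t ∈ Icc a b) (hsub : Icc a b ⊆ Icc 0 4)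
    (heq : EqOn f g (Icc a b)) (hg : HasDerivAt g d t) :
    derivWithin f (Icc 0 4) t = d :=
  (uniqueDiffOn_Icc hab t ht).eq_deriv _
    ((hf.differentiableOn hlam hr t (hsub ht)).hasDerivWithinAt.mono hsub)
    (hg.hasDerivWithinAt.congr heq (heq ht))

theorem IsMap.derivWithin_zero (hf : IsMap lam r f) (hlam : 14 ≤ lam) (hr : 1 ≤ r) {t : ℝ}
    (ht : t ∈ Icc 0 (5 / 2 * delta lam r)) : derivWithin f (Icc 0 4) t = lam ^ r := by
  have hd := delta_pos (r := r) hlam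
  have hd' := delta_le hlam hr
  exact hf.derivWithin_eq_of_eqOn hlam hr (a := 0) (b := 5 / 2 * delta lam r) (by positivity) ht
    (Icc_subset_Icc_right (by linarith)) (fun u hu => hf.near_zero u hu)
    (by simpa using (hasDerivAt_id t).const_mul (lam ^ r))

theorem IsMap.derivWithin_half (hf : IsMap lam r f) (hlam : 14 ≤ lam) (hr : 1 ≤ r) {t : ℝ}
    (ht : t ∈ Icc (1 / 2 - delta lam r) (1 / 2 + delta lam r)) :
    derivWithin f (Icc 0 4) t = 3 * (delta lam r)⁻¹ * (1 / 2 - t) := by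
  have hd := delta_pos (r := r) hlam
  have hd' := delta_le hlam hr
  refine hf.derivWithin_eq_of_eqOn hlam hr (a := 1 / 2 - delta lam r) (b := 1 / 2 + delta lam r)
    (by linarith) ht (Icc_subset_Icc (by linarith) (by linarith))
    (fun u hu => hf.near_half u (abs_le.2 ⟨by linarith [hu.1], by linarith [hu.2]⟩)) ?_
  have := ((((hasDerivAt_id t).sub_const (1 / 2)).pow 2).const_mul
    (3 / 2 * (delta lam r)⁻¹)).const_sub 4
  refine this.congr_deriv ?_
  simp
  ring

theorem IsMap.derivWithin_one (hf : IsMap lam r f) (hlam : 14 ≤ lam) (hr : 1 ≤ r) {t : ℝ}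
    (ht : t ∈ Icc (1 - delta lam r) 1) :
    derivWithin f (Icc 0 4) t = (delta lam r ^ (2 * r - 1))⁻¹ * (2 * r * (t - 1) ^ (2 * r - 1)) := by
  have hd := delta_pos (r := r) hlam
  have hd' := delta_le hlam hr
  refine hf.derivWithin_eq_of_eqOn hlam hr (a := 1 - delta lam r) (b := 1)
    (by linarith) ht (Icc_subset_Icc (by linarith) (by linarith))
    (fun u hu => hf.near_one u hu) ?_
  have := (((hasDerivAt_id t).sub_const 1).pow (2 * r)).const_mul (delta lam r ^ (2 * r - 1))⁻¹
  refine this.congr_deriv ?_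
  simp

theorem two_mul_le_lam_pow (hlam : 14 ≤ lam) (r : ℕ) : 2 * (r : ℝ) ≤ lam ^ r := by
  have h1 : 1 + (r : ℝ) * (lam - 1) ≤ (1 + (lam - 1)) ^ r :=
    one_add_mul_le_pow (by linarith) r
  rw [add_sub_cancel] at h1
  have : (0 : ℝ) ≤ r := by positivity
  nlinarith

/-- The map is increasing on `[0, 1/2]`. -/
theorem IsMap.derivWithin_mem_left (hf : IsMap lam r f) (hlam : 14 ≤ lam) (hr : 1 ≤ r) {t : ℝ}
    (ht : t ∈ Icc (0 : ℝ) (1 / 2)) : derivWithin f (Icc 0 4) t ∈ Icc 0 (lam ^ r) := by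
  have hl := lam_pow_ge hlam hr
  have hd := delta_pos (r := r) hlam
  rcases le_total t (5 / 2 * delta lam r) with h1 | h1
  · rw [hf.derivWithin_zero hlam hr ⟨ht.1, h1⟩]
    exact ⟨by linarith, le_rfl⟩
  rcases le_total t (1 / 2 - delta lam r) with h2 | h2
  · have := hf.deriv_left t ⟨h1, h2⟩
    exact ⟨by linarith [this.1], this.2⟩
  · rw [hf.derivWithin_half hlam hr ⟨h2, by linarith [ht.2]⟩]
    have h3 : (delta lam r)⁻¹ * (1 / 2 - t) ≤ 1 := by
      rw [inv_mul_le_iff₀ hd]; linarith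
    have h4 : 0 ≤ (delta lam r)⁻¹ * (1 / 2 - t) :=
      mul_nonneg (by positivity) (by linarith [ht.2])
    rw [mul_assoc]
    exact ⟨by linarith, by linarith⟩

/-- The map is decreasing on `[1/2, 1]`. -/
theorem IsMap.derivWithin_mem_middle (hf : IsMap lam r f) (hlam : 14 ≤ lam) (hr : 1 ≤ r) {t : ℝ}
    (ht : t ∈ Icc (1 / 2 : ℝ) 1) : derivWithin f (Icc 0 4) t ∈ Icc (-lam ^ r) 0 := by
  have hl := lam_pow_ge hlam hr
  have hd := delta_pos (r := r) hlam
  rcases le_total t (1 / 2 + delta lam r) with h1 | h1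
  · rw [hf.derivWithin_half hlam hr ⟨by linarith [ht.1], h1⟩]
    have h3 : (delta lam r)⁻¹ * (t - 1 / 2) ≤ 1 := by
      rw [inv_mul_le_iff₀ hd]; linarith
    have h4 : 0 ≤ (delta lam r)⁻¹ * (t - 1 / 2) :=
      mul_nonneg (by positivity) (by linarith [ht.1])
    have h5 : 3 * (delta lam r)⁻¹ * (1 / 2 - t) = -(3 * ((delta lam r)⁻¹ * (t - 1 / 2))) := by ring
    rw [h5]
    exact ⟨by linarith, by linarith⟩
  rcases le_total t (1 - delta lam r) with h2 | h2
  · have := hf.deriv_middle t ⟨h1, h2⟩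
    exact ⟨this.1, by linarith [this.2]⟩
  · rw [hf.derivWithin_one hlam hr ⟨h2, ht.2⟩]
    have hodd : Odd (2 * r - 1) := ⟨r - 1, by omega⟩
    have h3 : (t - 1) ^ (2 * r - 1) = -(1 - t) ^ (2 * r - 1) := by
      rw [← hodd.neg_pow, neg_sub]
    have h4 : (1 - t) ^ (2 * r - 1) ≤ delta lam r ^ (2 * r - 1) :=
      pow_le_pow_left₀ (by linarith [ht.2]) (by linarith) _
    have h5 : 0 ≤ (1 - t) ^ (2 * r - 1) := pow_nonneg (by linarith [ht.2]) _
    have h6 : (delta lam r ^ (2 * r - 1))⁻¹ * (1 - t) ^ (2 * r - 1) ≤ 1 := by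
      rw [inv_mul_le_iff₀ (by positivity), mul_one]; exact h4
    have h7 : 0 ≤ (delta lam r ^ (2 * r - 1))⁻¹ * (1 - t) ^ (2 * r - 1) := by positivity
    have h8 := two_mul_le_lam_pow hlam r
    have h9 : (0 : ℝ) ≤ r := by positivity
    have h10 : (delta lam r ^ (2 * r - 1))⁻¹ * (2 * r * (t - 1) ^ (2 * r - 1)) =
        -(2 * r * ((delta lam r ^ (2 * r - 1))⁻¹ * (1 - t) ^ (2 * r - 1))) := by rw [h3]; ring
    rw [h10]
    constructor <;> nlinarith

theorem IsMap.abs_derivWithin_xy_le (hf : IsMap lam r f) (hlam : 14 ≤ lam) (hr : 1 ≤ r) {n : ℕ}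
    (hn : 1 ≤ n) {t : ℝ} (ht : t ∈ Icc (x n) (y n)) : |derivWithin f (Icc 0 4) t| ≤ lam ^ r := by
  have h0 : 0 < lam := by linarith
  obtain ⟨s, hs, hfs⟩ := hf.on_xy
  have hxy := x_lt_y hn
  have hl : 0 < y n - x n := by linarith
  have hM := M_pos hlam hn
  have hsub : Icc (x n) (y n) ⊆ Icc 0 4 := fun u hu =>
    (mem_Icc_of_mem_zone hn ((y_succ_lt_x hn).le.trans hu.1) hu.2).1
  have hmaps : ∀ u ∈ Icc (x n) (y n), (M lam n : ℝ) * ((u - x n) / (y n - x n)) ∈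
      Icc (0 : ℝ) (M lam n) := fun u hu => affine_mem_Icc hxy hu hM.le
  have h1 := ((hs.smooth n hn).differentiableOn (by simp) _ (hmaps t ht)).hasDerivWithinAt
  have h2 : HasDerivWithinAt (fun u => (M lam n : ℝ) * ((u - x n) / (y n - x n)))
      (M lam n * (1 / (y n - x n))) (Icc (x n) (y n)) t :=
    ((((hasDerivAt_id t).sub_const (x n)).div_const (y n - x n)).const_mul
      (M lam n : ℝ)).hasDerivWithinAt
  have h3 := (((h1.scomp t h2 hmaps).const_mul (y n - x n)).const_add (x n)).const_mul
    (lam ^ (n * r))⁻¹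
  have h4 := (h3.congr (fun u hu => hfs n hn u hu) (hfs n hn t ht))
  have h5 := (hf.differentiableOn hlam hr t (hsub ht)).hasDerivWithinAt.mono hsub
  rw [(uniqueDiffOn_Icc hxy t ht).eq_deriv _ h5 h4, smul_eq_mul]
  have h6 := hs.deriv_le n hn _ (hmaps t ht)
  have h7 : (lam ^ (n * r))⁻¹ * M lam n ≤ 1 := by
    have hn' : (1 : ℝ) ≤ n := by exact_mod_cast hn
    calc (lam ^ (n * r))⁻¹ * M lam n ≤ (lam ^ n)⁻¹ * (lam ^ n / n ^ 2) := by
          gcongr ?_ * ?_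
          · exact inv_lam_pow_mul_le hlam hr n
          · exact M_le hlam hn
      _ = 1 / n ^ 2 := by field_simp
      _ ≤ 1 := by rw [div_le_one (by positivity)]; nlinarith
  have h8 : (lam ^ (n * r))⁻¹ * ((y n - x n) * (M lam n * (1 / (y n - x n)) *
      derivWithin (s n) (Icc 0 (M lam n)) (M lam n * ((t - x n) / (y n - x n))))) =
      (lam ^ (n * r))⁻¹ * M lam n *
        derivWithin (s n) (Icc 0 (M lam n)) (M lam n * ((t - x n) / (y n - x n))) := by
    field_simp
  rw [h8, abs_mul, abs_of_nonneg (by positivity)]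
  calc _ ≤ 1 * lam ^ r := by gcongr
    _ = _ := one_mul _

theorem IsMap.abs_derivWithin_wx_le (hf : IsMap lam r f) (hlam : 14 ≤ lam) (hr : 1 ≤ r) {n : ℕ}
    (hn : 1 ≤ n) {t : ℝ} (ht : t ∈ Icc (w lam r n) (x n)) :
    |derivWithin f (Icc 0 4) t| ≤ lam ^ r := by
  have h0 : 0 < lam := by linarith
  obtain ⟨h1, h2⟩ := hf.derivWithin_wx_nonneg hlam hr hn ht
  rw [abs_of_nonneg h1]
  refine h2.trans ?_
  have hn' : (1 : ℝ) ≤ n := by exact_mod_cast hn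
  have hd := delta_pos (r := r) hlam
  have hd' := delta_le hlam hr
  have hx := one_lt_x hn
  have hwx := w_lt_x (r := r) hlam hn
  have h3 : (f (x n) - f (w lam r n)) / (x n - w lam r n) ≤ 1 := by
    rw [div_le_one (by linarith), hf.x_sub_f_w hlam hn]
    have h4 := half_mul_le_x_sub_w (r := r) hlam hn
    rw [x_sub_y_succ hn] at h4
    have h5 : (lam ^ (n * r))⁻¹ ≤ (14 * (n : ℝ) ^ 2)⁻¹ :=
      (inv_lam_pow_mul_le hlam hr n).trans (inv_anti₀ (by positivity) (fourteen_mul_sq_le hlam hn))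
    calc (lam ^ (n * r))⁻¹ * x n * (1 - delta lam r) ≤ (14 * (n : ℝ) ^ 2)⁻¹ * x n * 1 := by
          gcongr
          · linarith
          · linarith
      _ ≤ ((n : ℝ) + 2) / (2 * n * (n + 1) ^ 2) / 2 := by
          rw [x, mul_one, show 1 + 1 / (n : ℝ) = (n + 1) / n by field_simp, inv_mul_eq_div,
            div_div, div_div, div_le_div_iff₀ (by positivity) (by positivity)]
          nlinarith [pow_pos (by linarith : (0 : ℝ) < n) 3, pow_pos (by linarith : (0 : ℝ) < n) 2,
            mul_nonneg (sub_nonneg.2 hn') (pow_pos (by linarith : (0 : ℝ) < n) 3).le,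
            mul_nonneg (sub_nonneg.2 hn') (pow_pos (by linarith : (0 : ℝ) < n) 2).le]
      _ ≤ _ := h4
  calc _ ≤ 1 * lam ^ r := by gcongr
    _ = _ := one_mul _

/-- The derivative of the map is bounded by `λ^r`. -/
theorem IsMap.abs_derivWithin_le (hf : IsMap lam r f) (hlam : 14 ≤ lam) (hr : 1 ≤ r) {t : ℝ}
    (ht : t ∈ Icc (0 : ℝ) 4) : |derivWithin f (Icc 0 4) t| ≤ lam ^ r := by
  have h0 : 0 < lam := by linarith
  have hl := lam_pow_ge hlam hr
  rcases le_total t (1 / 2) with h1 | h1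
  · have := hf.derivWithin_mem_left hlam hr ⟨ht.1, h1⟩
    exact abs_le.2 ⟨by linarith [this.1], this.2⟩
  rcases le_or_gt t 1 with h2 | h2
  · have := hf.derivWithin_mem_middle hlam hr ⟨h1, h2⟩
    exact abs_le.2 ⟨this.1, by linarith [this.2]⟩
  rcases le_total (y 1) t with h3 | h3
  · have := hf.deriv_right t ⟨h3, ht.2⟩
    exact abs_le.2 ⟨by linarith [this.1], this.2⟩
  obtain ⟨n, hn, hm⟩ := exists_mem_Ioc_y h2 h3
  rcases le_total (x n) t with h4 | h4
  · exact hf.abs_derivWithin_xy_le hlam hr hn ⟨h4, hm.2⟩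
  rcases le_total (w lam r n) t with h5 | h5
  · exact hf.abs_derivWithin_wx_le hlam hr hn ⟨h5, h4⟩
  · rw [hf.derivWithin_yw hlam hn ⟨hm.1.le, h5⟩, abs_of_nonneg (by positivity), add_mul, one_mul,
      pow_add]
    have h6 : (lam ^ (n * r) * lam ^ r)⁻¹ * (2 * lam ^ r) = 2 * (lam ^ (n * r))⁻¹ := by field_simp
    have h7 : (lam ^ (n * r))⁻¹ ≤ 1 := inv_le_one_of_one_le₀ (one_le_pow₀ (by linarith))
    rw [h6]; linarith

theorem IsMap.abs_derivWithin_iterate_le (hf : IsMap lam r f) (hlam : 14 ≤ lam) (hr : 1 ≤ r)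
    (k : ℕ) : ∀ t ∈ Icc (0 : ℝ) 4, ∃ d, |d| ≤ (lam ^ r) ^ k ∧
      HasDerivWithinAt f^[k] d (Icc 0 4) t := by
  have h0 : 0 < lam := by linarith
  induction k with
  | zero => exact fun t _ => ⟨1, by simp, hasDerivWithinAt_id t _⟩
  | succ k ih =>
    intro t ht
    obtain ⟨d, hd, h⟩ := ih (f t) (hf.mapsTo ht)
    refine ⟨_, ?_, h.comp t (hf.differentiableOn hlam hr t ht).hasDerivWithinAt hf.mapsTo⟩
    rw [abs_mul, pow_succ]
    gcongr
    exact hf.abs_derivWithin_le hlam hr ht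

/-- `R(f_r) = λ^r`: the derivative is at most `λ^r`, with equality at the fixed point `0`. -/
theorem IsMap.derivSpectralRadius_eq (hf : IsMap lam r f) (hlam : 14 ≤ lam) (hr : 1 ≤ r) :
    derivSpectralRadius (Icc 0 4) f = lam ^ r := by
  have h0 : 0 < lam := by linarith
  have hd := delta_pos (r := r) hlam
  have hz : (0 : ℝ) ∈ Icc (0 : ℝ) 4 := ⟨le_rfl, by norm_num⟩
  have huniq := uniqueDiffOn_Icc (show (0 : ℝ) < 4 by norm_num)
  have hle : ∀ (k : ℕ) (t : Icc (0 : ℝ) 4), |derivWithin f^[k] (Icc 0 4) t| ≤ (lam ^ r) ^ k := by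
    intro k t
    obtain ⟨d, hd, h⟩ := hf.abs_derivWithin_iterate_le hlam hr k t t.2
    rwa [h.derivWithin (huniq t t.2)]
  have hzero : ∀ k : ℕ, |derivWithin f^[k] (Icc 0 4) (⟨0, hz⟩ : Icc (0 : ℝ) 4)| =
      (lam ^ r) ^ k := by
    intro k
    have h := HasDerivWithinAt.iterate (0 : ℝ) (hf.differentiableOn hlam hr 0 hz).hasDerivWithinAt
      (hf.map_zero hlam) hf.mapsTo k
    rw [h.derivWithin (huniq 0 hz), hf.derivWithin_zero hlam hr ⟨le_rfl, by positivity⟩,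
      abs_of_pos (by positivity)]
  have hsup : ∀ k : ℕ, (⨆ t : Icc (0 : ℝ) 4, |derivWithin f^[k] (Icc 0 4) t|) = (lam ^ r) ^ k := by
    intro k
    have : Nonempty (Icc (0 : ℝ) 4) := ⟨⟨0, hz⟩⟩
    refine le_antisymm (ciSup_le (hle k)) ?_
    rw [← hzero k]
    exact le_ciSup (f := fun t : Icc (0 : ℝ) 4 => |derivWithin f^[k] (Icc 0 4) t|)
      ⟨_, by rintro _ ⟨t, rfl⟩; exact hle k t⟩ ⟨0, hz⟩
  have hconst : ∀ k : ℕ+, (⨆ t : Icc (0 : ℝ) 4, |derivWithin f^[(k : ℕ)] (Icc 0 4) t|) ^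
      ((k : ℝ)⁻¹) = lam ^ r := fun k => by
    rw [hsup k]
    exact Real.pow_rpow_inv_natCast (by positivity) k.ne_zero
  simp only [derivSpectralRadius, hconst, ciInf_const]

end Ruette

/-! ### Growth of the total variation of the iterates -/

/-- On a set that `f` maps monotonically into `S'`, the variation of `f^{n+1}` is at most the
variation of `f^n` on `S'`. -/
theorem eVariationOn_iterate_succ_le {f : ℝ → ℝ} {S S' : Set ℝ}
    (h : MonotoneOn f S ∨ AntitoneOn f S) (hS : MapsTo f S S') (n : ℕ) :
    eVariationOn f^[n + 1] S ≤ eVariationOn f^[n] S' := by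
  rw [Function.iterate_succ]
  rcases h with h | h
  · rw [eVariationOn.comp_eq_of_monotoneOn _ _ h]
    exact eVariationOn.mono _ hS.image_subset
  · rw [eVariationOn.comp_eq_of_antitoneOn _ _ h]
    exact eVariationOn.mono _ hS.image_subset

theorem eVariationOn_Icc_le_add (g : ℝ → ℝ) {a b c : ℝ} (hab : a ≤ b) (hbc : b ≤ c)
    {p q : ℝ} (hp : 0 ≤ p) (hq : 0 ≤ q)
    (h1 : eVariationOn g (Icc a b) ≤ ENNReal.ofReal p)
    (h2 : eVariationOn g (Icc b c) ≤ ENNReal.ofReal q) :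
    eVariationOn g (Icc a c) ≤ ENNReal.ofReal (p + q) := by
  have := eVariationOn.Icc_add_Icc g (s := univ) hab hbc (mem_univ b)
  simp only [univ_inter] at this
  rw [← this, ENNReal.ofReal_add hp hq]
  exact add_le_add h1 h2

/-- The variation on an interval divided into `N` equal parts. -/
theorem eVariationOn_Icc_le_of_parts (g : ℝ → ℝ) {a l B : ℝ} (hl : 0 ≤ l) (hB : 0 ≤ B) (N : ℕ)
    (h : ∀ i < N, eVariationOn g (Icc (a + l * i) (a + l * (i + 1))) ≤ ENNReal.ofReal B) :
    eVariationOn g (Icc a (a + l * N)) ≤ ENNReal.ofReal (N * B) := by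
  induction N with
  | zero => simp
  | succ N ih =>
    have := eVariationOn_Icc_le_add g (a := a) (b := a + l * N) (c := a + l * (N + 1))
      (by nlinarith [(Nat.cast_nonneg N : (0 : ℝ) ≤ N)]) (by nlinarith) (by positivity) hB
      (ih fun i hi => h i (by omega)) (h N (by omega))
    push_cast
    rwa [add_mul, one_mul]

namespace Ruette

variable {lam : ℝ} {r : ℕ} {f : ℝ → ℝ}

/-- A set that reaches `S` after `j` multiplications by `λ^r` contributes to the variation of `f^n`
at most `λ^{-j}` times the bound for `S`. -/
theorem IsMap.eVariationOn_scaled_le (hf : IsMap lam r f) (hlam : 14 ≤ lam) (hr : 1 ≤ r)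
    {a b : ℝ} (ha : 0 ≤ a) (hb : b ≤ 5 / 2) {v : ℝ} (hv : 0 ≤ v) (j : ℕ) : ∀ n : ℕ,
    (∀ k ≤ n, eVariationOn f^[k] (Icc a b) ≤ ENNReal.ofReal (v * lam ^ k)) →
    eVariationOn f^[n] (Icc ((lam ^ (j * r))⁻¹ * a) ((lam ^ (j * r))⁻¹ * b)) ≤
      ENNReal.ofReal (v * lam ^ n / lam ^ j) := by
  have h0 : 0 < lam := by linarith
  induction j with
  | zero =>
    intro n h
    simpa using h n le_rfl
  | succ j ih =>
    intro n h
    have hc : 0 < (lam ^ ((j + 1) * r))⁻¹ := by positivity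
    cases n with
    | zero =>
      have h1 := h 0 le_rfl
      simp only [Function.iterate_zero, pow_zero, mul_one, eVariationOn_id_Icc] at h1 ⊢
      rw [ENNReal.ofReal_le_ofReal_iff hv] at h1
      refine ENNReal.ofReal_le_ofReal ?_
      have h2 := inv_lam_pow_mul_le hlam hr (j + 1)
      calc (lam ^ ((j + 1) * r))⁻¹ * b - (lam ^ ((j + 1) * r))⁻¹ * a
          = (lam ^ ((j + 1) * r))⁻¹ * (b - a) := by ring
        _ ≤ (lam ^ ((j + 1) * r))⁻¹ * v := by gcongr
        _ ≤ (lam ^ (j + 1))⁻¹ * v := by gcongr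
        _ = _ := by ring
    | succ n =>
      have hmem : ∀ t ∈ Icc ((lam ^ ((j + 1) * r))⁻¹ * a) ((lam ^ ((j + 1) * r))⁻¹ * b),
          ∃ u ∈ Icc a b, t = (lam ^ ((j + 1) * r))⁻¹ * u := fun t ht => by
        refine ⟨lam ^ ((j + 1) * r) * t, ⟨?_, ?_⟩, ?_⟩
        · have := ht.1; rwa [inv_mul_le_iff₀ (by positivity)] at this
        · have := ht.2; rwa [le_inv_mul_iff₀ (by positivity)] at this
        · field_simp
      have hval : ∀ u ∈ Icc a b, f ((lam ^ ((j + 1) * r))⁻¹ * u) = (lam ^ (j * r))⁻¹ * u :=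
        fun u hu => hf.map_scaled hlam j ⟨ha.trans hu.1, hu.2.trans hb⟩
      refine (eVariationOn_iterate_succ_le
        (S' := Icc ((lam ^ (j * r))⁻¹ * a) ((lam ^ (j * r))⁻¹ * b)) (Or.inl ?_) ?_ n).trans ?_
      · intro t ht t' ht' htt
        obtain ⟨u, hu, rfl⟩ := hmem t ht
        obtain ⟨u', hu', rfl⟩ := hmem t' ht'
        rw [hval u hu, hval u' hu']
        have := le_of_mul_le_mul_left htt hc
        gcongr
      · intro t ht
        obtain ⟨u, hu, rfl⟩ := hmem t ht
        rw [hval u hu]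
        constructor
        · gcongr; exact hu.1
        · gcongr; exact hu.2
      · refine (ih n fun k hk => h k (by omega)).trans (le_of_eq ?_)
        congr 1
        rw [pow_succ, pow_succ]
        field_simp

/-- The bound `u_m` for the zone `[y_{m+1}, y_m]`. -/
noncomputable def zoneBound (lam : ℝ) (m : ℕ) : ℝ := 8 / lam ^ (m + 1) + 1 / m ^ 2

theorem zoneBound_pos (hlam : 14 ≤ lam) {m : ℕ} (hm : 1 ≤ m) : 0 < zoneBound lam m := by
  have : 0 < lam := by linarith
  simp only [zoneBound]; positivity

/-- The recursion for the zone `[y_{m+1}, y_m]`: the oscillating part returns to the zone in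
`M_m ≤ λ^m` laps, the affine part returns once, and the connecting part covers a piece of
`[0, 4]`. -/
theorem IsMap.eVariationOn_zone_succ_le (hf : IsMap lam r f) (hlam : 14 ≤ lam) (hr : 1 ≤ r)
    {m : ℕ} (hm : 1 ≤ m) (n : ℕ)
    (hV : ∀ k ≤ n, eVariationOn f^[k] (Icc 0 4) ≤ ENNReal.ofReal (4 * lam ^ k))
    (hU : ∀ k ≤ n, eVariationOn f^[k] (Icc (y (m + 1)) (y m)) ≤
      ENNReal.ofReal (zoneBound lam m * lam ^ k)) :
    eVariationOn f^[n + 1] (Icc (y (m + 1)) (y m)) ≤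
      ENNReal.ofReal (zoneBound lam m * lam ^ (n + 1)) := by
  have h0 : 0 < lam := by linarith
  have hu := zoneBound_pos hlam hm
  have hxy := x_lt_y hm
  have hyw := y_succ_lt_w (r := r) hlam hm
  have hwx := w_lt_x (r := r) hlam hm
  have hy := y_le hm
  have hy1 := one_lt_y (n := m + 1) (by omega)
  have hM := M_pos hlam hm
  set U := zoneBound lam m with hUdef
  -- On `[y_{m+1}, w_m]` the image is `λ^{-(m+1)r} [y_{m+1}, x_m]`, which returns to the zone.
  have hB : eVariationOn f^[n + 1] (Icc (y (m + 1)) (w lam r m)) ≤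
      ENNReal.ofReal (U * lam ^ n / lam ^ (m + 1)) := by
    refine (eVariationOn_iterate_succ_le (Or.inl ?_) ?_ n).trans
      (hf.eVariationOn_scaled_le hlam hr (by linarith) hy hu.le (m + 1) n hU)
    · intro t ht t' ht' htt
      rw [hf.map_yw hlam hm ht, hf.map_yw hlam hm ht']
      gcongr
    · intro t ht
      have h1 : f t ≤ f (w lam r m) := by
        rw [hf.map_yw hlam hm ht, hf.map_yw hlam hm ⟨hyw.le, le_rfl⟩]
        gcongr; exact ht.2
      rw [hf.map_w hlam hm] at h1
      refine ⟨?_, h1.trans (by gcongr)⟩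
      rw [hf.map_yw hlam hm ht]
      have : 0 ≤ 2 * lam ^ r * (t - y (m + 1)) := mul_nonneg (by positivity) (by linarith [ht.1])
      gcongr
      linarith
  -- On `[w_m, x_m]` the image lies in `λ^{-mr} [0, x_m]`, and nothing better than the variation over
  -- `[0, 4]` is used after its return.
  have hC : eVariationOn f^[n + 1] (Icc (w lam r m) (x m)) ≤
      ENNReal.ofReal (4 * lam ^ n / lam ^ m) := by
    refine (eVariationOn_iterate_succ_le (Or.inl (hf.monotoneOn_wx hlam hr hm)) ?_ n).trans
      (hf.eVariationOn_scaled_le hlam hr (a := 0) (b := x m) le_rfl (by linarith)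
        (by norm_num) m n fun k hk =>
        (eVariationOn.mono _ (Icc_subset_Icc_right (by linarith))).trans (hV k hk))
    intro t ht
    rw [mul_zero, ← hf.map_x hm]
    exact ⟨(hf.mapsTo (mem_Icc_of_mem_zone hm (hyw.le.trans ht.1) (ht.2.trans hxy.le)).1).1,
      hf.monotoneOn_wx hlam hr hm ht ⟨hwx.le, le_rfl⟩ ht.2⟩
  -- On `[x_m, y_m]` each of the `M_m` laps is mapped monotonically into `λ^{-mr} [y_{m+1}, y_m]`.
  have hA : eVariationOn f^[n + 1] (Icc (x m) (y m)) ≤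
      ENNReal.ofReal (M lam m * (U * lam ^ n / lam ^ m)) := by
    obtain ⟨s, hs, hfs⟩ := hf.on_xy
    have hl : 0 < y m - x m := by linarith
    have hp := eVariationOn_Icc_le_of_parts f^[n + 1] (a := x m) (l := (y m - x m) / M lam m)
      (B := U * lam ^ n / lam ^ m) (by positivity) (by positivity) (M lam m) fun i hi => ?_
    · rwa [div_mul_cancel₀ _ hM.ne', add_sub_cancel] at hp
    have hi' : (i : ℝ) + 1 ≤ M lam m := by exact_mod_cast hi
    have hsub : Icc (x m + (y m - x m) / M lam m * i) (x m + (y m - x m) / M lam m * (i + 1)) ⊆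
        Icc (x m) (y m) := by
      refine Icc_subset_Icc (le_add_of_nonneg_right (by positivity)) ?_
      have : (y m - x m) / M lam m * (i + 1) ≤ (y m - x m) / M lam m * M lam m := by gcongr
      rw [div_mul_cancel₀ _ hM.ne'] at this
      linarith
    have hscale : ∀ t ∈ Icc (x m + (y m - x m) / M lam m * i)
        (x m + (y m - x m) / M lam m * (i + 1)),
        (M lam m : ℝ) * ((t - x m) / (y m - x m)) ∈ Icc (i : ℝ) (i + 1) := fun t ht => by
      have e : ∀ c : ℝ, (y m - x m) / M lam m * c = c * (y m - x m) / M lam m := fun c => by ring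
      have h1 := ht.1
      have h2 := ht.2
      rw [e, ← le_sub_iff_add_le', div_le_iff₀ hM] at h1
      rw [e, ← sub_le_iff_le_add', le_div_iff₀ hM] at h2
      rw [← mul_div_assoc]
      exact ⟨by rw [le_div_iff₀ hl]; linarith, by rw [div_le_iff₀ hl]; linarith⟩
    have hmonoscale : ∀ t t', t ≤ t' → (M lam m : ℝ) * ((t - x m) / (y m - x m)) ≤
        M lam m * ((t' - x m) / (y m - x m)) := fun t t' h => by gcongr
    have hmaps : MapsTo f (Icc (x m + (y m - x m) / M lam m * i)
        (x m + (y m - x m) / M lam m * (i + 1)))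
        (Icc ((lam ^ (m * r))⁻¹ * y (m + 1)) ((lam ^ (m * r))⁻¹ * y m)) := fun t ht => by
      obtain ⟨u, hu, h⟩ := hf.exists_map_xy hlam hm (hsub ht)
      rw [h]
      constructor
      · gcongr; exact hu.1
      · gcongr; exact hu.2
    refine (eVariationOn_iterate_succ_le ?_ hmaps n).trans
      (hf.eVariationOn_scaled_le hlam hr (by linarith) hy hu.le m n hU)
    have hcc : 0 ≤ (lam ^ (m * r))⁻¹ := by positivity
    rcases Nat.even_or_odd' i with ⟨k, rfl | rfl⟩
    · left
      intro t ht t' ht' htt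
      rw [hfs m hm t (hsub ht), hfs m hm t' (hsub ht')]
      have e := (hs.increasing m hm k (by omega)).monotoneOn
        (by simpa using hscale t ht) (by simpa using hscale t' ht') (hmonoscale t t' htt)
      gcongr
    · right
      intro t ht t' ht' htt
      rw [hfs m hm t (hsub ht), hfs m hm t' (hsub ht')]
      have e2 : ((2 * k + 1 : ℕ) : ℝ) + 1 = 2 * k + 2 := by push_cast; ring
      have g1 := hscale t ht
      have g2 := hscale t' ht'
      rw [e2] at g1 g2
      have e := (hs.decreasing m hm k (by omega)).antitoneOn
        (by simpa using g1) (by simpa using g2) (hmonoscale t t' htt)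
      gcongr
  refine (eVariationOn_Icc_le_add _ (hyw.trans hwx).le hxy.le (by positivity) (by positivity)
    (eVariationOn_Icc_le_add _ hyw.le hwx.le (by positivity) (by positivity) hB hC) hA).trans
    (ENNReal.ofReal_le_ofReal ?_)
  have hMle : (M lam m : ℝ) ≤ lam ^ m := (M_le hlam hm).trans
    (div_le_self (by positivity) (one_le_pow₀ (by exact_mod_cast hm)))
  have t1 : (M lam m : ℝ) * (U * lam ^ n / lam ^ m) ≤ U * lam ^ n := by
    rw [mul_div_assoc', div_le_iff₀ (by positivity), mul_comm]
    gcongr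
  have t2 : U * lam ^ n / lam ^ (m + 1) ≤ U * lam ^ n :=
    div_le_self (by positivity) (one_le_pow₀ (by linarith))
  -- The summand `8 λ^{-m-1}` of `u_m` is chosen for this estimate.
  have t3 : 4 * lam ^ n / lam ^ m ≤ lam / 2 * U * lam ^ n := by
    have : 8 / lam ^ (m + 1) ≤ U := by
      rw [hUdef, zoneBound]; linarith [show (0 : ℝ) ≤ 1 / m ^ 2 by positivity]
    calc 4 * lam ^ n / lam ^ m = lam / 2 * (8 / lam ^ (m + 1)) * lam ^ n := by
          rw [pow_succ]; field_simp; norm_num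
      _ ≤ _ := by gcongr
  have t4 : 0 ≤ U * lam ^ n := by positivity
  have t5 : (1 + 1 + lam / 2) * (U * lam ^ n) ≤ lam * (U * lam ^ n) :=
    mul_le_mul_of_nonneg_right (by linarith) t4
  rw [pow_succ lam n]
  linarith

/-- The variation near `1` is the sum over the zones: the sum of the `u_m` is at most `2.1`. -/
theorem eVariationOn_tail_le (hlam : 14 ≤ lam) {g : ℝ → ℝ} {B : ℝ} (hB : 0 ≤ B)
    (h : ∀ m ≥ 1, eVariationOn g (Icc (y (m + 1)) (y m)) ≤
      ENNReal.ofReal (zoneBound lam m * B)) (N : ℕ) :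
    eVariationOn g (Icc (y (N + 1)) (y 1)) ≤
      ENNReal.ofReal (((8 / 13) * (1 / lam - 1 / lam ^ (N + 1)) + (2 - 2 / (N + 1))) * B) := by
  have h0 : 0 < lam := by linarith
  induction N with
  | zero => simp
  | succ N ih =>
    have hp : 0 ≤ (8 / 13) * (1 / lam - 1 / lam ^ (N + 1)) + (2 - 2 / ((N : ℝ) + 1)) := by
      have h1 : 1 / lam ^ (N + 1) ≤ 1 / lam := by
        apply one_div_le_one_div_of_le h0
        exact le_self_pow₀ (by linarith) (by omega)
      have h2 : 2 / ((N : ℝ) + 1) ≤ 2 := by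
        rw [div_le_iff₀ (by positivity)]; nlinarith [(Nat.cast_nonneg N : (0 : ℝ) ≤ N)]
      linarith
    have hz := zoneBound_pos hlam (m := N + 1) (by omega)
    refine (eVariationOn_Icc_le_add g (y_strictAnti (by omega) (by omega : N + 1 < N + 1 + 1)).le
      ?_ (by positivity) (by positivity) (h (N + 1) (by omega)) ih).trans
      (ENNReal.ofReal_le_ofReal ?_)
    · rcases Nat.eq_zero_or_pos N with rfl | hN
      · rfl
      · exact (y_strictAnti le_rfl (by omega)).le
    · rw [← add_mul]
      refine mul_le_mul_of_nonneg_right ?_ hB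
      rw [zoneBound]
      push_cast
      have h1 : 8 / lam ^ (N + 1 + 1) ≤ 8 / 13 * (1 / lam ^ (N + 1) - 1 / lam ^ (N + 1 + 1)) := by
        have : 0 < lam ^ (N + 1) := by positivity
        rw [pow_succ lam (N + 1)]
        field_simp
        linarith
      have h2 : 1 / ((N : ℝ) + 1) ^ 2 ≤ 2 / (N + 1) - 2 / (N + 1 + 1) := by
        have : (0 : ℝ) ≤ N := by positivity
        rw [div_sub_div _ _ (by positivity) (by positivity), div_le_div_iff₀ (by positivity)
          (by positivity)]
        nlinarith
      linarith

/-- For a function continuous at `1` the variation up to `1` is the limit of the variations up to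
`y_N`. -/
theorem eVariationOn_Icc_one_le {g : ℝ → ℝ} (hg : ContinuousAt g 1) {B : ℝ≥0∞}
    (h : ∀ N : ℕ, eVariationOn g (Icc (y (N + 1)) (y 1)) ≤ B) :
    eVariationOn g (Icc 1 (y 1)) ≤ B := by
  rw [← eVariationOn.eVariationOn_Ioc_eq_Icc_of_continuousWithinAt hg.continuousWithinAt]
  refine iSup_le ?_
  rintro ⟨n, u, hu, hmem⟩
  obtain ⟨N, hN⟩ := ((tendsto_y.comp (tendsto_add_atTop_nat 1)).eventually
    (gt_mem_nhds (hmem 0).1)).exists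
  refine (eVariationOn.sum_le hu fun i => ?_).trans (h N)
  exact ⟨hN.le.trans (hu (Nat.zero_le i)), (hmem i).2⟩

theorem IsMap.monotoneOn_left (hf : IsMap lam r f) (hlam : 14 ≤ lam) (hr : 1 ≤ r) :
    MonotoneOn f (Icc 0 (1 / 2)) := by
  have hsub : Icc (0 : ℝ) (1 / 2) ⊆ Icc 0 4 := Icc_subset_Icc_right (by norm_num)
  exact monotoneOn_of_derivWithin ((hf.continuousOn hlam hr).mono hsub) fun t ht => ⟨_,
    (hf.derivWithin_mem_left hlam hr (Ioo_subset_Icc_self ht)).1,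
    (hf.differentiableOn hlam hr t (hsub (Ioo_subset_Icc_self ht))).hasDerivWithinAt.mono hsub⟩

theorem IsMap.antitoneOn_middle (hf : IsMap lam r f) (hlam : 14 ≤ lam) (hr : 1 ≤ r) :
    AntitoneOn f (Icc (1 / 2) 1) := by
  have hsub : Icc (1 / 2 : ℝ) 1 ⊆ Icc 0 4 := Icc_subset_Icc (by norm_num) (by norm_num)
  have : MonotoneOn (-f) (Icc (1 / 2) 1) :=
    monotoneOn_of_derivWithin ((hf.continuousOn hlam hr).mono hsub).neg fun t ht => ⟨_,
      neg_nonneg.2 (hf.derivWithin_mem_middle hlam hr (Ioo_subset_Icc_self ht)).2,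
      ((hf.differentiableOn hlam hr t
        (hsub (Ioo_subset_Icc_self ht))).hasDerivWithinAt.mono hsub).neg⟩
  simpa using this.neg

theorem IsMap.monotoneOn_right (hf : IsMap lam r f) (hlam : 14 ≤ lam) (hr : 1 ≤ r) :
    MonotoneOn f (Icc (y 1) 4) := by
  have hsub : Icc (y 1) 4 ⊆ Icc 0 4 := Icc_subset_Icc_left (by norm_num [y_one])
  exact monotoneOn_of_derivWithin ((hf.continuousOn hlam hr).mono hsub) fun t ht => ⟨_,
    by linarith [(hf.deriv_right t (Ioo_subset_Icc_self ht)).1],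
    (hf.differentiableOn hlam hr t (hsub (Ioo_subset_Icc_self ht))).hasDerivWithinAt.mono hsub⟩

theorem IsMap.continuousAt_iterate_one (hf : IsMap lam r f) (hlam : 14 ≤ lam) (hr : 1 ≤ r)
    (n : ℕ) : ContinuousAt f^[n] 1 := by
  obtain ⟨d, -, h⟩ := hf.abs_derivWithin_iterate_le hlam hr n 1 ⟨by norm_num, by norm_num⟩
  exact h.continuousWithinAt.continuousAt (Icc_mem_nhds (by norm_num) (by norm_num))

/-- The total variation of `f^n` is at most `4 λ^n`. In the induction, three monotone pieces of
`[0, 4]` contribute at most the variation of `f^{n-1}` each, and the zones contribute the sum of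
the `u_m`. -/
theorem IsMap.eVariationOn_iterate_le (hf : IsMap lam r f) (hlam : 14 ≤ lam) (hr : 1 ≤ r)
    (n : ℕ) : eVariationOn f^[n] (Icc 0 4) ≤ ENNReal.ofReal (4 * lam ^ n) ∧
      ∀ m ≥ 1, eVariationOn f^[n] (Icc (y (m + 1)) (y m)) ≤
        ENNReal.ofReal (zoneBound lam m * lam ^ n) := by
  have h0 : 0 < lam := by linarith
  induction n using Nat.strong_induction_on with
  | _ n ih =>
  cases n with
  | zero =>
    simp only [Function.iterate_zero, pow_zero, mul_one, eVariationOn_id_Icc]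
    refine ⟨by norm_num, fun m hm => ENNReal.ofReal_le_ofReal ?_⟩
    rw [zoneBound]
    linarith [y_sub_y_succ_le hm, show 0 < 8 / lam ^ (m + 1) by positivity]
  | succ n =>
    have hU : ∀ m ≥ 1, eVariationOn f^[n + 1] (Icc (y (m + 1)) (y m)) ≤
        ENNReal.ofReal (zoneBound lam m * lam ^ (n + 1)) := fun m hm =>
      hf.eVariationOn_zone_succ_le hlam hr hm n (fun k hk => (ih k (by omega)).1)
        fun k hk => (ih k (by omega)).2 m hm
    refine ⟨?_, hU⟩
    have hV := (ih n (by omega)).1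
    have h1 := (eVariationOn_iterate_succ_le (Or.inl (hf.monotoneOn_left hlam hr))
      (hf.mapsTo.mono_left (Icc_subset_Icc_right (by norm_num))) n).trans hV
    have h2 := (eVariationOn_iterate_succ_le (Or.inr (hf.antitoneOn_middle hlam hr))
      (hf.mapsTo.mono_left (Icc_subset_Icc (by norm_num) (by norm_num))) n).trans hV
    have h4 := (eVariationOn_iterate_succ_le (Or.inl (hf.monotoneOn_right hlam hr))
      (hf.mapsTo.mono_left (Icc_subset_Icc_left (by norm_num [y_one]))) n).trans hV
    have h3 : eVariationOn f^[n + 1] (Icc 1 (y 1)) ≤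
        ENNReal.ofReal ((8 / 13 * (1 / lam) + 2) * lam ^ (n + 1)) := by
      refine eVariationOn_Icc_one_le (hf.continuousAt_iterate_one hlam hr _) fun N => ?_
      refine (eVariationOn_tail_le hlam (by positivity) hU N).trans (ENNReal.ofReal_le_ofReal ?_)
      have e1 : 0 < 1 / lam ^ (N + 1) := by positivity
      have e2 : 0 < 2 / ((N : ℝ) + 1) := by positivity
      exact mul_le_mul_of_nonneg_right (by linarith) (by positivity)
    have hy := one_lt_y le_rfl
    have h5 := eVariationOn_Icc_le_add _ (by norm_num) (by norm_num) (by positivity)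
      (by positivity) h1 (eVariationOn_Icc_le_add _ (by norm_num) (by norm_num [y_one])
        (by positivity) (by positivity) h2 (eVariationOn_Icc_le_add _ hy.le (by norm_num [y_one])
          (by positivity) (by positivity) h3 h4))
    -- The monotone pieces give `12 λ^n` and the zones less than `2.1 λ^{n+1}`; this is at most
    -- `4 λ^{n+1}` for `λ ≥ 14`.
    refine h5.trans (ENNReal.ofReal_le_ofReal ?_)
    have e : 1 / lam ≤ 1 / 14 := one_div_le_one_div_of_le (by norm_num) hlam
    have e1 : (8 / 13 * (1 / lam) + 2) * lam ^ (n + 1) ≤ (8 / 13 * (1 / 14) + 2) * lam ^ (n + 1) := by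
      gcongr
    have e2 : 0 < lam ^ n := by positivity
    rw [pow_succ lam n] at e1 ⊢
    nlinarith

theorem IsMap.coverEntropy_le (hf : IsMap lam r f) (hlam : 14 ≤ lam) (hr : 1 ≤ r) :
    Dynamics.coverEntropy (hf.mapsTo.restrict f (Icc 0 4) (Icc 0 4)) univ ≤
      (Real.log lam : EReal) :=
  coverEntropy_le_log_of_eVariationOn_le hf.mapsTo (by linarith) (by norm_num : (0 : ℝ) ≤ 4)
    fun n => (hf.eVariationOn_iterate_le hlam hr n).1

end Ruette

/-! ### Horseshoes near the accumulation point -/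

namespace Ruette

variable {lam : ℝ} {r : ℕ} {f : ℝ → ℝ}

/-- The map `f^{n+1}` on `[x_n, y_n]` is the rescaled oscillation. -/
theorem IsMap.iterate_xy (hf : IsMap lam r f) (hlam : 14 ≤ lam) {n : ℕ} (hn : 1 ≤ n) {t : ℝ}
    (ht : t ∈ Icc (x n) (y n)) {k : ℕ} (hk : k ≤ n) :
    ∃ u ∈ Icc (y (n + 1)) (y n), f t = (lam ^ (n * r))⁻¹ * u ∧
      f^[k + 1] t = (lam ^ ((n - k) * r))⁻¹ * u := by
  obtain ⟨u, hu, h⟩ := hf.exists_map_xy hlam hn ht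
  refine ⟨u, hu, h, ?_⟩
  have hy := y_le hn
  have hy1 := one_lt_y (n := n + 1) (by omega)
  have := hf.iterate_scaled hlam k (n - k) (t := u) ⟨by linarith [hu.1], by linarith [hu.2]⟩
  rw [Nat.sub_add_cancel hk] at this
  rw [Function.iterate_succ_apply, h, this]

theorem IsOscillation.surjOn {s : ℕ → ℝ → ℝ} (hs : IsOscillation lam r s) (hlam : 14 ≤ lam)
    {n : ℕ} (hn : 1 ≤ n) {i : ℕ} (hi : 2 * i + 1 ≤ M lam n) :
    Icc 0 1 ⊆ s n '' Icc (2 * i : ℝ) (2 * i + 1) := by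
  have hd := delta_pos (r := r) hlam
  have hi' : (2 * i : ℝ) + 1 ≤ M lam n := by exact_mod_cast hi
  have h0 : s n (2 * i) ≤ 0 := by
    rcases Nat.eq_zero_or_pos i with rfl | hpos
    · simp [hs.left_end n hn]
    · have := hs.near_min n hn (2 * i) (by omega) (by omega) (even_two_mul i) (2 * i)
        (by push_cast; simp [hd.le])
      rw [this]
      have hm : 0 ≤ m n := by
        rw [m, sub_nonneg, div_le_one (by positivity)]
        have : (0 : ℝ) ≤ n := by positivity
        nlinarith
      push_cast
      simpa using hm
  have h1 : s n (2 * i + 1) = 1 := by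
    rcases hi.eq_or_lt with h | h
    · have h' : (2 * i : ℝ) + 1 = M lam n := by exact_mod_cast h
      rw [h', hs.right_end n hn]
    · have := hs.near_max n hn (2 * i + 1) (by omega) h (odd_two_mul_add_one i) (2 * i + 1)
        (by push_cast; simp [hd.le])
      rw [this]; push_cast; simp
  have hc : ContinuousOn (s n) (Icc (2 * i : ℝ) (2 * i + 1)) :=
    (hs.smooth n hn).continuousOn.mono (Icc_subset_Icc (by positivity) hi')
  refine Subset.trans ?_ (intermediate_value_Icc (by linarith) hc)
  rw [h1]
  exact Icc_subset_Icc_left h0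

/-- The `i`-th increasing lap of `f^{n+1}` on `[x_n, y_n]`. -/
def lap (lam : ℝ) (n i : ℕ) : Set ℝ :=
  Icc (x n + (y n - x n) / M lam n * (2 * i)) (x n + (y n - x n) / M lam n * (2 * i + 1))

theorem lap_subset (hlam : 14 ≤ lam) {n : ℕ} (hn : 1 ≤ n) {i : ℕ} (hi : 2 * i + 1 ≤ M lam n) :
    lap lam n i ⊆ Icc (x n) (y n) := by
  have hM := M_pos hlam hn
  have hl : 0 < y n - x n := sub_pos.2 (x_lt_y hn)
  have hi' : (2 * i : ℝ) + 1 ≤ M lam n := by exact_mod_cast hi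
  refine Icc_subset_Icc (le_add_of_nonneg_right (by positivity)) ?_
  have : (y n - x n) / M lam n * (2 * i + 1) ≤ (y n - x n) / M lam n * M lam n := by gcongr
  rw [div_mul_cancel₀ _ hM.ne'] at this
  linarith

theorem lt_dist_of_mem_lap (hlam : 14 ≤ lam) {n : ℕ} (hn : 1 ≤ n) {i j : ℕ} (hij : i < j)
    {t t' : ℝ} (ht : t ∈ lap lam n i) (ht' : t' ∈ lap lam n j) :
    (y n - x n) / M lam n / 2 < dist t t' := by
  have hM := M_pos hlam hn
  have hl : 0 < y n - x n := sub_pos.2 (x_lt_y hn)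
  have hc : 0 < (y n - x n) / M lam n := by positivity
  have h1 : (i : ℝ) + 1 ≤ j := by exact_mod_cast hij
  have h2 : (y n - x n) / M lam n * (2 * (i : ℝ) + 1) + (y n - x n) / M lam n ≤
      (y n - x n) / M lam n * (2 * j) := by nlinarith
  rw [dist_comm, Real.dist_eq]
  refine lt_of_lt_of_le ?_ (le_abs_self _)
  linarith [ht.2, ht'.1]

theorem IsMap.exists_mem_lap (hf : IsMap lam r f) (hlam : 14 ≤ lam) {n : ℕ} (hn : 1 ≤ n) {i : ℕ}
    (hi : 2 * i + 1 ≤ M lam n) {z : ℝ} (hz : z ∈ Icc (x n) (y n)) :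
    ∃ t ∈ lap lam n i, f^[n + 1] t = z := by
  have h0 : 0 < lam := by linarith
  obtain ⟨s, hs, hfs⟩ := hf.on_xy
  have hM := M_pos hlam hn
  have hl : 0 < y n - x n := sub_pos.2 (x_lt_y hn)
  have hu : (z - x n) / (y n - x n) ∈ Icc (0 : ℝ) 1 := by
    simpa using affine_mem_Icc (x_lt_y hn) hz zero_le_one
  obtain ⟨a, ha, hsa⟩ := hs.surjOn hlam hn hi hu
  have ht : x n + (y n - x n) / M lam n * a ∈ lap lam n i :=
    ⟨by gcongr; exact ha.1, by gcongr; exact ha.2⟩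
  have ht' := lap_subset hlam hn hi ht
  refine ⟨_, ht, ?_⟩
  have hfz : f (x n + (y n - x n) / M lam n * a) = (lam ^ (n * r))⁻¹ * z := by
    rw [hfs n hn _ ht', add_sub_cancel_left]
    have : (M lam n : ℝ) * ((y n - x n) / M lam n * a / (y n - x n)) = a := by field_simp
    rw [this, hsa, mul_div_cancel₀ _ hl.ne']
    ring
  obtain ⟨u, hu', h1, h2⟩ := hf.iterate_xy hlam hn ht' le_rfl
  rw [h2, Nat.sub_self, zero_mul, pow_zero, inv_one, one_mul]
  rw [hfz] at h1
  exact (mul_left_cancel₀ (by positivity) h1).symm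

/-- The images of `[x_n, y_n]` under `f^k`, `k ≤ n`, have diameter at most `1 / n²`. -/
theorem IsMap.abs_iterate_sub_le (hf : IsMap lam r f) (hlam : 14 ≤ lam) {n : ℕ} (hn : 1 ≤ n)
    {k : ℕ} (hk : k < n + 1) {t t' : ℝ} (ht : t ∈ Icc (x n) (y n)) (ht' : t' ∈ Icc (x n) (y n)) :
    |f^[k] t - f^[k] t'| ≤ 1 / (n : ℝ) ^ 2 := by
  have h0 : 0 < lam := by linarith
  have hlen := y_sub_y_succ_le hn
  have hyx := y_succ_lt_x hn
  cases k with
  | zero =>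
    simp only [Function.iterate_zero, id]
    exact abs_le.2 ⟨by linarith [ht.1, ht'.2], by linarith [ht.2, ht'.1]⟩
  | succ k =>
    obtain ⟨u, hu, -, h⟩ := hf.iterate_xy hlam hn ht (show k ≤ n by omega)
    obtain ⟨u', hu', -, h'⟩ := hf.iterate_xy hlam hn ht' (show k ≤ n by omega)
    rw [h, h', ← mul_sub, abs_mul, abs_of_pos (by positivity)]
    have h1 : (lam ^ ((n - k) * r))⁻¹ ≤ 1 := inv_le_one_of_one_le₀ (one_le_pow₀ (by linarith))
    have h2 : |u - u'| ≤ 1 / (n : ℝ) ^ 2 :=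
      abs_le.2 ⟨by linarith [hu.1, hu'.2], by linarith [hu.2, hu'.1]⟩
    calc _ ≤ 1 * |u - u'| := by gcongr
      _ ≤ _ := by rw [one_mul]; exact h2

/-- The increasing laps of `f^{n+1}` on `[x_n, y_n]` form a horseshoe whose intermediate images
are small. -/
theorem IsMap.log_div_le_localEntropyAt (hf : IsMap lam r f) (hlam : 14 ≤ lam) {n : ℕ}
    (hn : 1 ≤ n) {ε : ℝ} (hε : 1 / (n : ℝ) ^ 2 < ε) {N : ℕ} (hN : 0 < N)
    (hMN : M lam n + 1 = 2 * N) :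
    ∃ δ > 0, ((Real.log N / (n + 1 : ℕ) : ℝ) : EReal) ≤
      localEntropyAt (hf.mapsTo.restrict f (Icc 0 4) (Icc 0 4)) ε δ := by
  have hM := M_pos hlam hn
  have hl : 0 < y n - x n := sub_pos.2 (x_lt_y hn)
  have hsub : Icc (x n) (y n) ⊆ Icc 0 4 := fun u hu =>
    (mem_Icc_of_mem_zone hn ((y_succ_lt_x hn).le.trans hu.1) hu.2).1
  have hit : ∀ (k : ℕ) (z : Icc (0 : ℝ) 4),
      (((hf.mapsTo.restrict f (Icc 0 4) (Icc 0 4))^[k] z : Icc (0 : ℝ) 4) : ℝ) = f^[k] z :=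
    fun k z => by simp [MapsTo.iterate_restrict]
  have hi : ∀ i : Fin N, 2 * (i : ℕ) + 1 ≤ M lam n := fun i => by omega
  -- Between two increasing laps there is a decreasing one of length `(y_n - x_n) / M_n`.
  refine ⟨(y n - x n) / M lam n / 2, by positivity, ?_⟩
  have hJ : ({z | (z : ℝ) ∈ Icc (x n) (y n)} : Set (Icc (0 : ℝ) 4)).Nonempty :=
    ⟨⟨x n, hsub ⟨le_rfl, (x_lt_y hn).le⟩⟩, ⟨le_rfl, (x_lt_y hn).le⟩⟩
  have hδ : 0 ≤ (y n - x n) / M lam n / 2 := by positivity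
  have hDJ : ∀ i : Fin N, {z : Icc (0 : ℝ) 4 | (z : ℝ) ∈ lap lam n i} ⊆ {z | (z : ℝ) ∈ Icc (x n) (y n)} := by
    intro i z hz
    exact lap_subset hlam hn (hi i) hz
  have hcov : ∀ i : Fin N, {z : Icc (0 : ℝ) 4 | (z : ℝ) ∈ Icc (x n) (y n)} ⊆
      (hf.mapsTo.restrict f (Icc 0 4) (Icc 0 4))^[n + 1] '' {z | (z : ℝ) ∈ lap lam n i} := by
    intro i z hz
    obtain ⟨t, ht, h⟩ := hf.exists_mem_lap hlam hn (hi i) hz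
    exact ⟨⟨t, hsub (lap_subset hlam hn (hi i) ht)⟩, ht, Subtype.ext ((hit _ _).trans h)⟩
  have hsep : ∀ i j : Fin N, i ≠ j → ∀ z ∈ {z : Icc (0 : ℝ) 4 | (z : ℝ) ∈ lap lam n i},
      ∀ z' ∈ {z : Icc (0 : ℝ) 4 | (z : ℝ) ∈ lap lam n j}, (y n - x n) / M lam n / 2 < dist z z' := by
    intro i j hij z hz z' hz'
    rw [Subtype.dist_eq]
    rcases lt_or_gt_of_ne hij with h | h
    · exact lt_dist_of_mem_lap hlam hn h hz hz'
    · rw [dist_comm]; exact lt_dist_of_mem_lap hlam hn h hz' hz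
  have hdiam : ∀ k < n + 1, ∀ z ∈ {z : Icc (0 : ℝ) 4 | (z : ℝ) ∈ Icc (x n) (y n)},
      ∀ z' ∈ {z : Icc (0 : ℝ) 4 | (z : ℝ) ∈ Icc (x n) (y n)},
      dist ((hf.mapsTo.restrict f (Icc 0 4) (Icc 0 4))^[k] z)
        ((hf.mapsTo.restrict f (Icc 0 4) (Icc 0 4))^[k] z') < ε := by
    intro k hk z hz z' hz'
    rw [Subtype.dist_eq, hit, hit, Real.dist_eq]
    exact (hf.abs_iterate_sub_le hlam hn hk hz hz').trans_lt hε
  exact log_div_le_localEntropyAt_of_horseshoe n.succ_pos hN hδ hJ hDJ hcov hsep hdiam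

/-- The horseshoes have `[λ^n / (2n²)]` pieces and return time `n + 1`: their entropies tend to
`log λ`. -/
theorem tendsto_log_floor_div (hlam : 14 ≤ lam) :
    Tendsto (fun n : ℕ => Real.log ⌊lam ^ n / (2 * (n : ℝ) ^ 2)⌋₊ / (n + 1 : ℕ)) atTop
      (𝓝 (Real.log lam)) := by
  have h0 : 0 < lam := by linarith
  have hn1 : Tendsto (fun n : ℕ => (n : ℝ) / (n + 1)) atTop (𝓝 1) := tendsto_natCast_div_add_atTop 1
  have hlogn : Tendsto (fun n : ℕ => Real.log n / (n : ℝ)) atTop (𝓝 0) :=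
    (Real.isLittleO_log_id_atTop.tendsto_div_nhds_zero).comp tendsto_natCast_atTop_atTop
  have hcn : Tendsto (fun n : ℕ => Real.log 4 / (n : ℝ)) atTop (𝓝 0) :=
    tendsto_const_div_atTop_nhds_zero_nat _
  have hlow : Tendsto (fun n : ℕ => (n : ℝ) / (n + 1) *
      (Real.log lam - Real.log 4 / n - 2 * (Real.log n / n))) atTop (𝓝 (Real.log lam)) := by
    simpa using hn1.mul ((tendsto_const_nhds (x := Real.log lam)).sub hcn |>.sub
      (hlogn.const_mul 2))
  have hup : Tendsto (fun n : ℕ => (n : ℝ) / (n + 1) * Real.log lam) atTop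
      (𝓝 (Real.log lam)) := by
    simpa using hn1.mul_const (Real.log lam)
  refine tendsto_of_tendsto_of_tendsto_of_le_of_le' hlow hup ?_ ?_ <;>
    filter_upwards [eventually_ge_atTop 1] with n hn
  · have hn0 : (0 : ℝ) < n := by exact_mod_cast hn
    have h7 := seven_le_floor hlam hn
    have h7' : (7 : ℝ) ≤ ⌊lam ^ n / (2 * (n : ℝ) ^ 2)⌋₊ := by exact_mod_cast h7
    have hlt := Nat.lt_floor_add_one (lam ^ n / (2 * (n : ℝ) ^ 2))
    have hge : lam ^ n / (4 * (n : ℝ) ^ 2) ≤ ⌊lam ^ n / (2 * (n : ℝ) ^ 2)⌋₊ := by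
      have : lam ^ n / (4 * (n : ℝ) ^ 2) = lam ^ n / (2 * (n : ℝ) ^ 2) / 2 := by
        field_simp; norm_num
      rw [this]; linarith
    have hlog := Real.log_le_log (by positivity) hge
    rw [Real.log_div (by positivity) (by positivity), Real.log_mul (by norm_num) (by positivity),
      Real.log_pow, Real.log_pow] at hlog
    push_cast at hlog ⊢
    rw [le_div_iff₀ (by positivity)]
    refine le_trans (le_of_eq ?_) hlog
    field_simp
    ring
  · have hn0 : (0 : ℝ) < n := by exact_mod_cast hn
    have h7 := seven_le_floor hlam hn
    have h7' : (7 : ℝ) ≤ ⌊lam ^ n / (2 * (n : ℝ) ^ 2)⌋₊ := by exact_mod_cast h7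
    have hle : (⌊lam ^ n / (2 * (n : ℝ) ^ 2)⌋₊ : ℝ) ≤ lam ^ n := by
      refine (Nat.floor_le (by positivity)).trans (div_le_self (by positivity) ?_)
      have : (1 : ℝ) ≤ n := by exact_mod_cast hn
      nlinarith
    have hlog := Real.log_le_log (by linarith) hle
    rw [Real.log_pow] at hlog
    push_cast
    rw [div_mul_eq_mul_div]
    gcongr

/-- The local entropy is at least `log λ`: at every scale `ε` it sees the horseshoes on `[x_n, y_n]`
for large `n`. -/
theorem IsMap.log_le_localEntropy (hf : IsMap lam r f) (hlam : 14 ≤ lam) :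
    (Real.log lam : EReal) ≤ localEntropy (hf.mapsTo.restrict f (Icc 0 4) (Icc 0 4)) := by
  refine le_iInf₂ fun ε hε => ?_
  have hsq : Tendsto (fun n : ℕ => 1 / (n : ℝ) ^ 2) atTop (𝓝 0) := by
    simpa using (tendsto_one_div_atTop_nhds_zero_nat (𝕜 := ℝ)).pow 2
  refine le_of_tendsto (continuous_coe_real_ereal.continuousAt.tendsto.comp
    (tendsto_log_floor_div hlam)) ?_
  filter_upwards [eventually_ge_atTop 1, hsq.eventually (gt_mem_nhds hε)] with n hn hnε
  obtain ⟨δ, hδ, h⟩ := hf.log_div_le_localEntropyAt hlam hn hnε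
    (by have := seven_le_floor hlam hn; omega) (M_add_one hlam hn)
  exact h.trans (le_iSup₂ (f := fun δ (_ : δ ∈ Ioi (0 : ℝ)) => localEntropyAt
    (hf.mapsTo.restrict f (Icc 0 4) (Icc 0 4)) ε δ) δ hδ)

end Ruette

/-! ### Smooth monotone connections of prescribed germs -/

/-- A smooth step equal to `1` on `(-∞, 0]` and to `0` on `[1, ∞)`. -/
noncomputable def smoothStep (u : ℝ) : ℝ := 1 - Real.smoothTransition u

theorem smoothStep_of_nonpos {u : ℝ} (hu : u ≤ 0) : smoothStep u = 1 := by
  simp [smoothStep, Real.smoothTransition.zero_of_nonpos hu]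

theorem smoothStep_of_one_le {u : ℝ} (hu : 1 ≤ u) : smoothStep u = 0 := by
  simp [smoothStep, Real.smoothTransition.one_of_one_le hu]

theorem smoothStep_nonneg (u : ℝ) : 0 ≤ smoothStep u := sub_nonneg.2 (Real.smoothTransition.le_one u)

theorem smoothStep_le_one (u : ℝ) : smoothStep u ≤ 1 :=
  sub_le_self 1 (Real.smoothTransition.nonneg u)

theorem contDiff_smoothStep : ContDiff ℝ ∞ smoothStep :=
  contDiff_const.sub Real.smoothTransition.contDiff

/-- The cutoff equal to `1` on `(-∞, a]` and to `0` on `[a + η, ∞)`. -/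
noncomputable def leftCutoff (a η t : ℝ) : ℝ := smoothStep ((t - a) / η)

/-- The cutoff equal to `1` on `[b, ∞)` and to `0` on `(-∞, b - η]`. -/
noncomputable def rightCutoff (b η t : ℝ) : ℝ := smoothStep ((b - t) / η)

/-- The cutoff that is supported in `[a, b]` and complements the two others. -/
noncomputable def midCutoff (a b η t : ℝ) : ℝ := 1 - leftCutoff a η t - rightCutoff b η t

theorem contDiff_leftCutoff (a η : ℝ) : ContDiff ℝ ∞ (leftCutoff a η) :=
  contDiff_smoothStep.comp ((contDiff_id.sub contDiff_const).div_const η)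

theorem contDiff_rightCutoff (b η : ℝ) : ContDiff ℝ ∞ (rightCutoff b η) :=
  contDiff_smoothStep.comp ((contDiff_const.sub contDiff_id).div_const η)

theorem contDiff_midCutoff (a b η : ℝ) : ContDiff ℝ ∞ (midCutoff a b η) :=
  (contDiff_const.sub (contDiff_leftCutoff a η)).sub (contDiff_rightCutoff b η)

section

variable {a b η t : ℝ}

theorem leftCutoff_of_le (hη : 0 < η) (ht : t ≤ a) : leftCutoff a η t = 1 :=
  smoothStep_of_nonpos (div_nonpos_of_nonpos_of_nonneg (by linarith) hη.le)

theorem leftCutoff_of_ge (hη : 0 < η) (ht : a + η ≤ t) : leftCutoff a η t = 0 :=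
  smoothStep_of_one_le (by rw [le_div_iff₀ hη]; linarith)

theorem rightCutoff_of_ge (hη : 0 < η) (ht : b ≤ t) : rightCutoff b η t = 1 :=
  smoothStep_of_nonpos (div_nonpos_of_nonpos_of_nonneg (by linarith) hη.le)

theorem rightCutoff_of_le (hη : 0 < η) (ht : t ≤ b - η) : rightCutoff b η t = 0 :=
  smoothStep_of_one_le (by rw [le_div_iff₀ hη]; linarith)

theorem leftCutoff_mem : leftCutoff a η t ∈ Icc (0 : ℝ) 1 :=
  ⟨smoothStep_nonneg _, smoothStep_le_one _⟩

theorem rightCutoff_mem : rightCutoff b η t ∈ Icc (0 : ℝ) 1 :=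
  ⟨smoothStep_nonneg _, smoothStep_le_one _⟩

/-- The integral of a function times the left cutoff is governed by its values on
`[a, a + η]`. -/
theorem integral_mul_leftCutoff_mem (hη : 0 < η) (hab : a + η ≤ b) {u : ℝ → ℝ}
    (hu : Continuous u) {hi : ℝ} (hb : ∀ t ∈ Icc a (a + η), u t ∈ Icc 0 hi) :
    ∫ t in a..b, u t * leftCutoff a η t ∈ Icc 0 (hi * η) := by
  have hc : Continuous fun t => u t * leftCutoff a η t := hu.mul (contDiff_leftCutoff a η).continuous
  have h2 : ∫ t in (a + η)..b, u t * leftCutoff a η t = 0 := by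
    rw [intervalIntegral.integral_congr (g := fun _ => 0), intervalIntegral.integral_zero]
    intro t ht
    rw [uIcc_of_le hab] at ht
    simp [leftCutoff_of_ge hη ht.1]
  rw [← intervalIntegral.integral_add_adjacent_intervals (hc.intervalIntegrable a (a + η))
    (hc.intervalIntegrable (a + η) b), h2, add_zero]
  have hle : a ≤ a + η := by linarith
  constructor
  · exact intervalIntegral.integral_nonneg hle fun t ht =>
      mul_nonneg (hb t ht).1 leftCutoff_mem.1
  · have := intervalIntegral.integral_mono_on hle (hc.intervalIntegrable _ _ (μ := MeasureTheory.volume))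
      (continuous_const (y := hi).intervalIntegrable _ _) fun t ht =>
        (mul_le_of_le_one_right (hb t ht).1 leftCutoff_mem.2).trans (hb t ht).2
    rw [intervalIntegral.integral_const, smul_eq_mul] at this
    linarith

theorem integral_mul_rightCutoff_mem (hη : 0 < η) (hab : a ≤ b - η) {u : ℝ → ℝ}
    (hu : Continuous u) {hi : ℝ} (hb : ∀ t ∈ Icc (b - η) b, u t ∈ Icc 0 hi) :
    ∫ t in a..b, u t * rightCutoff b η t ∈ Icc 0 (hi * η) := by
  have hc : Continuous fun t => u t * rightCutoff b η t :=
    hu.mul (contDiff_rightCutoff b η).continuous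
  have h2 : ∫ t in a..(b - η), u t * rightCutoff b η t = 0 := by
    rw [intervalIntegral.integral_congr (g := fun _ => 0), intervalIntegral.integral_zero]
    intro t ht
    rw [uIcc_of_le hab] at ht
    simp [rightCutoff_of_le hη ht.2]
  rw [← intervalIntegral.integral_add_adjacent_intervals (hc.intervalIntegrable a (b - η))
    (hc.intervalIntegrable (b - η) b), h2, zero_add]
  have hle : b - η ≤ b := by linarith
  constructor
  · exact intervalIntegral.integral_nonneg hle fun t ht =>
      mul_nonneg (hb t ht).1 rightCutoff_mem.1
  · have := intervalIntegral.integral_mono_on hle (hc.intervalIntegrable _ _ (μ := MeasureTheory.volume))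
      (continuous_const (y := hi).intervalIntegrable _ _) fun t ht =>
        (mul_le_of_le_one_right (hb t ht).1 rightCutoff_mem.2).trans (hb t ht).2
    rw [intervalIntegral.integral_const, smul_eq_mul] at this
    linarith

theorem integral_midCutoff_mem (hη : 0 < η) (hab : a + η ≤ b - η) :
    ∫ t in a..b, midCutoff a b η t ∈ Icc (b - a - 2 * η) (b - a) := by
  have h1 := integral_mul_leftCutoff_mem hη (by linarith : a + η ≤ b) (continuous_const (y := 1))
    (hi := 1) fun _ _ => ⟨zero_le_one, le_rfl⟩
  have h2 := integral_mul_rightCutoff_mem hη (by linarith : a ≤ b - η) (continuous_const (y := 1))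
    (hi := 1) fun _ _ => ⟨zero_le_one, le_rfl⟩
  simp only [one_mul] at h1 h2
  have i1 := ((contDiff_leftCutoff a η).continuous.intervalIntegrable a b (μ := MeasureTheory.volume))
  have i2 := ((contDiff_rightCutoff b η).continuous.intervalIntegrable a b
    (μ := MeasureTheory.volume))
  have : ∫ t in a..b, midCutoff a b η t = (b - a) - (∫ t in a..b, leftCutoff a η t) -
      ∫ t in a..b, rightCutoff b η t := by
    simp only [midCutoff]
    rw [intervalIntegral.integral_sub (by exact (continuous_const.intervalIntegrable _ _).sub i1) i2,
      intervalIntegral.integral_sub (by exact continuous_const.intervalIntegrable _ _) i1]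
    simp
  rw [this]
  constructor <;> linarith [h1.1, h1.2, h2.1, h2.2]

end

/-- The constant slope in the middle of the connection, chosen so that the total increment is
`R b - L a`. -/
noncomputable def connectSlope (a b η : ℝ) (L R : ℝ → ℝ) : ℝ :=
  (R b - L a - (∫ t in a..b, deriv L t * leftCutoff a η t) -
    ∫ t in a..b, deriv R t * rightCutoff b η t) / ∫ t in a..b, midCutoff a b η t

/-- The derivative of the connection: it passes from `L'` to a constant and then to `R'`. -/
noncomputable def connectDeriv (a b η : ℝ) (L R : ℝ → ℝ) (t : ℝ) : ℝ :=
  connectSlope a b η L R * midCutoff a b η t + deriv L t * leftCutoff a η t +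
    deriv R t * rightCutoff b η t

/-- A smooth function equal to `L` on `(-∞, a]` and to `R` on `[b, ∞)`. The transitions take place
in `[a, a + η]` and `[b - η, b]`. -/
noncomputable def connect (a b η : ℝ) (L R : ℝ → ℝ) (t : ℝ) : ℝ :=
  L a + ∫ u in a..t, connectDeriv a b η L R u

section

variable {a b η : ℝ} {L R : ℝ → ℝ}

theorem contDiff_deriv_of_contDiff {L : ℝ → ℝ} (hL : ContDiff ℝ ∞ L) : ContDiff ℝ ∞ (deriv L) :=
  (contDiff_infty_iff_deriv.1 hL).2

theorem contDiff_connectDeriv (hL : ContDiff ℝ ∞ L) (hR : ContDiff ℝ ∞ R) :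
    ContDiff ℝ ∞ (connectDeriv a b η L R) :=
  ((contDiff_const.mul (contDiff_midCutoff a b η)).add
    ((contDiff_deriv_of_contDiff hL).mul (contDiff_leftCutoff a η))).add
    ((contDiff_deriv_of_contDiff hR).mul (contDiff_rightCutoff b η))

theorem hasDerivAt_connect (hL : ContDiff ℝ ∞ L) (hR : ContDiff ℝ ∞ R) (t : ℝ) :
    HasDerivAt (connect a b η L R) (connectDeriv a b η L R t) t :=
  (intervalIntegral.integral_hasDerivAt_right
    ((contDiff_connectDeriv hL hR).continuous.intervalIntegrable _ _)
    ((contDiff_connectDeriv hL hR).continuous.stronglyMeasurableAtFilter _ _)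
    (contDiff_connectDeriv hL hR).continuous.continuousAt).const_add _

theorem deriv_connect (hL : ContDiff ℝ ∞ L) (hR : ContDiff ℝ ∞ R) :
    deriv (connect a b η L R) = connectDeriv a b η L R :=
  funext fun t => (hasDerivAt_connect hL hR t).deriv

theorem contDiff_connect (hL : ContDiff ℝ ∞ L) (hR : ContDiff ℝ ∞ R) :
    ContDiff ℝ ∞ (connect a b η L R) := by
  refine contDiff_infty_iff_deriv.2 ⟨fun t => (hasDerivAt_connect hL hR t).differentiableAt, ?_⟩
  rw [deriv_connect hL hR]
  exact contDiff_connectDeriv hL hR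

theorem connectDeriv_of_le (hη : 0 < η) (hab : a + η ≤ b - η) {t : ℝ} (ht : t ≤ a) :
    connectDeriv a b η L R t = deriv L t := by
  simp [connectDeriv, midCutoff, leftCutoff_of_le hη ht,
    rightCutoff_of_le hη (show t ≤ b - η by linarith)]

theorem connectDeriv_of_ge (hη : 0 < η) (hab : a + η ≤ b - η) {t : ℝ} (ht : b ≤ t) :
    connectDeriv a b η L R t = deriv R t := by
  simp [connectDeriv, midCutoff, rightCutoff_of_ge hη ht,
    leftCutoff_of_ge hη (show a + η ≤ t by linarith)]

theorem connect_of_le (hη : 0 < η) (hab : a + η ≤ b - η) (hL : ContDiff ℝ ∞ L) {t : ℝ}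
    (ht : t ≤ a) : connect a b η L R t = L t := by
  have h : ∫ u in a..t, connectDeriv a b η L R u = ∫ u in a..t, deriv L u :=
    intervalIntegral.integral_congr fun u hu => by
      rw [uIcc_of_ge ht] at hu
      exact connectDeriv_of_le hη hab hu.2
  rw [connect, h, intervalIntegral.integral_deriv_eq_sub
    (fun u _ => (hL.differentiable (by simp)).differentiableAt)
    ((contDiff_deriv_of_contDiff hL).continuous.intervalIntegrable _ _)]
  ring

theorem connect_right (hη : 0 < η) (hab : a + η < b - η) (hL : ContDiff ℝ ∞ L)
    (hR : ContDiff ℝ ∞ R) : connect a b η L R b = R b := by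
  have hI : 0 < ∫ t in a..b, midCutoff a b η t :=
    lt_of_lt_of_le (by linarith) (integral_midCutoff_mem hη hab.le).1
  have c0 : Continuous fun t => connectSlope a b η L R * midCutoff a b η t :=
    continuous_const.mul (contDiff_midCutoff a b η).continuous
  have c1 : Continuous fun t => deriv L t * leftCutoff a η t :=
    (contDiff_deriv_of_contDiff hL).continuous.mul (contDiff_leftCutoff a η).continuous
  have c2 : Continuous fun t => deriv R t * rightCutoff b η t :=
    (contDiff_deriv_of_contDiff hR).continuous.mul (contDiff_rightCutoff b η).continuous
  have c3 : Continuous fun t => connectSlope a b η L R * midCutoff a b η t +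
      deriv L t * leftCutoff a η t := c0.add c1
  simp only [connect, connectDeriv]
  rw [intervalIntegral.integral_add (c3.intervalIntegrable _ _)
      (c2.intervalIntegrable _ _),
    intervalIntegral.integral_add (c0.intervalIntegrable _ _)
      (c1.intervalIntegrable _ _), intervalIntegral.integral_const_mul, connectSlope,
    div_mul_cancel₀ _ hI.ne']
  ring

theorem connect_of_ge (hη : 0 < η) (hab : a + η < b - η) (hL : ContDiff ℝ ∞ L)
    (hR : ContDiff ℝ ∞ R) {t : ℝ} (ht : b ≤ t) : connect a b η L R t = R t := by
  have hc := (contDiff_connectDeriv (a := a) (b := b) (η := η) hL hR).continuous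
  have h : ∫ u in b..t, connectDeriv a b η L R u = ∫ u in b..t, deriv R u :=
    intervalIntegral.integral_congr fun u hu => by
      rw [uIcc_of_le ht] at hu
      exact connectDeriv_of_ge hη hab.le hu.1
  have hb := connect_right hη hab hL hR
  rw [connect] at hb ⊢
  rw [← intervalIntegral.integral_add_adjacent_intervals (hc.intervalIntegrable a b)
    (hc.intervalIntegrable b t), ← add_assoc, hb, h, intervalIntegral.integral_deriv_eq_sub
    (fun u _ => (hR.differentiable (by simp)).differentiableAt)
    ((contDiff_deriv_of_contDiff hR).continuous.intervalIntegrable _ _)]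
  ring

/-- If the germs have slopes in `[lo, hi]` and the mean slope lies well inside this interval, then
the connection has slopes in `[lo, hi]`. -/
theorem connectDeriv_mem (hη : 0 < η) (hab : a + η < b - η) (hL : ContDiff ℝ ∞ L)
    (hR : ContDiff ℝ ∞ R) {lo hi : ℝ} (hlo : 0 ≤ lo) (hhi : lo ≤ hi)
    (hLd : ∀ t ∈ Icc a (a + η), deriv L t ∈ Icc lo hi)
    (hRd : ∀ t ∈ Icc (b - η) b, deriv R t ∈ Icc lo hi)
    (h1 : lo * (b - a) + 2 * (hi * η) ≤ R b - L a) (h2 : R b - L a ≤ hi * (b - a - 2 * η))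
    {t : ℝ} (ht : t ∈ Icc a b) : connectDeriv a b η L R t ∈ Icc lo hi := by
  have hI := integral_midCutoff_mem hη hab.le
  have hI0 : 0 < ∫ t in a..b, midCutoff a b η t := lt_of_lt_of_le (by linarith) hI.1
  have hX := integral_mul_leftCutoff_mem hη (by linarith : a + η ≤ b)
    (contDiff_deriv_of_contDiff hL).continuous
    (fun t ht => ⟨hlo.trans (hLd t ht).1, (hLd t ht).2⟩)
  have hY := integral_mul_rightCutoff_mem hη (by linarith : a ≤ b - η)
    (contDiff_deriv_of_contDiff hR).continuous
    (fun t ht => ⟨hlo.trans (hRd t ht).1, (hRd t ht).2⟩)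
  have hc : connectSlope a b η L R ∈ Icc lo hi := by
    rw [connectSlope]
    constructor
    · rw [le_div_iff₀ hI0]
      have := mul_le_mul_of_nonneg_left hI.2 hlo
      linarith [hX.2, hY.2]
    · rw [div_le_iff₀ hI0]
      have := mul_le_mul_of_nonneg_left hI.1 (hlo.trans hhi)
      linarith [hX.1, hY.1]
  rw [connectDeriv]
  rcases le_total t (a + η) with h | h
  · have hl := hLd t ⟨ht.1, h⟩
    have hm := leftCutoff_mem (a := a) (η := η) (t := t)
    rw [midCutoff, rightCutoff_of_le hη (by linarith : t ≤ b - η)]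
    constructor <;> nlinarith [hm.1, hm.2, hl.1, hl.2, hc.1, hc.2]
  · have hm := rightCutoff_mem (b := b) (η := η) (t := t)
    rw [midCutoff, leftCutoff_of_ge hη h]
    rcases le_total t (b - η) with h' | h'
    · rw [rightCutoff_of_le hη h']
      simpa using hc
    · have hr := hRd t ⟨h', ht.2⟩
      constructor <;> nlinarith [hm.1, hm.2, hr.1, hr.2, hc.1, hc.2]

theorem monotoneOn_connect (hL : ContDiff ℝ ∞ L) (hR : ContDiff ℝ ∞ R) {s : Set ℝ}
    (hs : Convex ℝ s) (h : ∀ t ∈ interior s, 0 ≤ connectDeriv a b η L R t) :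
    MonotoneOn (connect a b η L R) s :=
  monotoneOn_of_deriv_nonneg hs (contDiff_connect hL hR).continuous.continuousOn
    ((contDiff_connect hL hR).differentiable (by simp)).differentiableOn
    fun t ht => by rw [deriv_connect hL hR]; exact h t ht

theorem connect_mem_Icc (hη : 0 < η) (hab : a + η < b - η) (hL : ContDiff ℝ ∞ L)
    (hR : ContDiff ℝ ∞ R) (h : ∀ t ∈ Icc a b, 0 ≤ connectDeriv a b η L R t) {t : ℝ}
    (ht : t ∈ Icc a b) : connect a b η L R t ∈ Icc (L a) (R b) := by
  have hle : a ≤ b := by linarith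
  have hm := monotoneOn_connect (a := a) (b := b) (η := η) hL hR (convex_Icc a b)
    fun t ht => h t (interior_subset ht)
  constructor
  · have := hm ⟨le_rfl, hle⟩ ht ht.1
    rwa [connect_of_le hη hab.le hL le_rfl] at this
  · have := hm ht ⟨hle, le_rfl⟩ ht.2
    rwa [connect_right hη hab hL hR] at this

theorem exists_abs_iteratedDeriv_le {u : ℝ → ℝ} (hu : ContDiff ℝ ∞ u) (k : ℕ) (K : Set ℝ)
    (hK : IsCompact K) : ∃ B, 0 ≤ B ∧ ∀ t ∈ K, |iteratedDeriv k u t| ≤ B := by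
  have hc : Continuous (iteratedDeriv k u) :=
    hu.continuous_iteratedDeriv k (by exact_mod_cast le_top)
  obtain ⟨B, hB⟩ := hK.exists_bound_of_continuousOn hc.continuousOn
  exact ⟨max B 0, le_max_right _ _, fun t ht => (hB t ht).trans (le_max_left _ _)⟩

/-- Connections of germs whose derivatives are bounded multiples of two fixed functions have
derivatives that are bounded uniformly in the multiples: they depend on the parameters in an
affine way. -/
theorem exists_abs_iteratedDeriv_connect_le (hη : 0 < η) (hab : a + η < b - η) {u v : ℝ → ℝ}
    (hu : ContDiff ℝ ∞ u) (hv : ContDiff ℝ ∞ v) {A : ℝ} (hA : 0 ≤ A) {K : Set ℝ} (hK : IsCompact K)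
    {k : ℕ} (hk : 1 ≤ k) :
    ∃ B, ∀ (L R : ℝ → ℝ) (α β : ℝ), ContDiff ℝ ∞ L → ContDiff ℝ ∞ R →
      (∀ t, deriv L t = α * u t) → (∀ t, deriv R t = β * v t) → |α| ≤ A → |β| ≤ A →
      |R b - L a| ≤ A → ∀ t ∈ K, |iteratedDeriv k (connect a b η L R) t| ≤ B := by
  obtain ⟨k, rfl⟩ : ∃ j, k = j + 1 := ⟨k - 1, by omega⟩
  have hI0 : 0 < ∫ t in a..b, midCutoff a b η t :=
    lt_of_lt_of_le (by linarith) (integral_midCutoff_mem hη hab.le).1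
  have s0 := contDiff_midCutoff a b η
  have s1 := hu.mul (contDiff_leftCutoff a η)
  have s2 := hv.mul (contDiff_rightCutoff b η)
  obtain ⟨B0, hB0, h0⟩ := exists_abs_iteratedDeriv_le s0 k K hK
  obtain ⟨B1, hB1, h1⟩ := exists_abs_iteratedDeriv_le s1 k K hK
  obtain ⟨B2, hB2, h2⟩ := exists_abs_iteratedDeriv_le s2 k K hK
  set I0 := ∫ t in a..b, midCutoff a b η t
  set I1 := ∫ t in a..b, u t * leftCutoff a η t with hI1
  set I2 := ∫ t in a..b, v t * rightCutoff b η t with hI2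
  refine ⟨(A + A * |I1| + A * |I2|) / I0 * B0 + A * B1 + A * B2, ?_⟩
  intro L R α β hL hR hLd hRd hα hβ hH t ht
  have hg : connectDeriv a b η L R = fun t => connectSlope a b η L R * midCutoff a b η t +
      α * (u t * leftCutoff a η t) + β * (v t * rightCutoff b η t) := by
    ext t
    rw [connectDeriv, hLd, hRd]
    ring
  have hc : |connectSlope a b η L R| ≤ (A + A * |I1| + A * |I2|) / I0 := by
    have e1 : ∫ t in a..b, deriv L t * leftCutoff a η t = α * I1 := by
      rw [hI1, ← intervalIntegral.integral_const_mul]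
      exact intervalIntegral.integral_congr fun t _ => by simp only [hLd]; ring
    have e2 : ∫ t in a..b, deriv R t * rightCutoff b η t = β * I2 := by
      rw [hI2, ← intervalIntegral.integral_const_mul]
      exact intervalIntegral.integral_congr fun t _ => by simp only [hRd]; ring
    rw [connectSlope, e1, e2, abs_div, abs_of_pos hI0]
    gcongr
    calc |R b - L a - α * I1 - β * I2| ≤ |R b - L a| + |α * I1| + |β * I2| :=
          (abs_sub _ _).trans (add_le_add_left (abs_sub _ _) _)
      _ ≤ _ := by
          rw [abs_mul, abs_mul]
          gcongr
  have ks : ((k : ℕ) : WithTop ℕ∞) ≤ ((⊤ : ℕ∞) : WithTop ℕ∞) := by exact_mod_cast le_top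
  have c0 : ContDiff ℝ k (fun t => connectSlope a b η L R * midCutoff a b η t) :=
    (contDiff_const.mul s0).of_le ks
  have c1 : ContDiff ℝ k (fun t => α * (u t * leftCutoff a η t)) :=
    (contDiff_const.mul s1).of_le ks
  have c2 : ContDiff ℝ k (fun t => β * (v t * rightCutoff b η t)) :=
    (contDiff_const.mul s2).of_le ks
  have hsum : iteratedDeriv k (connectDeriv a b η L R) t =
      connectSlope a b η L R * iteratedDeriv k (midCutoff a b η) t +
        α * iteratedDeriv k (fun t => u t * leftCutoff a η t) t +
        β * iteratedDeriv k (fun t => v t * rightCutoff b η t) t := by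
    rw [hg, iteratedDeriv_fun_add (c0.add c1).contDiffAt c2.contDiffAt,
      iteratedDeriv_fun_add c0.contDiffAt c1.contDiffAt, iteratedDeriv_const_mul_field,
      iteratedDeriv_const_mul_field, iteratedDeriv_const_mul_field]
  rw [iteratedDeriv_succ', deriv_connect hL hR, hsum]
  refine (abs_add_le _ _).trans (add_le_add ((abs_add_le _ _).trans (add_le_add ?_ ?_)) ?_)
  · rw [abs_mul]; exact mul_le_mul hc (h0 t ht) (abs_nonneg _) (by positivity)
  · rw [abs_mul]; exact mul_le_mul hα (h1 t ht) (abs_nonneg _) hA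
  · rw [abs_mul]; exact mul_le_mul hβ (h2 t ht) (abs_nonneg _) hA

end

/-! ### The monotone laps of the oscillations -/

namespace Ruette

/-- The germ of a lap at a minimum of value `-d`, placed at `0`. -/
noncomputable def valleyGerm (D d u : ℝ) : ℝ := -d + 1 / (4 * D ^ 2) * u ^ 2

/-- The germ of a lap at a maximum of value `1`, placed at `1`. -/
noncomputable def peakGerm (D u : ℝ) : ℝ := 1 - 1 / (4 * D ^ 2) * (u - 1) ^ 2

/-- An affine germ with value `0` at `0`. -/
noncomputable def startGerm (k u : ℝ) : ℝ := k * u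

/-- An affine germ with value `1` at `1`. -/
noncomputable def endGerm (k u : ℝ) : ℝ := k * (u - 1) + 1

theorem contDiff_valleyGerm (D d : ℝ) : ContDiff ℝ ∞ (valleyGerm D d) :=
  contDiff_const.add (contDiff_const.mul (contDiff_id.pow 2))

theorem contDiff_peakGerm (D : ℝ) : ContDiff ℝ ∞ (peakGerm D) :=
  contDiff_const.sub (contDiff_const.mul ((contDiff_id.sub contDiff_const).pow 2))

theorem contDiff_startGerm (k : ℝ) : ContDiff ℝ ∞ (startGerm k) := contDiff_const.mul contDiff_id

theorem contDiff_endGerm (k : ℝ) : ContDiff ℝ ∞ (endGerm k) :=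
  (contDiff_const.mul (contDiff_id.sub contDiff_const)).add contDiff_const

theorem deriv_valleyGerm (D d u : ℝ) : deriv (valleyGerm D d) u = 1 / (2 * D ^ 2) * u := by
  refine (((hasDerivAt_pow 2 u).const_mul (1 / (4 * D ^ 2))).const_add (-d)).deriv.trans ?_
  rw [show 4 * D ^ 2 = 2 * D ^ 2 * 2 by ring, ← div_div]
  norm_num
  ring

theorem deriv_peakGerm (D u : ℝ) : deriv (peakGerm D) u = 1 / (2 * D ^ 2) * (1 - u) := by
  refine (((((hasDerivAt_id u).sub_const 1).pow 2).const_mul (1 / (4 * D ^ 2))).const_sub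
    1).deriv.trans ?_
  rw [show 4 * D ^ 2 = 2 * D ^ 2 * 2 by ring, ← div_div]
  norm_num
  ring

theorem deriv_startGerm (k u : ℝ) : deriv (startGerm k) u = k :=
  ((hasDerivAt_id u).const_mul k).deriv.trans (mul_one k)

theorem deriv_endGerm (k u : ℝ) : deriv (endGerm k) u = k := 
  ((((hasDerivAt_id u).sub_const 1).const_mul k).add_const 1).deriv.trans (mul_one k)

/-- Properties of the slopes of a germ as a function of the distance to the end of the lap. The
proposition `p` says that the lower bound `lo` is valid up to the end. -/
structure IsGermSlope (D lo : ℝ) (p : Prop) (g : ℝ → ℝ) : Prop where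
  mem : ∀ u ∈ Icc 0 (D + D / 50), g u ∈ Icc 0 D⁻¹
  pos : ∀ u ∈ Ioc 0 (D + D / 50), 0 < g u
  le : ∀ u ∈ Icc D (D + D / 50), lo ≤ g u
  le_all : p → ∀ u ∈ Icc 0 (D + D / 50), lo ≤ g u

theorem isGermSlope_quadratic {D lo : ℝ} (hD : 0 < D) (hD' : D ≤ 1 / 14) (hlo : lo ≤ 1 / 2) :
    IsGermSlope D lo False fun u => 1 / (2 * D ^ 2) * u := by
  have h0 : 0 < 1 / (2 * D ^ 2) := by positivity
  have h1 : 1 / (2 * D ^ 2) * D = D⁻¹ / 2 := by field_simp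
  have h2 : 14 ≤ D⁻¹ := by rw [le_inv_comm₀ (by norm_num) hD]; linarith
  refine ⟨fun u hu => ⟨mul_nonneg h0.le hu.1, ?_⟩, fun u hu => mul_pos h0 hu.1, fun u hu => ?_,
    False.elim⟩
  · have := mul_le_mul_of_nonneg_left hu.2 h0.le
    linarith
  · have := mul_le_mul_of_nonneg_left hu.1 h0.le
    linarith

theorem isGermSlope_const {D lo k : ℝ} (hk : 0 < k) (hk' : k ≤ D⁻¹) (hlo : lo ≤ k) :
    IsGermSlope D lo True fun _ => k :=
  ⟨fun _ _ => ⟨hk.le, hk'⟩, fun _ _ => hk, fun _ _ => hlo, fun _ _ _ => hlo⟩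

/-- An increasing lap over `[0, 1]` with values in `[-d, 1]` and slopes at most `D⁻¹`. Slopes are
at least `lo` in `[D, 1 - D]`, and even in `[0, 1 - D]` or `[D, 1]` if `pl` or `pr` is true. -/
structure IsLap (D lo d : ℝ) (pl pr : Prop) (P : ℝ → ℝ) : Prop where
  contDiff : ContDiff ℝ ∞ P
  deriv_mem : ∀ u ∈ Icc (0 : ℝ) 1, deriv P u ∈ Icc 0 D⁻¹
  deriv_pos : ∀ u ∈ Ioo (0 : ℝ) 1, 0 < deriv P u
  le_deriv : ∀ u ∈ Icc (0 : ℝ) 1, (pl ∨ D ≤ u) → (pr ∨ u ≤ 1 - D) → lo ≤ deriv P u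
  mapsTo : MapsTo P (Icc 0 1) (Icc (-d) 1)

theorem IsLap.strictMonoOn {D lo d : ℝ} {pl pr : Prop} {P : ℝ → ℝ} (h : IsLap D lo d pl pr P) :
    StrictMonoOn P (Icc 0 1) :=
  strictMonoOn_of_deriv_pos (convex_Icc 0 1) h.contDiff.continuous.continuousOn
    fun u hu => h.deriv_pos u (by rwa [interior_Icc] at hu)

/-- The lap with prescribed germs on `[0, D]` and `[1 - D, 1]`. -/
noncomputable def lapFun (D : ℝ) (L R : ℝ → ℝ) : ℝ → ℝ := connect D (1 - D) (D / 50) L R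

section

variable {D : ℝ} {L R : ℝ → ℝ}

theorem contDiff_lapFun (hL : ContDiff ℝ ∞ L) (hR : ContDiff ℝ ∞ R) : ContDiff ℝ ∞ (lapFun D L R) :=
  contDiff_connect hL hR

theorem lapFun_of_le (hD : 0 < D) (hD' : D ≤ 1 / 14) (hL : ContDiff ℝ ∞ L) {u : ℝ} (hu : u ≤ D) :
    lapFun D L R u = L u :=
  connect_of_le (by linarith) (by linarith) hL hu

theorem lapFun_of_ge (hD : 0 < D) (hD' : D ≤ 1 / 14) (hL : ContDiff ℝ ∞ L) (hR : ContDiff ℝ ∞ R)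
    {u : ℝ} (hu : 1 - D ≤ u) : lapFun D L R u = R u :=
  connect_of_ge (by linarith) (by linarith) hL hR hu

/-- The transitions of the connection have length `D / 50` and slopes at most `D⁻¹`, so they
contribute at most `2 / 50` to the increment; this is why an increment of at least `5 / 9` leaves
room for slopes `≥ lo`, where `lo ≤ 1 / 2`. -/
theorem isLap_lapFun (hD : 0 < D) (hD' : D ≤ 1 / 14) (hL : ContDiff ℝ ∞ L) (hR : ContDiff ℝ ∞ R)
    {lo d : ℝ} (hlo : 0 < lo) (hlo' : lo ≤ 1 / 2) {pl pr : Prop}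
    (hgL : IsGermSlope D lo pl (deriv L)) (hgR : IsGermSlope D lo pr fun u => deriv R (1 - u))
    (h1 : 5 / 9 ≤ R (1 - D) - L D) (h2 : R (1 - D) - L D ≤ 2) (hL0 : -d ≤ L 0) (hR1 : R 1 ≤ 1) :
    IsLap D lo d pl pr (lapFun D L R) := by
  have hDi : 14 ≤ D⁻¹ := by rw [le_inv_comm₀ (by norm_num) hD]; linarith
  have hDD : D⁻¹ * D = 1 := inv_mul_cancel₀ hD.ne'
  have hder : deriv (lapFun D L R) = connectDeriv D (1 - D) (D / 50) L R := deriv_connect hL hR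
  have hl : ∀ u ≤ D, deriv (lapFun D L R) u = deriv L u := fun u hu => by
    rw [hder, connectDeriv_of_le (by linarith) (by linarith) hu]
  have hr : ∀ u, 1 - D ≤ u → deriv (lapFun D L R) u = deriv R (1 - (1 - u)) := fun u hu => by
    rw [hder, connectDeriv_of_ge (by linarith) (by linarith) hu, sub_sub_cancel]
  have hm : ∀ u ∈ Icc D (1 - D), deriv (lapFun D L R) u ∈ Icc lo D⁻¹ := fun u hu => by
    rw [hder]
    refine connectDeriv_mem (by linarith) (by linarith) hL hR hlo.le (by linarith)
      (fun t ht => ⟨hgL.le t ht, (hgL.mem t ⟨hD.le.trans ht.1, ht.2⟩).2⟩)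
      (fun t ht => ?_) ?_ ?_ hu
    · have e1 := hgR.le (1 - t) ⟨by linarith [ht.2], by linarith [ht.1]⟩
      have e2 := (hgR.mem (1 - t) ⟨by linarith [ht.2], by linarith [ht.1]⟩).2
      rw [sub_sub_cancel] at e1 e2
      exact ⟨e1, e2⟩
    · rw [show D⁻¹ * (D / 50) = D⁻¹ * D / 50 by ring, hDD]
      nlinarith
    · rw [show D⁻¹ * (1 - D - D - 2 * (D / 50)) = D⁻¹ - D⁻¹ * D * (51 / 25) by ring, hDD]
      linarith
  have hmem : ∀ u ∈ Icc (0 : ℝ) 1, deriv (lapFun D L R) u ∈ Icc 0 D⁻¹ := fun u hu => by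
    rcases le_total u D with h | h
    · rw [hl u h]; exact hgL.mem u ⟨hu.1, by linarith⟩
    rcases le_total u (1 - D) with h' | h'
    · exact ⟨hlo.le.trans (hm u ⟨h, h'⟩).1, (hm u ⟨h, h'⟩).2⟩
    · rw [hr u h']; exact hgR.mem (1 - u) ⟨by linarith [hu.2], by linarith⟩
  have hpos : ∀ u ∈ Ioo (0 : ℝ) 1, 0 < deriv (lapFun D L R) u := fun u hu => by
    rcases le_total u D with h | h
    · rw [hl u h]; exact hgL.pos u ⟨hu.1, by linarith⟩
    rcases le_total u (1 - D) with h' | h'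
    · exact hlo.trans_le (hm u ⟨h, h'⟩).1
    · rw [hr u h']; exact hgR.pos (1 - u) ⟨by linarith [hu.2], by linarith⟩
  have hmono : MonotoneOn (lapFun D L R) (Icc 0 1) :=
    (strictMonoOn_of_deriv_pos (convex_Icc 0 1) (contDiff_lapFun hL hR).continuous.continuousOn
      fun u hu => hpos u (by rwa [interior_Icc] at hu)).monotoneOn
  refine ⟨contDiff_lapFun hL hR, hmem, hpos, fun u hu h h' => ?_, fun u hu => ⟨?_, ?_⟩⟩
  · rcases le_total u D with e | e
    · rw [hl u e]
      rcases h with h | h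
      · exact hgL.le_all h u ⟨hu.1, by linarith⟩
      · exact hgL.le u ⟨h, by linarith⟩
    rcases le_total u (1 - D) with e' | e'
    · exact (hm u ⟨e, e'⟩).1
    · rw [hr u e']
      rcases h' with h' | h'
      · exact hgR.le_all h' (1 - u) ⟨by linarith [hu.2], by linarith⟩
      · exact hgR.le (1 - u) ⟨by linarith, by linarith⟩
  · have := hmono ⟨le_rfl, zero_le_one⟩ hu hu.1
    rw [lapFun_of_le hD hD' hL hD.le] at this
    linarith
  · have := hmono hu ⟨zero_le_one, le_rfl⟩ hu.2
    rw [lapFun_of_ge (u := 1) hD hD' hL hR (by linarith)] at this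
    linarith

theorem valleyGerm_self (hD : 0 < D) (d : ℝ) : valleyGerm D d D = -d + 1 / 4 := by
  rw [valleyGerm]; field_simp

theorem peakGerm_one_sub (hD : 0 < D) : peakGerm D (1 - D) = 1 - 1 / 4 := by
  rw [peakGerm]; field_simp; ring

theorem isLap_valley_peak (hD : 0 < D) (hD' : D ≤ 1 / 14) {lo d : ℝ} (hlo : 0 < lo)
    (hlo' : lo ≤ 1 / 2) (hd : d ∈ Icc (3 / 4 : ℝ) 1) :
    IsLap D lo d False False (lapFun D (valleyGerm D d) (peakGerm D)) := by
  refine isLap_lapFun hD hD' (contDiff_valleyGerm D d) (contDiff_peakGerm D) hlo hlo' ?_ ?_ ?_ ?_ ?_ ?_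
  · simpa only [funext (deriv_valleyGerm D d)] using isGermSlope_quadratic hD hD' hlo'
  · simpa only [deriv_peakGerm, sub_sub_cancel] using isGermSlope_quadratic hD hD' hlo'
  · rw [valleyGerm_self hD, peakGerm_one_sub hD]; linarith [hd.1]
  · rw [valleyGerm_self hD, peakGerm_one_sub hD]; linarith [hd.2]
  · simp [valleyGerm]
  · simp [peakGerm]

theorem isLap_start_peak (hD : 0 < D) (hD' : D ≤ 1 / 14) {lo d k : ℝ} (hlo : 0 < lo)
    (hlo' : lo ≤ 1 / 2) (hk : lo ≤ k) (hk' : k * D ≤ 2 / 13) (hd : 0 ≤ d) :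
    IsLap D lo d True False (lapFun D (startGerm k) (peakGerm D)) := by
  have hkD : k ≤ D⁻¹ := by
    rw [← one_div, le_div_iff₀ hD]; linarith
  have hk0 : 0 ≤ k * D := mul_nonneg (hlo.le.trans hk) hD.le
  refine isLap_lapFun hD hD' (contDiff_startGerm k) (contDiff_peakGerm D) hlo hlo' ?_ ?_ ?_ ?_ ?_ ?_
  · simpa only [show deriv (startGerm k) = fun _ => k from funext (deriv_startGerm k)] using
      isGermSlope_const (hlo.trans_le hk) hkD hk
  · simpa only [deriv_peakGerm, sub_sub_cancel] using isGermSlope_quadratic hD hD' hlo'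
  · rw [startGerm, peakGerm_one_sub hD]; linarith
  · rw [startGerm, peakGerm_one_sub hD]; linarith
  · simp [startGerm, hd]
  · simp [peakGerm]

theorem isLap_valley_end (hD : 0 < D) (hD' : D ≤ 1 / 14) {lo d k : ℝ} (hlo : 0 < lo)
    (hlo' : lo ≤ 1 / 2) (hk : lo ≤ k) (hk' : k * D ≤ 2 / 13) (hd : d ∈ Icc (3 / 4 : ℝ) 1) :
    IsLap D lo d False True (lapFun D (valleyGerm D d) (endGerm k)) := by
  have hkD : k ≤ D⁻¹ := by
    rw [← one_div, le_div_iff₀ hD]; linarith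
  have hk0 : 0 ≤ k * D := mul_nonneg (hlo.le.trans hk) hD.le
  refine isLap_lapFun hD hD' (contDiff_valleyGerm D d) (contDiff_endGerm k) hlo hlo' ?_ ?_ ?_ ?_ ?_ ?_
  · simpa only [funext (deriv_valleyGerm D d)] using isGermSlope_quadratic hD hD' hlo'
  · simpa only [deriv_endGerm] using isGermSlope_const (hlo.trans_le hk) hkD hk
  · rw [valleyGerm_self hD, endGerm]; linarith [hd.1]
  · rw [valleyGerm_self hD, endGerm]; linarith [hd.2]
  · simp [valleyGerm]
  · simp [endGerm]

/-- The derivatives of the laps are bounded uniformly in `d` and `k`. -/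
theorem exists_abs_iteratedDeriv_lapFun_le (hD : 0 < D) (hD' : D ≤ 1 / 14) {j : ℕ} (hj : 1 ≤ j) :
    ∃ B, ∀ d ∈ Icc (3 / 4 : ℝ) 1, ∀ k : ℝ, 0 ≤ k → k * D ≤ 2 / 13 → ∀ u ∈ Icc (0 : ℝ) 1,
      |iteratedDeriv j (lapFun D (valleyGerm D d) (peakGerm D)) u| ≤ B ∧
      |iteratedDeriv j (lapFun D (startGerm k) (peakGerm D)) u| ≤ B ∧
      |iteratedDeriv j (lapFun D (valleyGerm D d) (endGerm k)) u| ≤ B := by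
  have hDi : 14 ≤ D⁻¹ := by rw [le_inv_comm₀ (by norm_num) hD]; linarith
  have c0 : ContDiff ℝ ∞ fun _ : ℝ => (1 : ℝ) := contDiff_const
  have c1 : ContDiff ℝ ∞ fun u : ℝ => 1 / (2 * D ^ 2) * u := contDiff_const.mul contDiff_id
  have c2 : ContDiff ℝ ∞ fun u : ℝ => 1 / (2 * D ^ 2) * (1 - u) :=
    contDiff_const.mul (contDiff_const.sub contDiff_id)
  obtain ⟨B1, h1⟩ := exists_abs_iteratedDeriv_connect_le (a := D) (b := 1 - D) (η := D / 50)
    (by linarith) (by linarith) c1 c2 (A := D⁻¹) (by positivity) (isCompact_Icc (a := 0) (b := 1)) hj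
  obtain ⟨B2, h2⟩ := exists_abs_iteratedDeriv_connect_le (a := D) (b := 1 - D) (η := D / 50)
    (by linarith) (by linarith) c0 c2 (A := D⁻¹) (by positivity) (isCompact_Icc (a := 0) (b := 1)) hj
  obtain ⟨B3, h3⟩ := exists_abs_iteratedDeriv_connect_le (a := D) (b := 1 - D) (η := D / 50)
    (by linarith) (by linarith) c1 c0 (A := D⁻¹) (by positivity) (isCompact_Icc (a := 0) (b := 1)) hj
  have hone : |(1 : ℝ)| ≤ D⁻¹ := by rw [abs_one]; linarith
  refine ⟨max B1 (max B2 B3), fun d hd k hk hk' u hu => ⟨?_, ?_, ?_⟩⟩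
  · refine (h1 _ _ 1 1 (contDiff_valleyGerm D d) (contDiff_peakGerm D)
      (fun t => by rw [deriv_valleyGerm, one_mul]) (fun t => by rw [deriv_peakGerm, one_mul])
      hone hone ?_ u hu).trans (le_max_left _ _)
    rw [valleyGerm_self hD, peakGerm_one_sub hD, abs_le]
    constructor <;> linarith [hd.1, hd.2]
  · have hkD : k ≤ D⁻¹ := by rw [← one_div, le_div_iff₀ hD]; linarith
    have hk0 : 0 ≤ k * D := mul_nonneg hk hD.le
    refine (h2 _ _ k 1 (contDiff_startGerm k) (contDiff_peakGerm D)
      (fun t => by rw [deriv_startGerm, mul_one]) (fun t => by rw [deriv_peakGerm, one_mul])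
      (by rwa [abs_of_nonneg hk]) hone ?_ u hu).trans ((le_max_left _ _).trans (le_max_right _ _))
    rw [startGerm, peakGerm_one_sub hD, abs_le]
    constructor <;> linarith
  · have hkD : k ≤ D⁻¹ := by rw [← one_div, le_div_iff₀ hD]; linarith
    have hk0 : 0 ≤ k * D := mul_nonneg hk hD.le
    refine (h3 _ _ 1 k (contDiff_valleyGerm D d) (contDiff_endGerm k)
      (fun t => by rw [deriv_valleyGerm, one_mul]) (fun t => by rw [deriv_endGerm, mul_one])
      hone (by rwa [abs_of_nonneg hk]) ?_ u hu).trans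
      ((le_max_right _ _).trans (le_max_right _ _))
    rw [valleyGerm_self hD, endGerm, abs_le]
    constructor <;> linarith [hd.1, hd.2]

end

end Ruette

/-! ### Existence of the oscillations -/

namespace Ruette

/-- The `j`-th lap, over `[j, j + 1]`, of the oscillation with `M_n` laps. It is extended smoothly
to the whole line. -/
noncomputable def piece (lam : ℝ) (r n j : ℕ) (t : ℝ) : ℝ :=
  if j = 0 then lapFun (delta lam r) (startGerm (slope lam r n)) (peakGerm (delta lam r)) t
  else if j + 1 = M lam n then
    lapFun (delta lam r) (valleyGerm (delta lam r) (m n)) (endGerm (slope lam r n)) (t - j)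
  else if Even j then
    lapFun (delta lam r) (valleyGerm (delta lam r) (m n)) (peakGerm (delta lam r)) (t - j)
  else lapFun (delta lam r) (valleyGerm (delta lam r) (m n)) (peakGerm (delta lam r)) (j + 1 - t)

/-- The quadratic germ at the local extremum `j`. -/
noncomputable def turn (lam : ℝ) (r n j : ℕ) (t : ℝ) : ℝ :=
  if Even j then -m n + 1 / (4 * delta lam r ^ 2) * (t - j) ^ 2
  else 1 - 1 / (4 * delta lam r ^ 2) * (t - j) ^ 2

/-- The index of the lap that contains `t`. -/
noncomputable def lapIndex (lam : ℝ) (n : ℕ) (t : ℝ) : ℕ := min ⌊t⌋₊ (M lam n - 1)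

/-- A choice of the oscillations, extended smoothly to the whole line. -/
noncomputable def oscillation (lam : ℝ) (r n : ℕ) (t : ℝ) : ℝ := piece lam r n (lapIndex lam n t) t

section

variable {lam : ℝ} {r : ℕ}

theorem m_mem {n : ℕ} (hn : 1 ≤ n) : m n ∈ Icc (3 / 4 : ℝ) 1 := by
  have h : (1 : ℝ) ≤ n := by exact_mod_cast hn
  have h1 : 1 / ((n : ℝ) + 1) ^ 2 ≤ 1 / 4 := by
    rw [div_le_div_iff₀ (by positivity) (by norm_num)]; nlinarith
  have h2 : 0 < 1 / ((n : ℝ) + 1) ^ 2 := by positivity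
  rw [m]
  constructor <;> linarith

theorem slope_pos (hlam : 14 ≤ lam) {n : ℕ} (hn : 1 ≤ n) : 0 < slope lam r n := by
  have := M_pos hlam hn
  have : 0 < lam := by linarith
  rw [slope]; positivity

theorem slope_mul_delta_le (hlam : 14 ≤ lam) {n : ℕ} (hn : 1 ≤ n) :
    slope lam r n * delta lam r ≤ 2 / 13 := by
  have h0 := M_pos hlam hn
  have h1 : (13 : ℝ) ≤ M lam n := by exact_mod_cast thirteen_le_M hlam hn
  have h2 : lam ^ r ≠ 0 := pow_ne_zero _ (by linarith)
  rw [slope, delta, div_mul_eq_mul_div, mul_assoc, mul_inv_cancel₀ h2, mul_one]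
  exact div_le_div_of_nonneg_left (by norm_num) (by norm_num) h1

theorem even_of_add_one_eq_M (hlam : 14 ≤ lam) {n : ℕ} (hn : 1 ≤ n) {j : ℕ} (hj : j + 1 = M lam n) :
    Even j := by
  have h1 := M_add_one hlam hn
  exact ⟨⌊lam ^ n / (2 * n ^ 2)⌋₊ - 1, by have := seven_le_floor hlam hn; omega⟩

theorem min_slope_pos (hlam : 14 ≤ lam) {n : ℕ} (hn : 1 ≤ n) :
    0 < min (1 / 2) (slope lam r n) := lt_min (by norm_num) (slope_pos hlam hn)

/-- On the even pieces the oscillation increases. -/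
theorem exists_piece_even (hlam : 14 ≤ lam) (hr : 1 ≤ r) {n : ℕ} (hn : 1 ≤ n) {j : ℕ}
    (hj : Even j) : ∃ P, IsLap (delta lam r) (min (1 / 2) (slope lam r n)) (m n) (j = 0)
      (j + 1 = M lam n) P ∧ ∀ t, piece lam r n j t = P (t - j) := by
  have hD := delta_pos (r := r) hlam
  have hD' := delta_le hlam hr
  have hlo := min_slope_pos (r := r) hlam hn
  have hk := slope_mul_delta_le (r := r) hlam hn
  have hM := thirteen_le_M hlam hn
  by_cases h0 : j = 0
  · subst h0
    have := isLap_start_peak hD hD' hlo (min_le_left _ _) (min_le_right _ _) hk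
      (d := m n) (by linarith [(m_mem hn).1])
    refine ⟨lapFun (delta lam r) (startGerm (slope lam r n)) (peakGerm (delta lam r)),
      ?_, fun t => ?_⟩
    rotate_left
    · simp only [piece, if_true, Nat.cast_zero, sub_zero]
    · rwa [eq_true (Eq.refl 0), eq_false (show ¬0 + 1 = M lam n by omega)]
  by_cases h1 : j + 1 = M lam n
  · have := isLap_valley_end hD hD' hlo (min_le_left _ _) (min_le_right _ _) hk (m_mem hn)
    refine ⟨lapFun (delta lam r) (valleyGerm (delta lam r) (m n)) (endGerm (slope lam r n)),
      ?_, fun t => ?_⟩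
    rotate_left
    · simp only [piece, if_neg h0, if_pos h1]
    · rwa [eq_false h0, eq_true h1]
  · have := isLap_valley_peak hD hD' hlo (min_le_left _ _) (m_mem hn)
    refine ⟨lapFun (delta lam r) (valleyGerm (delta lam r) (m n)) (peakGerm (delta lam r)),
      ?_, fun t => ?_⟩
    rotate_left
    · simp only [piece, if_neg h0, if_neg h1, if_pos hj]
    · rwa [eq_false h0, eq_false h1]

/-- On the odd pieces the oscillation decreases. -/
theorem exists_piece_odd (hlam : 14 ≤ lam) (hr : 1 ≤ r) {n : ℕ} (hn : 1 ≤ n) {j : ℕ}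
    (hj : ¬Even j) : ∃ P, IsLap (delta lam r) (min (1 / 2) (slope lam r n)) (m n) False False P ∧
      ∀ t, piece lam r n j t = P (j + 1 - t) := by
  have h0 : j ≠ 0 := by rintro rfl; exact hj Even.zero
  have h1 : j + 1 ≠ M lam n := fun h => hj (even_of_add_one_eq_M hlam hn h)
  exact ⟨_, isLap_valley_peak (delta_pos hlam) (delta_le hlam hr) (min_slope_pos hlam hn)
    (min_le_left _ _) (m_mem hn), fun t => by simp only [piece, if_neg h0, if_neg h1, if_neg hj]⟩

theorem contDiff_piece (n j : ℕ) : ContDiff ℝ ∞ (piece lam r n j) := by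
  unfold piece
  have h1 := contDiff_valleyGerm (delta lam r) (m n)
  have h2 := contDiff_peakGerm (delta lam r)
  have h3 := contDiff_startGerm (slope lam r n)
  have h4 := contDiff_endGerm (slope lam r n)
  split_ifs
  · exact contDiff_lapFun h3 h2
  · exact (contDiff_lapFun h1 h4).comp (contDiff_id.sub contDiff_const)
  · exact (contDiff_lapFun h1 h2).comp (contDiff_id.sub contDiff_const)
  · exact (contDiff_lapFun h1 h2).comp (contDiff_const.sub contDiff_id)

theorem piece_eq_turn_left (hlam : 14 ≤ lam) (hr : 1 ≤ r) {n j : ℕ} (hj : 1 ≤ j) {t : ℝ}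
    (ht : t ≤ j + delta lam r) : piece lam r n j t = turn lam r n j t := by
  have hD := delta_pos (r := r) hlam
  have hD' := delta_le hlam hr
  have h0 : j ≠ 0 := by omega
  have h1 := contDiff_valleyGerm (delta lam r) (m n)
  simp only [piece, if_neg h0, turn]
  split_ifs with h2 h3 h4
  · rw [lapFun_of_le hD hD' h1 (by linarith)]; rfl
  · exact absurd (even_of_add_one_eq_M hlam (n := n) (by
      rcases Nat.eq_zero_or_pos n with rfl | h
      · simp [M] at h2
      · exact h) h2) h3
  · rw [lapFun_of_le hD hD' h1 (by linarith)]; rfl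
  · rw [lapFun_of_ge hD hD' h1 (contDiff_peakGerm _) (by linarith), peakGerm]; ring

theorem piece_eq_turn_right (hlam : 14 ≤ lam) (hr : 1 ≤ r) {n j : ℕ} (hj : j + 1 ≠ M lam n)
    {t : ℝ} (ht : j + 1 - delta lam r ≤ t) : piece lam r n j t = turn lam r n (j + 1) t := by
  have hD := delta_pos (r := r) hlam
  have hD' := delta_le hlam hr
  have h1 := contDiff_valleyGerm (delta lam r) (m n)
  simp only [piece, if_neg hj, turn, Nat.even_add_one, Nat.cast_add, Nat.cast_one]
  by_cases h0 : j = 0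
  · subst h0
    simp only [Nat.cast_zero, zero_add] at ht
    simp only [if_true, Even.zero, not_true_eq_false, if_false, CharP.cast_eq_zero, zero_add]
    rw [lapFun_of_ge hD hD' (contDiff_startGerm _) (contDiff_peakGerm _) (by linarith), peakGerm]
  rw [if_neg h0]
  by_cases h2 : Even j
  · rw [if_pos h2, if_neg (not_not.2 h2),
      lapFun_of_ge hD hD' h1 (contDiff_peakGerm _) (by linarith), peakGerm]
    ring
  · rw [if_neg h2, if_pos h2, lapFun_of_le hD hD' h1 (by linarith), valleyGerm]
    ring

/-- The oscillation agrees with each piece beyond the ends of its lap, since neighbouring pieces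
have the same quadratic germ at their common turning point. -/
theorem oscillation_eq_piece (hlam : 14 ≤ lam) (hr : 1 ≤ r) {n : ℕ} {j : ℕ} (hj : j < M lam n)
    {t : ℝ} (h1 : j = 0 ∨ j - delta lam r ≤ t) (h2 : j + 1 = M lam n ∨ t ≤ j + 1 + delta lam r) :
    oscillation lam r n t = piece lam r n j t := by
  have hD := delta_pos (r := r) hlam
  have hD' := delta_le hlam hr
  rw [oscillation]
  rcases lt_trichotomy (lapIndex lam n t) j with h | h | h
  · have hi : lapIndex lam n t = ⌊t⌋₊ := by
      rw [lapIndex] at h ⊢; omega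
    have h3 := h1.resolve_left (by omega)
    have h4 := Nat.lt_floor_add_one t
    have h5 : j = ⌊t⌋₊ + 1 := by
      have : (j : ℝ) < (⌊t⌋₊ + 1 + 1 : ℕ) := by push_cast; linarith
      have := Nat.cast_lt.1 this
      omega
    rw [hi, h5]
    rw [h5] at h3
    push_cast at h3
    rw [piece_eq_turn_right hlam hr (by omega) h3, piece_eq_turn_left hlam hr (by omega)]
    push_cast
    linarith
  · rw [h]
  · have hi : lapIndex lam n t ≤ ⌊t⌋₊ := min_le_left _ _
    have hi' : lapIndex lam n t ≤ M lam n - 1 := min_le_right _ _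
    have h3 := h2.resolve_left (by omega)
    have h0 : 0 ≤ t := by
      by_contra hc
      rw [Nat.floor_of_nonpos (by linarith)] at hi
      omega
    have h4 : (lapIndex lam n t : ℝ) ≤ t := (Nat.cast_le.2 hi).trans (Nat.floor_le h0)
    have h5 : lapIndex lam n t = j + 1 := by
      have : (lapIndex lam n t : ℝ) < (j + 1 + 1 : ℕ) := by push_cast; linarith
      have := Nat.cast_lt.1 this
      omega
    rw [h5] at h4 ⊢
    push_cast at h4
    rw [piece_eq_turn_right hlam hr (by omega) (by linarith : (j : ℝ) + 1 - delta lam r ≤ t),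
      piece_eq_turn_left hlam hr (by omega)]
    push_cast
    linarith

theorem lapIndex_lt (hlam : 14 ≤ lam) {n : ℕ} (hn : 1 ≤ n) (t : ℝ) : lapIndex lam n t < M lam n :=
  (min_le_right _ _).trans_lt (by have := thirteen_le_M hlam hn; omega)

/-- A point of `[0, M_n]` lies in the lap of its index. -/
theorem sub_lapIndex_mem (hlam : 14 ≤ lam) {n : ℕ} (hn : 1 ≤ n) {t : ℝ}
    (ht : t ∈ Icc (0 : ℝ) (M lam n)) : t - lapIndex lam n t ∈ Icc (0 : ℝ) 1 := by
  have hM := thirteen_le_M hlam hn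
  have h1 : (lapIndex lam n t : ℝ) ≤ ⌊t⌋₊ := Nat.cast_le.2 (min_le_left _ _)
  refine ⟨by linarith [Nat.floor_le ht.1], ?_⟩
  rcases min_choice ⌊t⌋₊ (M lam n - 1) with h | h
  · rw [lapIndex, h]; linarith [Nat.lt_floor_add_one t]
  · rw [lapIndex, h, Nat.cast_sub (by omega)]; push_cast; linarith [ht.2]

theorem oscillation_eventuallyEq (hlam : 14 ≤ lam) (hr : 1 ≤ r) {n : ℕ} (hn : 1 ≤ n) (t : ℝ) :
    oscillation lam r n =ᶠ[𝓝 t] piece lam r n (lapIndex lam n t) := by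
  have hD := delta_pos (r := r) hlam
  have hlt := lapIndex_lt hlam hn t
  have e1 : ∀ᶠ u in 𝓝 t, lapIndex lam n t = 0 ∨ lapIndex lam n t - delta lam r ≤ u := by
    rcases Nat.eq_zero_or_pos (lapIndex lam n t) with h | h
    · exact Eventually.of_forall fun _ => Or.inl h
    · have hi : lapIndex lam n t ≤ ⌊t⌋₊ := min_le_left _ _
      have h0 : 0 ≤ t := by
        by_contra hc
        rw [Nat.floor_of_nonpos (by linarith)] at hi
        omega
      have h4 : (lapIndex lam n t : ℝ) ≤ t := (Nat.cast_le.2 hi).trans (Nat.floor_le h0)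
      exact (eventually_ge_nhds (by linarith)).mono fun u hu => Or.inr hu
  have e2 : ∀ᶠ u in 𝓝 t, lapIndex lam n t + 1 = M lam n ∨
      u ≤ lapIndex lam n t + 1 + delta lam r := by
    by_cases h : lapIndex lam n t + 1 = M lam n
    · exact Eventually.of_forall fun _ => Or.inl h
    · have hi : lapIndex lam n t = ⌊t⌋₊ := by
        rw [lapIndex] at h hlt ⊢; omega
      have h4 := Nat.lt_floor_add_one t
      rw [← hi] at h4
      exact (eventually_le_nhds (by linarith)).mono fun u hu => Or.inr hu
  filter_upwards [e1, e2] with u h1 h2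
  exact oscillation_eq_piece hlam hr hlt h1 h2

theorem contDiff_oscillation (hlam : 14 ≤ lam) (hr : 1 ≤ r) {n : ℕ} (hn : 1 ≤ n) :
    ContDiff ℝ ∞ (oscillation lam r n) :=
  contDiff_iff_contDiffAt.2 fun t =>
    (contDiff_piece n _).contDiffAt.congr_of_eventuallyEq (oscillation_eventuallyEq hlam hr hn t)

theorem oscillation_of_le (hlam : 14 ≤ lam) (hr : 1 ≤ r) {n : ℕ} (hn : 1 ≤ n) {t : ℝ}
    (ht : t ≤ delta lam r) : oscillation lam r n t = slope lam r n * t := by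
  have hD := delta_pos (r := r) hlam
  have hM := thirteen_le_M hlam hn
  rw [oscillation_eq_piece hlam hr (show 0 < M lam n by omega) (Or.inl rfl)
    (Or.inr (by push_cast; linarith)), piece, if_pos rfl,
    lapFun_of_le hD (delta_le hlam hr) (contDiff_startGerm _) ht, startGerm]

theorem oscillation_of_ge (hlam : 14 ≤ lam) (hr : 1 ≤ r) {n : ℕ} (hn : 1 ≤ n) {t : ℝ}
    (ht : M lam n - delta lam r ≤ t) :
    oscillation lam r n t = slope lam r n * (t - M lam n) + 1 := by
  have hD := delta_pos (r := r) hlam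
  have hM := thirteen_le_M hlam hn
  have h1 : ((M lam n - 1 : ℕ) : ℝ) = M lam n - 1 := by rw [Nat.cast_sub (by omega)]; simp
  rw [oscillation_eq_piece hlam hr (show M lam n - 1 < M lam n by omega)
    (Or.inr (by rw [h1]; linarith)) (Or.inl (by omega)), piece, if_neg (by omega),
    if_pos (by omega), lapFun_of_ge hD (delta_le hlam hr) (contDiff_valleyGerm _ _)
    (contDiff_endGerm _) (by rw [h1]; linarith), endGerm, h1]
  ring

theorem oscillation_eq_turn (hlam : 14 ≤ lam) (hr : 1 ≤ r) {n j : ℕ}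
    (hj : 0 < j) (hj' : j < M lam n) {t : ℝ} (ht : |t - j| ≤ delta lam r) :
    oscillation lam r n t = turn lam r n j t := by
  have hD := delta_pos (r := r) hlam
  have hD' := delta_le hlam hr
  rw [abs_le] at ht
  rw [oscillation_eq_piece hlam hr hj' (Or.inr (by linarith)) (Or.inr (by linarith)),
    piece_eq_turn_left hlam hr hj (by linarith)]

/-- The derivatives at `t` of the oscillation are up to sign those of a lap. -/
theorem exists_isLap_iteratedDeriv (hlam : 14 ≤ lam) (hr : 1 ≤ r) {n : ℕ} (hn : 1 ≤ n) {t : ℝ}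
    (ht : t ∈ Icc (0 : ℝ) (M lam n)) :
    ∃ P, ∃ u ∈ Icc (0 : ℝ) 1, IsLap (delta lam r) (min (1 / 2) (slope lam r n)) (m n)
      (lapIndex lam n t = 0) (lapIndex lam n t + 1 = M lam n) P ∧ oscillation lam r n t = P u ∧
      (|deriv (oscillation lam r n) t| = deriv P u) ∧
      ((∀ j : ℕ, 0 < j → j < M lam n → delta lam r ≤ |t - j|) →
        (lapIndex lam n t = 0 ∨ delta lam r ≤ u) ∧
        (lapIndex lam n t + 1 = M lam n ∨ u ≤ 1 - delta lam r)) := by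
  have hu := sub_lapIndex_mem hlam hn ht
  have he := oscillation_eventuallyEq hlam hr hn t
  have hlt := lapIndex_lt hlam hn t
  have hd := he.deriv_eq
  have hv := he.eq_of_nhds
  set j := lapIndex lam n t
  by_cases hj : Even j
  · obtain ⟨P, hP, hPt⟩ := exists_piece_even hlam hr hn hj
    refine ⟨P, t - j, hu, hP, hv.trans (hPt t), ?_, fun h => ⟨?_, ?_⟩⟩
    · rw [hd, show piece lam r n j = fun t => P (t - j) from funext hPt, deriv_comp_sub_const,
        abs_of_nonneg (hP.deriv_mem _ hu).1]
    · refine or_iff_not_imp_left.2 fun h0 => ?_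
      have := h j (by omega) hlt
      rwa [abs_of_nonneg hu.1] at this
    · refine or_iff_not_imp_left.2 fun h0 => ?_
      have := h (j + 1) (by omega) (by omega)
      push_cast at this
      rw [abs_of_nonpos (by linarith [hu.2])] at this
      linarith
  · obtain ⟨P, hP, hPt⟩ := exists_piece_odd hlam hr hn hj
    have hu' : (j : ℝ) + 1 - t ∈ Icc (0 : ℝ) 1 := ⟨by linarith [hu.2], by linarith [hu.1]⟩
    have h0 : j ≠ 0 := by intro h; rw [h] at hj; exact hj Even.zero
    have h1 : j + 1 ≠ M lam n := fun h => hj (even_of_add_one_eq_M hlam hn h)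
    refine ⟨P, j + 1 - t, hu', ?_, hv.trans (hPt t), ?_, fun h => ⟨Or.inr ?_, Or.inr ?_⟩⟩
    · rwa [eq_false h0, eq_false h1]
    · rw [hd, show piece lam r n j = fun t => P (j + 1 - t) from funext hPt,
        deriv_comp_const_sub, abs_neg, abs_of_nonneg (hP.deriv_mem _ hu').1]
    · have := h (j + 1) (by omega) (by omega)
      push_cast at this
      rw [abs_of_nonpos (by linarith [hu.2])] at this
      linarith
    · have := h j (by omega) hlt
      rw [abs_of_nonneg hu.1] at this
      linarith

theorem exists_abs_iteratedDeriv_oscillation_le (hlam : 14 ≤ lam) (hr : 1 ≤ r) {k : ℕ}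
    (hk : 1 ≤ k) : ∃ B, ∀ n ≥ 1, ∀ t ∈ Icc (0 : ℝ) (M lam n),
      |iteratedDeriv k (oscillation lam r n) t| ≤ B := by
  obtain ⟨B, hB⟩ := exists_abs_iteratedDeriv_lapFun_le (delta_pos (r := r) hlam)
    (delta_le hlam hr) hk
  refine ⟨B, fun n hn t ht => ?_⟩
  have hu := sub_lapIndex_mem hlam hn ht
  have hB' := hB (m n) (m_mem hn) (slope lam r n) (slope_pos hlam hn).le (slope_mul_delta_le hlam hn)
  rw [(oscillation_eventuallyEq hlam hr hn t).iteratedDeriv_eq k]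
  set j := lapIndex lam n t
  have hu' : (j : ℝ) + 1 - t ∈ Icc (0 : ℝ) 1 := ⟨by linarith [hu.2], by linarith [hu.1]⟩
  unfold piece
  split_ifs with h0 h1 h2
  · rw [h0] at hu
    simp only [Nat.cast_zero, sub_zero] at hu
    exact (hB' t hu).2.1
  · rw [iteratedDeriv_comp_sub_const]
    exact (hB' _ hu).2.2
  · rw [iteratedDeriv_comp_sub_const]
    exact (hB' _ hu).1
  · simp only [iteratedDeriv_comp_const_sub]
    rw [smul_eq_mul, abs_mul, abs_pow, abs_neg, abs_one, one_pow,
      one_mul]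
    exact (hB' _ hu').1

theorem isOscillation_oscillation (hlam : 14 ≤ lam) (hr : 1 ≤ r) :
    IsOscillation lam r (oscillation lam r) := by
  have hD := delta_pos (r := r) hlam
  have hD' := delta_le hlam hr
  have hder : ∀ n ≥ 1, ∀ t ∈ Icc (0 : ℝ) (M lam n),
      derivWithin (oscillation lam r n) (Icc 0 (M lam n)) t = deriv (oscillation lam r n) t :=
    fun n hn t ht => ((contDiff_oscillation hlam hr hn).differentiable
      (by simp)).differentiableAt.derivWithin (uniqueDiffOn_Icc (M_pos hlam hn) t ht)
  constructor
  · exact fun n hn => (contDiff_oscillation hlam hr hn).contDiffOn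
  · intro n hn t ht
    obtain ⟨P, u, hu, hP, he, -⟩ := exists_isLap_iteratedDeriv hlam hr hn ht
    rw [he]
    exact hP.mapsTo hu
  · intro n hn
    rw [oscillation_of_le hlam hr hn hD.le, mul_zero]
  · intro n hn
    rw [oscillation_of_ge hlam hr hn (by linarith), sub_self, mul_zero, zero_add]
  · intro n hn k hk
    obtain ⟨P, hP, hPt⟩ := exists_piece_even hlam hr hn (j := 2 * k) (even_two_mul k)
    push_cast at hPt
    have he : ∀ t ∈ Icc (2 * k : ℝ) (2 * k + 1), oscillation lam r n t = P (t - 2 * k) :=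
      fun t ht => (oscillation_eq_piece hlam hr (j := 2 * k) (by omega)
        (Or.inr (by push_cast; linarith [ht.1])) (Or.inr (by push_cast; linarith [ht.2]))).trans
        (hPt t)
    intro a ha b hb hab
    rw [he a ha, he b hb]
    exact hP.strictMonoOn ⟨by linarith [ha.1], by linarith [ha.2]⟩
      ⟨by linarith [hb.1], by linarith [hb.2]⟩ (by linarith)
  · intro n hn k hk
    obtain ⟨P, hP, hPt⟩ := exists_piece_odd hlam hr hn (j := 2 * k + 1) (by simp)
    push_cast at hPt
    have he : ∀ t ∈ Icc (2 * k + 1 : ℝ) (2 * k + 2),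
        oscillation lam r n t = P (2 * k + 1 + 1 - t) :=
      fun t ht => (oscillation_eq_piece hlam hr (j := 2 * k + 1) (by omega)
        (Or.inr (by push_cast; linarith [ht.1])) (Or.inr (by push_cast; linarith [ht.2]))).trans
        (hPt t)
    intro a ha b hb hab
    rw [he a ha, he b hb]
    exact hP.strictMonoOn ⟨by linarith [hb.2], by linarith [hb.1]⟩
      ⟨by linarith [ha.2], by linarith [ha.1]⟩ (by linarith)
  · intro n hn j hj hj' ho t ht
    rw [oscillation_eq_turn hlam hr hj hj' ht, turn, if_neg (Nat.not_even_iff_odd.2 ho)]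
  · intro n hn j hj hj' ho t ht
    rw [oscillation_eq_turn hlam hr hj hj' ht, turn, if_pos ho]
  · exact fun n hn t ht => oscillation_of_ge hlam hr hn ht.1
  · exact fun n hn t ht => oscillation_of_le hlam hr hn ht.2
  · intro k hk
    obtain ⟨B, hB⟩ := exists_abs_iteratedDeriv_oscillation_le hlam hr hk
    refine ⟨B, fun n hn t ht => ?_⟩
    rw [iteratedDerivWithin_eq_iteratedDeriv (uniqueDiffOn_Icc (M_pos hlam hn))
      ((contDiff_oscillation hlam hr hn).contDiffAt.of_le (by exact_mod_cast le_top)) ht]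
    exact hB n hn t ht
  · intro n hn t ht
    obtain ⟨P, u, hu, hP, -, hd, -⟩ := exists_isLap_iteratedDeriv hlam hr hn ht
    rw [hder n hn t ht, hd]
    exact (hP.deriv_mem u hu).2.trans_eq (by rw [delta, inv_inv])
  · intro n hn t ht hj
    obtain ⟨P, u, hu, hP, -, hd, h⟩ := exists_isLap_iteratedDeriv hlam hr hn ht
    rw [hder n hn t ht, hd]
    exact hP.le_deriv u hu (h hj).1 (h hj).2

end

end Ruette

/-! ### The outer branches of the map -/

namespace Ruette

/-- The germ of the map at the critical point `1/2`. -/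
noncomputable def topGerm (D t : ℝ) : ℝ := 4 - 3 / 2 * D⁻¹ * (t - 1 / 2) ^ 2

/-- The germ of the map on the left of the critical point `1`. -/
noncomputable def flatGerm (D : ℝ) (r : ℕ) (t : ℝ) : ℝ := (D ^ (2 * r - 1))⁻¹ * (t - 1) ^ (2 * r)

/-- The increasing branch of the map over `[0, 1/2]`. -/
noncomputable def leftBranch (lam : ℝ) (r : ℕ) : ℝ → ℝ :=
  connect (5 / 2 * delta lam r) (1 / 2 - delta lam r) (delta lam r / 50) (fun t => lam ^ r * t)
    (topGerm (delta lam r))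

/-- The decreasing branch of the map over `[1/2, 1]`. -/
noncomputable def middleBranch (lam : ℝ) (r : ℕ) (t : ℝ) : ℝ :=
  -connect (1 / 2 + delta lam r) (1 - delta lam r) (delta lam r / 50)
    (fun t => -topGerm (delta lam r) t) (fun t => -flatGerm (delta lam r) r t) t

/-- The increasing branch of the map over `[y_1, 4]`. -/
noncomputable def rightBranch (lam : ℝ) (r : ℕ) : ℝ → ℝ :=
  connect (5 / 2) (4 - 3 / 2 * delta lam r) (delta lam r / 50)
    (fun t => (lam ^ r)⁻¹ * (5 / 2) + 2 * (t - 5 / 2)) (fun t => 4 + lam ^ r * (t - 4))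

theorem contDiff_topGerm (D : ℝ) : ContDiff ℝ ∞ (topGerm D) :=
  contDiff_const.sub (contDiff_const.mul ((contDiff_id.sub contDiff_const).pow 2))

theorem contDiff_flatGerm (D : ℝ) (r : ℕ) : ContDiff ℝ ∞ (flatGerm D r) :=
  contDiff_const.mul ((contDiff_id.sub contDiff_const).pow (2 * r))

theorem contDiff_affine (a b c : ℝ) : ContDiff ℝ ∞ fun t : ℝ => a + b * (t - c) :=
  contDiff_const.add (contDiff_const.mul (contDiff_id.sub contDiff_const))

theorem deriv_affine (a b c t : ℝ) : deriv (fun t : ℝ => a + b * (t - c)) t = b :=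
  ((((hasDerivAt_id t).sub_const c).const_mul b).const_add a).deriv.trans (mul_one b)

theorem deriv_topGerm (D t : ℝ) : deriv (topGerm D) t = 3 * D⁻¹ * (1 / 2 - t) := by
  refine (((((hasDerivAt_id t).sub_const (1 / 2)).pow 2).const_mul (3 / 2 * D⁻¹)).const_sub
    4).deriv.trans ?_
  norm_num
  ring

theorem deriv_flatGerm (D : ℝ) (r : ℕ) (t : ℝ) :
    deriv (flatGerm D r) t = (D ^ (2 * r - 1))⁻¹ * (2 * r * (t - 1) ^ (2 * r - 1)) := by
  refine ((((hasDerivAt_id t).sub_const 1).pow (2 * r)).const_mul _).deriv.trans ?_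
  simp

theorem deriv_const_mul_id (c t : ℝ) : deriv (fun t : ℝ => c * t) t = c :=
  ((hasDerivAt_id t).const_mul c).deriv.trans (mul_one c)

section

variable {lam : ℝ} {r : ℕ}

theorem fourteen_le_lam_pow (hlam : 14 ≤ lam) (hr : 1 ≤ r) : 14 ≤ lam ^ r :=
  hlam.trans (lam_pow_ge hlam hr)

theorem delta_inv : (delta lam r)⁻¹ = lam ^ r := inv_inv _

theorem lam_pow_mul_delta (hlam : 14 ≤ lam) : lam ^ r * delta lam r = 1 :=
  mul_inv_cancel₀ (pow_ne_zero _ (by linarith))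

theorem contDiff_leftBranch : ContDiff ℝ ∞ (leftBranch lam r) :=
  contDiff_connect (contDiff_const.mul contDiff_id) (contDiff_topGerm _)

theorem leftBranch_of_le (hlam : 14 ≤ lam) (hr : 1 ≤ r) {t : ℝ} (ht : t ≤ 5 / 2 * delta lam r) :
    leftBranch lam r t = lam ^ r * t := by
  have hD := delta_pos (r := r) hlam
  have hD' := delta_le hlam hr
  exact connect_of_le (by linarith) (by linarith) (contDiff_const.mul contDiff_id) ht

theorem leftBranch_of_ge (hlam : 14 ≤ lam) (hr : 1 ≤ r) {t : ℝ} (ht : 1 / 2 - delta lam r ≤ t) :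
    leftBranch lam r t = topGerm (delta lam r) t := by
  have hD := delta_pos (r := r) hlam
  have hD' := delta_le hlam hr
  exact connect_of_ge (by linarith) (by linarith) (contDiff_const.mul contDiff_id)
    (contDiff_topGerm _) ht

theorem deriv_leftBranch_mem (hlam : 14 ≤ lam) (hr : 1 ≤ r) {t : ℝ}
    (ht : t ∈ Icc (5 / 2 * delta lam r) (1 / 2 - delta lam r)) :
    deriv (leftBranch lam r) t ∈ Icc (3 / 2) (lam ^ r) := by
  have hD := delta_pos (r := r) hlam
  have hD' := delta_le hlam hr
  have hK := fourteen_le_lam_pow hlam hr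
  have hKD := lam_pow_mul_delta (r := r) hlam
  have hL : ContDiff ℝ ∞ fun t : ℝ => lam ^ r * t := contDiff_const.mul contDiff_id
  rw [leftBranch, deriv_connect hL (contDiff_topGerm _)]
  refine connectDeriv_mem (by linarith) (by linarith) hL (contDiff_topGerm _) (by norm_num)
    (by linarith) (fun u _ => ?_) (fun u hu => ?_) ?_ ?_ ht
  · rw [deriv_const_mul_id]; exact ⟨by linarith, le_rfl⟩
  · rw [deriv_topGerm, delta_inv]
    have h1 := mul_le_mul_of_nonneg_left hu.1 (by linarith : 0 ≤ lam ^ r)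
    have h2 := mul_le_mul_of_nonneg_left hu.2 (by linarith : 0 ≤ lam ^ r)
    constructor <;> linarith
  · rw [topGerm, delta_inv]
    nlinarith
  · rw [topGerm, delta_inv]
    nlinarith

theorem leftBranch_mem (hlam : 14 ≤ lam) (hr : 1 ≤ r) {t : ℝ} (ht : t ∈ Icc (0 : ℝ) (1 / 2)) :
    leftBranch lam r t ∈ Icc (0 : ℝ) 4 := by
  have hD := delta_pos (r := r) hlam
  have hD' := delta_le hlam hr
  have hL : ContDiff ℝ ∞ fun t : ℝ => lam ^ r * t := contDiff_const.mul contDiff_id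
  have hK := fourteen_le_lam_pow hlam hr
  have hm : MonotoneOn (leftBranch lam r) (Icc 0 (1 / 2)) := by
    refine monotoneOn_connect hL (contDiff_topGerm _) (convex_Icc _ _) fun u hu => ?_
    rw [interior_Icc] at hu
    rcases le_total u (5 / 2 * delta lam r) with h | h
    · rw [connectDeriv_of_le (by linarith) (by linarith) h, deriv_const_mul_id]
      linarith
    rcases le_total u (1 / 2 - delta lam r) with h' | h'
    · have := (deriv_leftBranch_mem hlam hr ⟨h, h'⟩).1
      rw [leftBranch, deriv_connect hL (contDiff_topGerm _)] at this
      linarith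
    · rw [connectDeriv_of_ge (by linarith) (by linarith) h', deriv_topGerm]
      exact mul_nonneg (by positivity) (by linarith [hu.2])
  have h0 := hm ⟨le_rfl, by norm_num⟩ ht ht.1
  have h1 := hm ht ⟨by norm_num, le_rfl⟩ ht.2
  rw [leftBranch_of_le hlam hr (by linarith)] at h0
  rw [leftBranch_of_ge hlam hr (t := 1 / 2) (by linarith), topGerm] at h1
  constructor <;> linarith

theorem contDiff_middleBranch : ContDiff ℝ ∞ (middleBranch lam r) :=
  (contDiff_connect (contDiff_topGerm _).neg (contDiff_flatGerm _ _).neg).neg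

theorem middleBranch_of_le (hlam : 14 ≤ lam) (hr : 1 ≤ r) {t : ℝ} (ht : t ≤ 1 / 2 + delta lam r) :
    middleBranch lam r t = topGerm (delta lam r) t := by
  have hD := delta_pos (r := r) hlam
  have hD' := delta_le hlam hr
  rw [middleBranch, connect_of_le (by linarith) (by linarith) (contDiff_topGerm _).neg ht, neg_neg]

theorem middleBranch_of_ge (hlam : 14 ≤ lam) (hr : 1 ≤ r) {t : ℝ} (ht : 1 - delta lam r ≤ t) :
    middleBranch lam r t = flatGerm (delta lam r) r t := by
  have hD := delta_pos (r := r) hlam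
  have hD' := delta_le hlam hr
  rw [middleBranch, connect_of_ge (by linarith) (by linarith) (contDiff_topGerm _).neg
    (contDiff_flatGerm _ _).neg ht, neg_neg]

theorem deriv_middleBranch (t : ℝ) : deriv (middleBranch lam r) t =
    -connectDeriv (1 / 2 + delta lam r) (1 - delta lam r) (delta lam r / 50)
      (fun t => -topGerm (delta lam r) t) (fun t => -flatGerm (delta lam r) r t) t :=
  (hasDerivAt_connect (contDiff_topGerm _).neg (contDiff_flatGerm _ _).neg t).neg.deriv

theorem flatGerm_one_sub (hlam : 14 ≤ lam) (hr : 1 ≤ r) :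
    flatGerm (delta lam r) r (1 - delta lam r) = delta lam r := by
  have hD := delta_pos (r := r) hlam
  obtain ⟨k, hk⟩ : ∃ k, 2 * r = k + 1 := ⟨2 * r - 1, by omega⟩
  have h : (1 - delta lam r - 1) ^ (2 * r) = delta lam r ^ (2 * r) := by
    rw [← (even_two_mul r).neg_pow (delta lam r)]; congr 1; ring
  rw [flatGerm, h, hk, Nat.add_sub_cancel, pow_succ]
  field_simp

theorem neg_deriv_flatGerm (hr : 1 ≤ r) (t : ℝ) : -deriv (flatGerm (delta lam r) r) t =
    2 * r * ((1 - t) / delta lam r) ^ (2 * r - 1) := by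
  have : (t - 1) ^ (2 * r - 1) = -(1 - t) ^ (2 * r - 1) := by
    rw [← (show Odd (2 * r - 1) from ⟨r - 1, by omega⟩).neg_pow]; congr 1; ring
  rw [deriv_flatGerm, this, div_pow, div_eq_mul_inv]
  ring

/-- The slope bound for the flat germ `δ^{1-2r} (x - 1)^{2r}` at distance at most `51/50 δ` of `1`. -/
theorem two_mul_mul_pow_le (hlam : 14 ≤ lam) (hr : 1 ≤ r) :
    2 * r * (51 / 50 : ℝ) ^ (2 * r - 1) ≤ lam ^ r := by
  have h1 : (2 * r : ℝ) ≤ 2 ^ r := by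
    obtain ⟨k, rfl⟩ : ∃ k, r = k + 1 := ⟨r - 1, by omega⟩
    have : k + 1 ≤ 2 ^ k := Nat.lt_two_pow_self
    have : ((k + 1 : ℕ) : ℝ) ≤ 2 ^ k := by exact_mod_cast this
    rw [pow_succ]; linarith
  have h2 : (51 / 50 : ℝ) ^ (2 * r - 1) ≤ 2 ^ r := by
    calc (51 / 50 : ℝ) ^ (2 * r - 1) ≤ (51 / 50) ^ (2 * r) :=
          pow_le_pow_right₀ (by norm_num) (Nat.sub_le _ _)
      _ = ((51 / 50) ^ 2) ^ r := pow_mul _ _ _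
      _ ≤ 2 ^ r := pow_le_pow_left₀ (by norm_num) (by norm_num) r
  calc 2 * r * (51 / 50 : ℝ) ^ (2 * r - 1) ≤ 2 ^ r * 2 ^ r := by gcongr
    _ = 4 ^ r := by rw [← mul_pow]; norm_num
    _ ≤ lam ^ r := pow_le_pow_left₀ (by norm_num) (by linarith) r

theorem deriv_middleBranch_mem (hlam : 14 ≤ lam) (hr : 1 ≤ r) {t : ℝ}
    (ht : t ∈ Icc (1 / 2 + delta lam r) (1 - delta lam r)) :
    deriv (middleBranch lam r) t ∈ Icc (-lam ^ r) (-(3 / 2)) := by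
  have hD := delta_pos (r := r) hlam
  have hD' := delta_le hlam hr
  have hK := fourteen_le_lam_pow hlam hr
  have hKD := lam_pow_mul_delta (r := r) hlam
  have hr' : (1 : ℝ) ≤ r := by exact_mod_cast hr
  rw [deriv_middleBranch]
  have : connectDeriv (1 / 2 + delta lam r) (1 - delta lam r) (delta lam r / 50)
      (fun t => -topGerm (delta lam r) t) (fun t => -flatGerm (delta lam r) r t) t ∈
      Icc (3 / 2) (lam ^ r) := by
    refine connectDeriv_mem (by linarith) (by linarith) (contDiff_topGerm _).neg
      (contDiff_flatGerm _ _).neg (by norm_num)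
      (by linarith) (fun u hu => ?_) (fun u hu => ?_) ?_ ?_ ht
    · rw [deriv.fun_neg, deriv_topGerm, delta_inv]
      have h1 := mul_le_mul_of_nonneg_left hu.1 (by linarith : 0 ≤ lam ^ r)
      have h2 := mul_le_mul_of_nonneg_left hu.2 (by linarith : 0 ≤ lam ^ r)
      constructor <;> linarith
    · rw [deriv.fun_neg, neg_deriv_flatGerm hr]
      have h1 : 1 ≤ (1 - u) / delta lam r := by rw [le_div_iff₀ hD]; linarith [hu.2]
      have h2 : (1 - u) / delta lam r ≤ 51 / 50 := by rw [div_le_iff₀ hD]; linarith [hu.1]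
      constructor
      · have := one_le_pow₀ h1 (n := 2 * r - 1)
        nlinarith
      · refine le_trans ?_ (two_mul_mul_pow_le hlam hr)
        exact mul_le_mul_of_nonneg_left (pow_le_pow_left₀ (by linarith) h2 _) (by linarith)
    · rw [flatGerm_one_sub hlam hr, topGerm, delta_inv]
      nlinarith
    · rw [flatGerm_one_sub hlam hr, topGerm, delta_inv]
      nlinarith
  exact ⟨neg_le_neg this.2, neg_le_neg this.1⟩

theorem middleBranch_mem (hlam : 14 ≤ lam) (hr : 1 ≤ r) {t : ℝ} (ht : t ∈ Icc (1 / 2 : ℝ) 1) :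
    middleBranch lam r t ∈ Icc (0 : ℝ) 4 := by
  have hD := delta_pos (r := r) hlam
  have hD' := delta_le hlam hr
  have hm : MonotoneOn (connect (1 / 2 + delta lam r) (1 - delta lam r) (delta lam r / 50)
      (fun t => -topGerm (delta lam r) t) (fun t => -flatGerm (delta lam r) r t))
      (Icc (1 / 2) 1) := by
    refine monotoneOn_connect (contDiff_topGerm _).neg (contDiff_flatGerm _ _).neg
      (convex_Icc _ _) fun u hu => ?_
    rw [interior_Icc] at hu
    rcases le_total u (1 / 2 + delta lam r) with h | h
    · rw [connectDeriv_of_le (by linarith) (by linarith) h, deriv.fun_neg, deriv_topGerm,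
        ← mul_neg]
      exact mul_nonneg (by positivity) (by linarith [hu.1])
    rcases le_total u (1 - delta lam r) with h' | h'
    · have := (deriv_middleBranch_mem hlam hr ⟨h, h'⟩).2
      rw [deriv_middleBranch] at this
      linarith
    · rw [connectDeriv_of_ge (by linarith) (by linarith) h', deriv.fun_neg, neg_deriv_flatGerm hr]
      have : 0 ≤ (1 - u) / delta lam r := div_nonneg (by linarith [hu.2]) hD.le
      positivity
  have h0 := neg_le_neg (hm ⟨le_rfl, by norm_num⟩ ht ht.1)
  have h1 := neg_le_neg (hm ht ⟨by norm_num, le_rfl⟩ ht.2)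
  have e0 : middleBranch lam r (1 / 2) = 4 := by
    rw [middleBranch_of_le hlam hr (by linarith), topGerm]; norm_num
  have e1 : middleBranch lam r 1 = 0 := by
    rw [middleBranch_of_ge hlam hr (by linarith), flatGerm, sub_self, zero_pow (by omega), mul_zero]
  rw [middleBranch] at e0 e1
  rw [middleBranch]
  constructor <;> linarith

theorem contDiff_rightBranch : ContDiff ℝ ∞ (rightBranch lam r) :=
  contDiff_connect (contDiff_affine _ _ _) (contDiff_affine _ _ _)

theorem rightBranch_of_le (hlam : 14 ≤ lam) (hr : 1 ≤ r) {t : ℝ} (ht : t ≤ 5 / 2) :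
    rightBranch lam r t = (lam ^ r)⁻¹ * (5 / 2) + 2 * (t - 5 / 2) := by
  have hD := delta_pos (r := r) hlam
  have hD' := delta_le hlam hr
  exact connect_of_le (by linarith) (by linarith) (contDiff_affine _ _ _) ht

theorem rightBranch_of_ge (hlam : 14 ≤ lam) (hr : 1 ≤ r) {t : ℝ}
    (ht : 4 - 3 / 2 * delta lam r ≤ t) : rightBranch lam r t = 4 + lam ^ r * (t - 4) := by
  have hD := delta_pos (r := r) hlam
  have hD' := delta_le hlam hr
  exact connect_of_ge (by linarith) (by linarith) (contDiff_affine _ _ _) (contDiff_affine _ _ _) ht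

theorem deriv_rightBranch_mem (hlam : 14 ≤ lam) (hr : 1 ≤ r) {t : ℝ} (ht : 5 / 2 ≤ t) :
    deriv (rightBranch lam r) t ∈ Icc (3 / 2) (lam ^ r) := by
  have hD := delta_pos (r := r) hlam
  have hD' := delta_le hlam hr
  have hK := fourteen_le_lam_pow hlam hr
  have hKD := lam_pow_mul_delta (r := r) hlam
  rw [rightBranch, deriv_connect (contDiff_affine _ _ _) (contDiff_affine _ _ _)]
  rcases le_total (4 - 3 / 2 * delta lam r) t with h | h
  · rw [connectDeriv_of_ge (by linarith) (by linarith) h, deriv_affine]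
    exact ⟨by linarith, le_rfl⟩
  refine connectDeriv_mem (by linarith) (by linarith) (contDiff_affine _ _ _)
    (contDiff_affine _ _ _) (by norm_num)
    (by linarith) (fun u hu => ?_) (fun u hu => ?_) ?_ ?_ ⟨ht, h⟩
  · rw [deriv_affine]; constructor <;> linarith
  · rw [deriv_affine]; constructor <;> linarith
  · rw [← delta]
    nlinarith
  · rw [← delta]
    nlinarith

theorem rightBranch_mem (hlam : 14 ≤ lam) (hr : 1 ≤ r) {t : ℝ} (ht : t ∈ Icc (5 / 2 : ℝ) 4) :
    rightBranch lam r t ∈ Icc (0 : ℝ) 4 := by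
  have hD := delta_pos (r := r) hlam
  have hm : MonotoneOn (rightBranch lam r) (Icc (5 / 2) 4) := by
    refine monotoneOn_connect (contDiff_affine _ _ _) (contDiff_affine _ _ _) (convex_Icc _ _)
      fun u hu => ?_
    have := (deriv_rightBranch_mem hlam hr (interior_subset hu).1).1
    rw [rightBranch, deriv_connect (contDiff_affine _ _ _) (contDiff_affine _ _ _)] at this
    linarith
  have h0 := hm ⟨le_rfl, by norm_num⟩ ht ht.1
  have h1 := hm ht ⟨by norm_num, le_rfl⟩ ht.2
  rw [rightBranch_of_le hlam hr le_rfl, ← delta] at h0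
  rw [rightBranch_of_ge hlam hr (t := 4) (by linarith), sub_self, mul_zero] at h1
  constructor <;> linarith

end

end Ruette

/-! ### The map between consecutive points `y_{n+1}` and `y_n` -/

namespace Ruette

/-- The affine germ of the map at `y_n`. -/
noncomputable def lineGerm (lam : ℝ) (r n : ℕ) (t : ℝ) : ℝ :=
  (lam ^ (n * r))⁻¹ * (y n + 2 * lam ^ r * (t - y n))

/-- The initial slope of the normalized link over `[w_n, x_n]`: the slope `2 λ^{-nr}` of the affine
germ at `y_{n+1}` times `(x_n - w_n) / (f(x_n) - f(w_n))`. The final slope, which continues the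
germ of the oscillation at `x_n`, is `λ^r` times as large. -/
noncomputable def linkSlope (lam : ℝ) (r n : ℕ) : ℝ :=
  2 * (x n - w lam r n) / (x n * (1 - delta lam r))

/-- The normalized link over `[w_n, x_n]`. -/
noncomputable def link (lam : ℝ) (r n : ℕ) : ℝ → ℝ :=
  connect 0 1 (delta lam r / 50) (startGerm (linkSlope lam r n))
    (endGerm (lam ^ r * linkSlope lam r n))

/-- The link over `[w_n, x_n]`, extended smoothly to the whole line. -/
noncomputable def joint (lam : ℝ) (r n : ℕ) (t : ℝ) : ℝ :=
  (lam ^ (n * r))⁻¹ * x n * (delta lam r +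
    (1 - delta lam r) * link lam r n ((t - w lam r n) / (x n - w lam r n)))

/-- The oscillating part over `[x_n, y_n]`, extended smoothly to the whole line. -/
noncomputable def wave (lam : ℝ) (r n : ℕ) (t : ℝ) : ℝ :=
  (lam ^ (n * r))⁻¹ *
    (x n + (y n - x n) * oscillation lam r n (M lam n * ((t - x n) / (y n - x n))))

/-- The map over `[y_{n+1}, y_n]`, extended smoothly to the whole line. -/
noncomputable def zone (lam : ℝ) (r n : ℕ) (t : ℝ) : ℝ :=
  if t ≤ x n then joint lam r n t else wave lam r n t

/-- The oscillating part is affine at distance at most `germRadius` of its ends. -/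
noncomputable def germRadius (lam : ℝ) (r n : ℕ) : ℝ := (y n - x n) * delta lam r / M lam n

section

variable {lam : ℝ} {r : ℕ}

theorem germRadius_pos (hlam : 14 ≤ lam) {n : ℕ} (hn : 1 ≤ n) : 0 < germRadius lam r n :=
  div_pos (mul_pos (sub_pos.2 (x_lt_y hn)) (delta_pos hlam)) (M_pos hlam hn)

theorem inv_pow_succ_mul (lam : ℝ) (r n : ℕ) :
    (lam ^ ((n + 1) * r))⁻¹ = (lam ^ (n * r))⁻¹ * delta lam r := by
  rw [delta, add_mul, one_mul, pow_add, mul_inv]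

theorem x_mul_pos (hlam : 14 ≤ lam) (hr : 1 ≤ r) {n : ℕ} (hn : 1 ≤ n) :
    0 < x n * (1 - delta lam r) :=
  mul_pos (by linarith [one_lt_x hn]) (by linarith [delta_le hlam hr])

theorem linkSlope_pos (hlam : 14 ≤ lam) (hr : 1 ≤ r) {n : ℕ} (hn : 1 ≤ n) :
    0 < linkSlope lam r n :=
  div_pos (mul_pos two_pos (sub_pos.2 (w_lt_x hlam hn))) (x_mul_pos hlam hr hn)

theorem linkSlope_le (hlam : 14 ≤ lam) (hr : 1 ≤ r) {n : ℕ} (hn : 1 ≤ n) :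
    linkSlope lam r n ≤ 9 / 10 := by
  have hD := delta_pos (r := r) hlam
  have hD' := delta_le hlam hr
  rw [linkSlope, div_le_iff₀ (x_mul_pos hlam hr hn)]
  have h1 := y_succ_lt_w (r := r) hlam hn
  have h2 : x n - y (n + 1) ≤ 3 / 8 := by
    have hn' : (1 : ℝ) ≤ n := by exact_mod_cast hn
    rw [x_sub_y_succ hn, div_le_div_iff₀ (by positivity) (by norm_num)]
    nlinarith [mul_nonneg (by linarith : (0 : ℝ) ≤ n - 1) (by linarith : (0 : ℝ) ≤ n),
      mul_nonneg (by linarith : (0 : ℝ) ≤ n - 1) (by positivity : (0 : ℝ) ≤ (n : ℝ) ^ 2)]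
  have h3 := one_lt_x hn
  nlinarith

theorem contDiff_link (n : ℕ) : ContDiff ℝ ∞ (link lam r n) :=
  contDiff_connect (contDiff_startGerm _) (contDiff_endGerm _)

theorem link_of_le (hlam : 14 ≤ lam) (hr : 1 ≤ r) (n : ℕ) {u : ℝ} (hu : u ≤ 0) :
    link lam r n u = linkSlope lam r n * u := by
  have hD := delta_pos (r := r) hlam
  have hD' := delta_le hlam hr
  exact connect_of_le (by linarith) (by linarith) (contDiff_startGerm _) hu

theorem link_of_ge (hlam : 14 ≤ lam) (hr : 1 ≤ r) (n : ℕ) {u : ℝ} (hu : 1 ≤ u) :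
    link lam r n u = lam ^ r * linkSlope lam r n * (u - 1) + 1 := by
  have hD := delta_pos (r := r) hlam
  have hD' := delta_le hlam hr
  exact connect_of_ge (by linarith) (by linarith) (contDiff_startGerm _) (contDiff_endGerm _) hu

theorem deriv_link (n : ℕ) : deriv (link lam r n) = connectDeriv 0 1 (delta lam r / 50)
    (startGerm (linkSlope lam r n)) (endGerm (lam ^ r * linkSlope lam r n)) :=
  deriv_connect (contDiff_startGerm _) (contDiff_endGerm _)

theorem deriv_link_zero (hlam : 14 ≤ lam) (hr : 1 ≤ r) (n : ℕ) :
    deriv (link lam r n) 0 = linkSlope lam r n := by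
  have hD := delta_pos (r := r) hlam
  have hD' := delta_le hlam hr
  rw [deriv_link, connectDeriv_of_le (by linarith) (by linarith) le_rfl, deriv_startGerm]

theorem deriv_link_mem (hlam : 14 ≤ lam) (hr : 1 ≤ r) {n : ℕ} (hn : 1 ≤ n) {u : ℝ}
    (hu : u ∈ Icc (0 : ℝ) 1) :
    deriv (link lam r n) u ∈ Icc (2 / 3 * linkSlope lam r n) (lam ^ r) := by
  have hD := delta_pos (r := r) hlam
  have hD' := delta_le hlam hr
  have hK := fourteen_le_lam_pow hlam hr
  have hKD := lam_pow_mul_delta (r := r) hlam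
  have hp := linkSlope_pos hlam hr hn
  have hp' := linkSlope_le hlam hr hn
  rw [deriv_link]
  refine connectDeriv_mem (by linarith) (by linarith) (contDiff_startGerm _) (contDiff_endGerm _)
    (by linarith) (by linarith) (fun v _ => ?_) (fun v _ => ?_) ?_ ?_ hu
  · rw [deriv_startGerm]; constructor <;> linarith
  · rw [deriv_endGerm]; constructor <;> nlinarith
  · simp only [startGerm, endGerm]
    nlinarith
  · simp only [startGerm, endGerm]
    nlinarith

theorem link_mem (hlam : 14 ≤ lam) (hr : 1 ≤ r) {n : ℕ} (hn : 1 ≤ n) {u : ℝ}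
    (hu : u ∈ Icc (0 : ℝ) 1) : link lam r n u ∈ Icc (0 : ℝ) 1 := by
  have hD := delta_pos (r := r) hlam
  have hD' := delta_le hlam hr
  have hp := linkSlope_pos hlam hr hn
  have := connect_mem_Icc (a := 0) (b := 1) (η := delta lam r / 50) (by linarith) (by linarith)
    (contDiff_startGerm (linkSlope lam r n)) (contDiff_endGerm (lam ^ r * linkSlope lam r n))
    (fun v hv => by
      have := (deriv_link_mem hlam hr hn hv).1
      rw [deriv_link] at this
      linarith) hu
  have e0 : startGerm (linkSlope lam r n) 0 = 0 := mul_zero _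
  have e1 : endGerm (lam ^ r * linkSlope lam r n) 1 = 1 := by simp [endGerm]
  rwa [e0, e1] at this

theorem exists_abs_iteratedDeriv_link_le (hlam : 14 ≤ lam) (hr : 1 ≤ r) {k : ℕ} (hk : 1 ≤ k) :
    ∃ B, ∀ n ≥ 1, ∀ u ∈ Icc (0 : ℝ) 1, |iteratedDeriv k (link lam r n) u| ≤ B := by
  have hD := delta_pos (r := r) hlam
  have hD' := delta_le hlam hr
  have hK := fourteen_le_lam_pow hlam hr
  have c0 : ContDiff ℝ ∞ fun _ : ℝ => (1 : ℝ) := contDiff_const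
  obtain ⟨B, hB⟩ := exists_abs_iteratedDeriv_connect_le (a := 0) (b := 1) (η := delta lam r / 50)
    (by linarith) (by linarith) c0 c0 (A := lam ^ r) (by linarith)
    (isCompact_Icc (a := 0) (b := 1)) hk
  refine ⟨B, fun n hn u hu => ?_⟩
  have hp := linkSlope_pos hlam hr hn
  have hp' := linkSlope_le hlam hr hn
  refine hB _ _ (linkSlope lam r n) (lam ^ r * linkSlope lam r n) (contDiff_startGerm _)
    (contDiff_endGerm _) (fun t => by rw [deriv_startGerm, mul_one])
    (fun t => by rw [deriv_endGerm, mul_one]) ?_ ?_ ?_ u hu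
  · rw [abs_of_pos hp]; linarith
  · rw [abs_of_pos (by positivity)]; nlinarith
  · simp only [startGerm, endGerm, mul_zero, sub_self, zero_add, sub_zero, abs_one]
    linarith

theorem contDiff_joint (n : ℕ) : ContDiff ℝ ∞ (joint lam r n) :=
  contDiff_const.mul (contDiff_const.add (contDiff_const.mul
    ((contDiff_link n).comp ((contDiff_id.sub contDiff_const).div_const _))))

theorem contDiff_wave (hlam : 14 ≤ lam) (hr : 1 ≤ r) {n : ℕ} (hn : 1 ≤ n) :
    ContDiff ℝ ∞ (wave lam r n) :=
  contDiff_const.mul (contDiff_const.add (contDiff_const.mul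
    ((contDiff_oscillation hlam hr hn).comp (contDiff_const.mul
      ((contDiff_id.sub contDiff_const).div_const _)))))

/-- The link continues the affine germ at `y_{n+1}`. -/
theorem joint_of_le (hlam : 14 ≤ lam) (hr : 1 ≤ r) {n : ℕ} (hn : 1 ≤ n) {t : ℝ}
    (ht : t ≤ w lam r n) : joint lam r n t = lineGerm lam r (n + 1) t := by
  have h1 : x n - w lam r n ≠ 0 := (sub_pos.2 (w_lt_x hlam hn)).ne'
  have hD' := delta_le hlam hr
  have h2 : 1 - delta lam r ≠ 0 := by linarith
  have h3 : x n ≠ 0 := by linarith [one_lt_x hn]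
  have h4 := w_sub_y_succ (r := r) hlam hn
  have hKD := lam_pow_mul_delta (r := r) hlam
  have hw : w lam r n = y (n + 1) + (x n - y (n + 1)) * (delta lam r / 2) := by
    rw [mul_inv, ← delta] at h4; linarith
  rw [joint, link_of_le hlam hr n (div_nonpos_of_nonpos_of_nonneg (by linarith)
    (sub_pos.2 (w_lt_x hlam hn)).le), lineGerm, inv_pow_succ_mul, linkSlope]
  have e : x n * (delta lam r + (1 - delta lam r) * (2 * (x n - w lam r n) /
      (x n * (1 - delta lam r)) * ((t - w lam r n) / (x n - w lam r n)))) =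
      x n * delta lam r + 2 * (t - w lam r n) := by
    field_simp
  rw [mul_assoc, e, mul_assoc, hw]
  congr 1
  linear_combination (-2 * (t - y (n + 1))) * hKD

theorem joint_of_ge (hlam : 14 ≤ lam) (hr : 1 ≤ r) {n : ℕ} (hn : 1 ≤ n) {t : ℝ}
    (ht : x n ≤ t) :
    joint lam r n t = (lam ^ (n * r))⁻¹ * (x n + 2 * lam ^ r * (t - x n)) := by
  have h1 : 0 < x n - w lam r n := sub_pos.2 (w_lt_x hlam hn)
  have hD' := delta_le hlam hr
  have h2 : 1 - delta lam r ≠ 0 := by linarith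
  have h3 : x n ≠ 0 := by linarith [one_lt_x hn]
  rw [joint, link_of_ge hlam hr n (by rw [le_div_iff₀ h1]; linarith), linkSlope]
  have h1' := h1.ne'
  rw [mul_assoc]
  congr 1
  field_simp
  ring

/-- The oscillation continues the final germ of the link. -/
theorem wave_of_le (hlam : 14 ≤ lam) (hr : 1 ≤ r) {n : ℕ} (hn : 1 ≤ n) {t : ℝ}
    (ht : t ≤ x n + germRadius lam r n) :
    wave lam r n t = (lam ^ (n * r))⁻¹ * (x n + 2 * lam ^ r * (t - x n)) := by
  have h1 : 0 < y n - x n := sub_pos.2 (x_lt_y hn)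
  have hM := M_pos hlam hn
  have h2 : (M lam n : ℝ) * ((t - x n) / (y n - x n)) ≤ delta lam r := by
    rw [← sub_le_iff_le_add', germRadius, le_div_iff₀ hM] at ht
    rw [← mul_div_assoc, div_le_iff₀ h1]
    linarith
  rw [wave, oscillation_of_le hlam hr hn h2]
  congr 2
  have h3 := M_mul_slope (r := r) hlam hn
  have h1' := h1.ne'
  field_simp
  linear_combination (t - x n) * h3

theorem wave_of_ge (hlam : 14 ≤ lam) (hr : 1 ≤ r) {n : ℕ} (hn : 1 ≤ n) {t : ℝ}
    (ht : y n - germRadius lam r n ≤ t) : wave lam r n t = lineGerm lam r n t := by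
  have h1 : 0 < y n - x n := sub_pos.2 (x_lt_y hn)
  have hM := M_pos hlam hn
  have h2 : (M lam n : ℝ) - delta lam r ≤ M lam n * ((t - x n) / (y n - x n)) := by
    have : y n - t ≤ germRadius lam r n := by linarith
    rw [germRadius, le_div_iff₀ hM] at this
    rw [← mul_div_assoc, le_div_iff₀ h1]
    linarith
  rw [wave, oscillation_of_ge hlam hr hn h2, lineGerm]
  congr 1
  have h3 := M_mul_slope (r := r) hlam hn
  have h1' := h1.ne'
  field_simp
  linear_combination (t - y n) * h3

theorem zone_eq_joint (hlam : 14 ≤ lam) (hr : 1 ≤ r) {n : ℕ} (hn : 1 ≤ n) {t : ℝ}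
    (ht : t ≤ x n + germRadius lam r n) : zone lam r n t = joint lam r n t := by
  rw [zone]
  split_ifs with h
  · rfl
  · rw [wave_of_le hlam hr hn ht, joint_of_ge hlam hr hn (not_le.1 h).le]

theorem zone_eq_wave (hlam : 14 ≤ lam) (hr : 1 ≤ r) {n : ℕ} (hn : 1 ≤ n) {t : ℝ}
    (ht : x n ≤ t) : zone lam r n t = wave lam r n t := by
  rw [zone]
  split_ifs with h
  · rw [wave_of_le hlam hr hn (h.trans (by linarith [germRadius_pos (r := r) hlam hn])),
      joint_of_ge hlam hr hn ht]
  · rfl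

theorem contDiff_zone (hlam : 14 ≤ lam) (hr : 1 ≤ r) {n : ℕ} (hn : 1 ≤ n) :
    ContDiff ℝ ∞ (zone lam r n) := by
  have hg := germRadius_pos (r := r) hlam hn
  refine contDiff_iff_contDiffAt.2 fun t => ?_
  rcases lt_or_ge (x n) t with h | h
  · exact (contDiff_wave hlam hr hn).contDiffAt.congr_of_eventuallyEq
      ((eventually_ge_nhds h).mono fun u hu => zone_eq_wave hlam hr hn hu)
  · exact (contDiff_joint n).contDiffAt.congr_of_eventuallyEq
      ((eventually_le_nhds (show t < x n + germRadius lam r n by linarith)).mono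
        fun u hu => zone_eq_joint hlam hr hn hu)

theorem zone_of_le (hlam : 14 ≤ lam) (hr : 1 ≤ r) {n : ℕ} (hn : 1 ≤ n) {t : ℝ}
    (ht : t ≤ w lam r n) : zone lam r n t = lineGerm lam r (n + 1) t := by
  rw [zone, if_pos (ht.trans (w_lt_x hlam hn).le), joint_of_le hlam hr hn ht]

theorem germRadius_lt (hlam : 14 ≤ lam) (hr : 1 ≤ r) {n : ℕ} (hn : 1 ≤ n) :
    germRadius lam r n < y n - x n := by
  have h1 : 0 < y n - x n := sub_pos.2 (x_lt_y hn)
  have h2 : (13 : ℝ) ≤ M lam n := by exact_mod_cast thirteen_le_M hlam hn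
  rw [germRadius, div_lt_iff₀ (M_pos hlam hn)]
  exact mul_lt_mul_of_pos_left (by linarith [delta_le hlam hr]) h1

theorem zone_of_ge (hlam : 14 ≤ lam) (hr : 1 ≤ r) {n : ℕ} (hn : 1 ≤ n) {t : ℝ}
    (ht : y n - germRadius lam r n ≤ t) : zone lam r n t = lineGerm lam r n t := by
  rw [zone_eq_wave hlam hr hn (by linarith [germRadius_lt hlam hr hn]), wave_of_ge hlam hr hn ht]

theorem zone_mem (hlam : 14 ≤ lam) (hr : 1 ≤ r) {n : ℕ} (hn : 1 ≤ n) {t : ℝ}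
    (ht : t ∈ Icc (y (n + 1)) (y n)) : zone lam r n t ∈ Icc (0 : ℝ) 4 := by
  have hD := delta_pos (r := r) hlam
  have hD' := delta_le hlam hr
  have hx := one_lt_x hn
  have hxl := x_le hn
  have hy := y_le hn
  have hy' := one_lt_y (n := n + 1) (by omega)
  have hxy := x_lt_y hn
  have hκ : 0 ≤ (lam ^ (n * r))⁻¹ := inv_nonneg.2 (pow_nonneg (by linarith) _)
  have hκ' : (lam ^ (n * r))⁻¹ ≤ 1 := inv_le_one_of_one_le₀ (one_le_pow₀ (by linarith))
  have hκ2 : 0 ≤ (lam ^ ((n + 1) * r))⁻¹ := inv_nonneg.2 (pow_nonneg (by linarith) _)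
  have hκ2' : (lam ^ ((n + 1) * r))⁻¹ ≤ 1 := inv_le_one_of_one_le₀ (one_le_pow₀ (by linarith))
  have key : ∀ a b : ℝ, 0 ≤ a → a ≤ 1 → 0 ≤ b → b ≤ 4 → a * b ∈ Icc (0 : ℝ) 4 :=
    fun a b h0 h1 h2 h3 => ⟨mul_nonneg h0 h2, (mul_le_of_le_one_left h2 h1).trans h3⟩
  rcases le_total t (w lam r n) with h | h
  · rw [zone_of_le hlam hr hn h, lineGerm]
    have h4 := w_sub_y_succ (r := r) hlam hn
    have hK : 0 < lam ^ r := pow_pos (by linarith) r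
    have h5 : 2 * lam ^ r * (w lam r n - y (n + 1)) = x n - y (n + 1) := by
      rw [h4]; field_simp
    have h6 : 0 ≤ 2 * lam ^ r * (t - y (n + 1)) :=
      mul_nonneg (by positivity) (by linarith [ht.1])
    have h7 : 2 * lam ^ r * (t - y (n + 1)) ≤ 2 * lam ^ r * (w lam r n - y (n + 1)) :=
      mul_le_mul_of_nonneg_left (by linarith) (by positivity)
    exact key _ _ hκ2 hκ2' (by linarith) (by linarith)
  rcases le_total t (x n) with h' | h'
  · rw [zone_eq_joint hlam hr hn (by linarith [germRadius_pos (r := r) hlam hn]), joint, mul_assoc]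
    have hwx := w_lt_x (r := r) hlam hn
    have hl := link_mem hlam hr hn (u := (t - w lam r n) / (x n - w lam r n))
      ⟨div_nonneg (by linarith) (by linarith), by rw [div_le_one (by linarith)]; linarith⟩
    have h1 : 0 ≤ (1 - delta lam r) * link lam r n ((t - w lam r n) / (x n - w lam r n)) :=
      mul_nonneg (by linarith) hl.1
    have h2 : (1 - delta lam r) * link lam r n ((t - w lam r n) / (x n - w lam r n)) ≤
        1 - delta lam r := mul_le_of_le_one_right (by linarith) hl.2
    exact key _ _ hκ hκ' (mul_nonneg (by linarith) (by linarith)) (by nlinarith)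
  · rw [zone_eq_wave hlam hr hn h', wave]
    have hM := M_pos hlam hn
    have h3 := (isOscillation_oscillation hlam hr).mapsTo n hn
      (show (M lam n : ℝ) * ((t - x n) / (y n - x n)) ∈ Icc (0 : ℝ) (M lam n) from
        ⟨mul_nonneg hM.le (div_nonneg (by linarith) (by linarith)),
          mul_le_of_le_one_right hM.le (by rw [div_le_one (by linarith)]; linarith [ht.2])⟩)
    have h4 := mul_le_mul_of_nonneg_left h3.1 (by linarith : 0 ≤ y n - x n)
    have h5 := mul_le_mul_of_nonneg_left h3.2 (by linarith : 0 ≤ y n - x n)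
    have h6 := x_sub_m_mul hn
    exact key _ _ hκ hκ' (by linarith) (by linarith)

end

end Ruette

/-! ### Existence of the maps -/

namespace Ruette

open Classical in
/-- One of the maps of the construction. -/
noncomputable def standardMap (lam : ℝ) (r : ℕ) (t : ℝ) : ℝ :=
  if t ≤ 1 / 2 then leftBranch lam r t
  else if t ≤ 1 then middleBranch lam r t
  else if h : ∃ n, 1 ≤ n ∧ t ∈ Ioc (y (n + 1)) (y n) then zone lam r h.choose t
  else rightBranch lam r t

section

variable {lam : ℝ} {r : ℕ}

theorem standardMap_eq_left {t : ℝ} (ht : t ≤ 1 / 2) :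
    standardMap lam r t = leftBranch lam r t := by
  rw [standardMap, if_pos ht]

theorem standardMap_eq_middle (hlam : 14 ≤ lam) (hr : 1 ≤ r) {t : ℝ}
    (ht : 1 / 2 - delta lam r ≤ t) (ht' : t ≤ 1) :
    standardMap lam r t = middleBranch lam r t := by
  rw [standardMap]
  split_ifs with h
  · rw [leftBranch_of_ge hlam hr ht,
      middleBranch_of_le hlam hr (by linarith [delta_pos (r := r) hlam])]
  · rfl

theorem standardMap_eq_zone_of_mem {n : ℕ} (hn : 1 ≤ n) {t : ℝ}
    (ht : t ∈ Ioc (y (n + 1)) (y n)) : standardMap lam r t = zone lam r n t := by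
  have h1 : 1 < t := (one_lt_y (by omega)).trans ht.1
  have h : ∃ n, 1 ≤ n ∧ t ∈ Ioc (y (n + 1)) (y n) := ⟨n, hn, ht⟩
  rw [standardMap, if_neg (by linarith), if_neg (by linarith), dif_pos h]
  congr 1
  obtain ⟨h2, h3⟩ := h.choose_spec
  set j := h.choose
  -- The intervals `(y_{n+1}, y_n]` are pairwise disjoint.
  have key : ∀ a b : ℕ, 1 ≤ a → t ∈ Ioc (y (a + 1)) (y a) → t ∈ Ioc (y (b + 1)) (y b) → ¬a < b := by
    intro a b ha hta htb hab
    rcases Nat.lt_or_ge (a + 1) b with h' | h'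
    · linarith [y_strictAnti (by omega : 1 ≤ a + 1) h', hta.1, htb.2]
    · have : b = a + 1 := by omega
      subst this
      linarith [hta.1, htb.2]
  have := key j n h2 h3 ht
  have := key n j hn ht h3
  omega

/-- The formula for the map on `(y_{n+1}, y_n]` is valid slightly beyond `y_{n+1}`. -/
theorem standardMap_eq_zone (hlam : 14 ≤ lam) (hr : 1 ≤ r) {n : ℕ} (hn : 1 ≤ n) {t : ℝ}
    (ht : y (n + 1) - germRadius lam r (n + 1) < t) (ht' : t ≤ y n) :
    standardMap lam r t = zone lam r n t := by
  rcases lt_or_ge (y (n + 1)) t with h | h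
  · exact standardMap_eq_zone_of_mem hn ⟨h, ht'⟩
  · have h1 := germRadius_lt hlam hr (n := n + 1) (by omega)
    have h2 := y_succ_lt_x (n := n + 1) (by omega)
    rw [standardMap_eq_zone_of_mem (n := n + 1) (by omega) ⟨by linarith, h⟩,
      zone_of_ge hlam hr (by omega) ht.le,
      zone_of_le hlam hr hn (h.trans (y_succ_lt_w hlam hn).le)]

/-- The formula for the map on `[y_1, 4]` is valid slightly beyond `y_1`. -/
theorem standardMap_eq_right (hlam : 14 ≤ lam) (hr : 1 ≤ r) {t : ℝ}
    (ht : 5 / 2 - germRadius lam r 1 < t) : standardMap lam r t = rightBranch lam r t := by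
  have hK : lam ^ r ≠ 0 := pow_ne_zero _ (by linarith)
  rcases lt_or_ge (5 / 2) t with h | h
  · have : ¬∃ n, 1 ≤ n ∧ t ∈ Ioc (y (n + 1)) (y n) := by
      rintro ⟨n, hn, h'⟩
      linarith [y_le hn, h'.2]
    rw [standardMap, if_neg (by linarith), if_neg (by linarith), dif_neg this]
  · have h1 := germRadius_lt hlam hr le_rfl
    have h2 := y_succ_lt_x le_rfl
    rw [← y_one] at ht h
    rw [standardMap_eq_zone_of_mem le_rfl ⟨by linarith, h⟩, zone_of_ge hlam hr le_rfl ht.le,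
      rightBranch_of_le hlam hr (by rwa [← y_one]), lineGerm, y_one, one_mul]
    field_simp

/-- Near each point other than `1` the map agrees with a smooth function. -/
theorem contDiffAt_standardMap (hlam : 14 ≤ lam) (hr : 1 ≤ r) {t : ℝ} (h1 : t ≠ 1) :
    ContDiffAt ℝ ∞ (standardMap lam r) t := by
  have hD := delta_pos (r := r) hlam
  rcases lt_or_ge t (1 / 2) with h | h
  · exact contDiff_leftBranch.contDiffAt.congr_of_eventuallyEq
      ((eventually_le_nhds h).mono fun u hu => standardMap_eq_left hu)
  rcases lt_or_gt_of_ne h1 with h' | h'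
  · refine (contDiff_middleBranch (lam := lam) (r := r)).contDiffAt.congr_of_eventuallyEq ?_
    filter_upwards [eventually_ge_nhds (show 1 / 2 - delta lam r < t by linarith),
      eventually_le_nhds h'] with u hu hu'
    exact standardMap_eq_middle hlam hr hu hu'
  rcases lt_or_ge t (5 / 2) with h'' | h''
  · obtain ⟨n, hn, h2, h3⟩ := exists_mem_Ioc_y h' (h''.le.trans_eq y_one.symm)
    rcases h3.lt_or_eq with h4 | h4
    · refine (contDiff_zone hlam hr hn).contDiffAt.congr_of_eventuallyEq ?_
      filter_upwards [eventually_gt_nhds h2, eventually_le_nhds h4] with u hu hu'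
      exact standardMap_eq_zone_of_mem hn ⟨hu, hu'⟩
    · obtain ⟨k, rfl⟩ : ∃ k, n = k + 1 := ⟨n - 1, by omega⟩
      have hk : 1 ≤ k := by
        rcases Nat.eq_zero_or_pos k with rfl | hk
        · rw [zero_add, y_one] at h4; linarith
        · exact hk
      have hg := germRadius_pos (r := r) hlam hn
      refine (contDiff_zone hlam hr hk).contDiffAt.congr_of_eventuallyEq ?_
      filter_upwards [eventually_gt_nhds (show y (k + 1) - germRadius lam r (k + 1) < t by
        linarith), eventually_le_nhds (show t < y k by
          linarith [y_strictAnti hk (Nat.lt_succ_self k)])] with u hu hu'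
      exact standardMap_eq_zone hlam hr hk hu hu'
  · have hg := germRadius_pos (r := r) hlam le_rfl
    exact contDiff_rightBranch.contDiffAt.congr_of_eventuallyEq
      ((eventually_gt_nhds (show 5 / 2 - germRadius lam r 1 < t by linarith)).mono
        fun u hu => standardMap_eq_right hlam hr hu)

theorem derivWithin_standardMap (hlam : 14 ≤ lam) (hr : 1 ≤ r) {t : ℝ} (h1 : t ≠ 1)
    (ht : t ∈ Icc (0 : ℝ) 4) :
    derivWithin (standardMap lam r) (Icc 0 4) t = deriv (standardMap lam r) t :=
  ((contDiffAt_standardMap hlam hr h1).differentiableAt (by simp)).derivWithin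
    (uniqueDiffOn_Icc (by norm_num) t ht)

/-- The normalization over `[w_n, x_n]` is the link. -/
theorem phi_standardMap (hlam : 14 ≤ lam) (hr : 1 ≤ r) {n : ℕ} (hn : 1 ≤ n) {u : ℝ}
    (hu : u ∈ Icc (0 : ℝ) 1) : phi lam r (standardMap lam r) n u = link lam r n u := by
  have hD' := delta_le hlam hr
  have hwx := w_lt_x (r := r) hlam hn
  have hyw := y_succ_lt_w (r := r) hlam hn
  have hxy := x_lt_y hn
  have hg := germRadius_pos (r := r) hlam hn
  have hκ : 0 < (lam ^ (n * r))⁻¹ := inv_pos.2 (pow_pos (by linarith) _)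
  have hx := one_lt_x hn
  have hl : 0 < x n - w lam r n := by linarith
  have e : ∀ v ∈ Icc (0 : ℝ) 1, standardMap lam r (w lam r n + (x n - w lam r n) * v) =
      (lam ^ (n * r))⁻¹ * x n * (delta lam r + (1 - delta lam r) * link lam r n v) := by
    intro v hv
    have h1 := mul_nonneg hl.le hv.1
    have h2 := mul_le_of_le_one_right hl.le hv.2
    rw [standardMap_eq_zone_of_mem hn ⟨by linarith, by linarith⟩,
      zone_eq_joint hlam hr hn (by linarith), joint, add_sub_cancel_left,
      mul_div_cancel_left₀ _ hl.ne']
  have e0 := e 0 ⟨le_rfl, zero_le_one⟩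
  have e1 := e 1 ⟨zero_le_one, le_rfl⟩
  rw [link_of_le hlam hr n le_rfl, mul_zero, mul_zero, mul_zero, add_zero, add_zero] at e0
  rw [link_of_ge hlam hr n le_rfl, sub_self, mul_zero, zero_add, mul_one, mul_one,
    add_sub_cancel, add_sub_cancel] at e1
  rw [phi, e u hu, e0, e1]
  have h2 : 1 - delta lam r ≠ 0 := by linarith
  have h3 : x n ≠ 0 := by linarith
  have h4 := hκ.ne'
  have h5 : (lam ^ (n * r))⁻¹ * x n * 1 - (lam ^ (n * r))⁻¹ * x n * delta lam r ≠ 0 := by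
    rw [← mul_sub]
    exact mul_ne_zero (mul_ne_zero h4 h3) h2
  rw [inv_mul_eq_iff_eq_mul₀ h5]
  ring

theorem derivWithin_phi_standardMap (hlam : 14 ≤ lam) (hr : 1 ≤ r) {n : ℕ} (hn : 1 ≤ n) {u : ℝ}
    (hu : u ∈ Icc (0 : ℝ) 1) :
    derivWithin (phi lam r (standardMap lam r) n) (Icc 0 1) u = deriv (link lam r n) u := by
  rw [derivWithin_congr (fun v hv => phi_standardMap hlam hr hn hv) (phi_standardMap hlam hr hn hu)]
  exact ((contDiff_link n).differentiable (by simp)).differentiableAt.derivWithin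
    (uniqueDiffOn_Icc zero_lt_one u hu)

theorem isMap_standardMap (hlam : 14 ≤ lam) (hr : 1 ≤ r) : IsMap lam r (standardMap lam r) := by
  have hD := delta_pos (r := r) hlam
  have hD' := delta_le hlam hr
  constructor
  · intro t ht
    rcases le_total t (1 / 2) with h | h
    · rw [standardMap_eq_left h]; exact leftBranch_mem hlam hr ⟨ht.1, h⟩
    rcases le_or_gt t 1 with h' | h'
    · rw [standardMap_eq_middle hlam hr (by linarith) h']; exact middleBranch_mem hlam hr ⟨h, h'⟩
    rcases le_total t (5 / 2) with h'' | h''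
    · obtain ⟨n, hn, hm⟩ := exists_mem_Ioc_y h' (h''.trans_eq y_one.symm)
      rw [standardMap_eq_zone_of_mem hn hm]
      exact zone_mem hlam hr hn (Ioc_subset_Icc_self hm)
    · rw [standardMap_eq_right hlam hr (by linarith [germRadius_pos (r := r) hlam le_rfl])]
      exact rightBranch_mem hlam hr ⟨h'', ht.2⟩
  · exact fun t ht => (contDiffAt_standardMap hlam hr ht.2).contDiffWithinAt
  · refine ⟨oscillation lam r, isOscillation_oscillation hlam hr, fun n hn t ht => ?_⟩
    rw [standardMap_eq_zone_of_mem hn ⟨(y_succ_lt_x hn).trans_le ht.1, ht.2⟩,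
      zone_eq_wave hlam hr hn ht.1, wave]
  · intro n hn t ht
    have hg := germRadius_pos (r := r) hlam (n := n + 1) (by omega)
    rw [standardMap_eq_zone hlam hr hn (by linarith [ht.1])
      (ht.2.trans ((w_lt_x hlam hn).trans (x_lt_y hn)).le), zone_of_le hlam hr hn ht.2, lineGerm,
      mul_assoc _ (M lam (n + 1) : ℝ), M_mul_slope hlam (by omega)]
    ring
  · intro k hk
    obtain ⟨B, hB⟩ := exists_abs_iteratedDeriv_link_le hlam hr hk
    refine ⟨B, fun n hn t ht => ?_⟩
    rw [iteratedDerivWithin_congr (fun v hv => phi_standardMap hlam hr hn hv) ht,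
      iteratedDerivWithin_eq_iteratedDeriv (uniqueDiffOn_Icc zero_lt_one)
        ((contDiff_link n).contDiffAt.of_le (by exact_mod_cast le_top)) ht]
    exact hB n hn t ht
  · intro n hn t ht
    rw [derivWithin_phi_standardMap hlam hr hn ht,
      derivWithin_phi_standardMap hlam hr hn ⟨le_rfl, zero_le_one⟩, deriv_link_zero hlam hr]
    exact deriv_link_mem hlam hr hn ht
  · intro t ht
    rw [standardMap_eq_left (by linarith [ht.2]), leftBranch_of_le hlam hr ht.2]
  · intro t ht
    rw [abs_le] at ht
    rw [standardMap_eq_middle hlam hr (by linarith) (by linarith),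
      middleBranch_of_le hlam hr (by linarith), topGerm]
  · intro t ht
    rw [standardMap_eq_middle hlam hr (by linarith [ht.1]) ht.2, middleBranch_of_ge hlam hr ht.1,
      flatGerm]
  · intro t ht
    have hg := germRadius_pos (r := r) hlam le_rfl
    rw [standardMap_eq_right hlam hr (by linarith [ht.1]), rightBranch_of_ge hlam hr ht.1]
  · intro t ht
    have he : standardMap lam r =ᶠ[𝓝 t] leftBranch lam r :=
      (eventually_le_nhds (show t < 1 / 2 by linarith [ht.2])).mono
        fun u hu => standardMap_eq_left hu
    rw [derivWithin_standardMap hlam hr (by linarith [ht.2]) ⟨by linarith [ht.1], by linarith [ht.2]⟩,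
      he.deriv_eq]
    exact deriv_leftBranch_mem hlam hr ht
  · intro t ht
    have he : standardMap lam r =ᶠ[𝓝 t] middleBranch lam r := by
      filter_upwards [eventually_ge_nhds (show 1 / 2 - delta lam r < t by linarith [ht.1]),
        eventually_le_nhds (show t < 1 by linarith [ht.2])] with u hu hu'
      exact standardMap_eq_middle hlam hr hu hu'
    rw [derivWithin_standardMap hlam hr (by linarith [ht.2]) ⟨by linarith [ht.1], by linarith [ht.2]⟩,
      he.deriv_eq]
    exact deriv_middleBranch_mem hlam hr ht
  · intro t ht
    have hg := germRadius_pos (r := r) hlam le_rfl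
    rw [y_one] at ht
    have he : standardMap lam r =ᶠ[𝓝 t] rightBranch lam r :=
      (eventually_gt_nhds (show 5 / 2 - germRadius lam r 1 < t by linarith [ht.1])).mono
        fun u hu => standardMap_eq_right hlam hr hu
    rw [derivWithin_standardMap hlam hr (by linarith [ht.1]) ⟨by linarith [ht.1], ht.2⟩,
      he.deriv_eq]
    exact deriv_rightBranch_mem hlam hr ht.1

end

end Ruette

/-! ### Conclusion -/

theorem proposition3p6 (lam : ℝ) (hlam : 14 ≤ lam) (r : ℕ) (hr : 1 ≤ r) :
    (∃ f : ℝ → ℝ, Ruette.IsMap lam r f) ∧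
    ∀ (f : ℝ → ℝ) (hf : Ruette.IsMap lam r f),
      ContDiffOn ℝ r f (Icc 0 4) ∧
      derivSpectralRadius (Icc 0 4) f = lam ^ r ∧
      localEntropy (hf.mapsTo.restrict f (Icc 0 4) (Icc 0 4)) =
        ((Real.log (derivSpectralRadius (Icc 0 4) f) / r : ℝ) : EReal) ∧
      Real.log (derivSpectralRadius (Icc 0 4) f) / r = Real.log lam ∧
      Dynamics.coverEntropy (hf.mapsTo.restrict f (Icc 0 4) (Icc 0 4)) univ =
        ((Real.log lam : ℝ) : EReal) := by
  refine ⟨⟨_, Ruette.isMap_standardMap hlam hr⟩, fun f hf => ?_⟩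
  have hR := hf.derivSpectralRadius_eq hlam hr
  have hlog : Real.log (derivSpectralRadius (Icc 0 4) f) / r = Real.log lam := by
    have : (r : ℝ) ≠ 0 := by positivity
    rw [hR, Real.log_pow, mul_div_cancel_left₀ _ this]
  have h1 := hf.log_le_localEntropy hlam
  have h2 := localEntropy_le_coverEntropy (hf.mapsTo.restrict f (Icc 0 4) (Icc 0 4))
  have h3 := hf.coverEntropy_le hlam hr
  refine ⟨hf.contDiffOn hlam hr, hR, ?_, hlog, le_antisymm h3 (h1.trans h2)⟩
  rw [hlog]
  exact le_antisymm (h2.trans h3) h1
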